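/- Let $\Omega\subset\mathbb R^d$ be open, let $T>0$ and $\gamma>0$, and let $\mathcal U\subset L_2(\Omega)$ be closed and convex with $0\in\mathcal U$. Let $H^1_0(\Omega)$ be the closure of $C_c^\infty(\Omega)$ in the $H^1$-norm, with dual $H^{-1}(\Omega)$. For a measurable set $\omega\subset\Omega$, a control $u\in L_2(0,T;L_2(\Omega))$ and $f\in H^1_0(\Omega)$, let $y^{u,f,\omega}$ be the weak solution of $\partial_t y-\Delta y=\chi_\omega u$ in $\Omega\times(0,T]$, $y=0$ on $\partial\Omega\times(0,T]$, $y(0)=f$; that is, $y\in L_2(0,T;H^1_0(\Omega))$, $\partial_t y\in L_2(0,T;H^{-1}(\Omega))$, $y(0)=f$, and for all $\varphi\in H^1_0(\Omega)$ and a.e. $t\in(0,T)$ $$\langle\partial_t y(t),\varphi\rangle+\int_\Omega\nabla y(t)\cdot\nabla\varphi\,dx=\int_\Omega\chi_\omega u(t)\varphi\,dx .$$ Put $$\mathcal J_1(\omega,f)=\inf_{u\in L_2(0,T;\mathcal U)}\int_0^T\|y^{u,f,\omega}(t)\|_{L_2(\Omega)}^2+\gamma\|u(t)\|_{L_2(\Omega)}^2\,dt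 .$$ Let $\mathring C^{0,1}(\overline\Omega,\mathbb R^d)$ be the space of bounded Lipschitz vector fields on $\overline\Omega$ that vanish on $\partial\Omega$. For such an $X$ let $T_t(x)=x+tX(x)$ and $\tau_X=1/(2\|X\|_{C^{0,1}})$, where $\|X\|_{C^{0,1}}$ is the supremum norm plus the smallest Lipschitz constant, and let $$D\mathcal J_1(\omega,f)(X)=\lim_{t\searrow0}\frac{\mathcal J_1(T_t(\omega),f)-\mathcal J_1(\omega,f)}{t}.$$ Suppose that for all $X\in\mathring C^{0,1}(\overline\Omega,\mathbb R^d)$, $t\in[0,\tau_X]$ and $u\in L_2(\Omega)$ one has $u\in\mathcal U$ if and only if $u\circ T_t\in\mathcal U$, and that $v\in\mathcal U$ implies $-v\in\mathcal U$. Then for every measurable $\omega\subset\Omega$, every $f\in H^1_0(\Omega)$ and every $X\in\mathring C^{0,1}(\overline\Omega,\mathbb R^d)$ the limits $D\mathcal J_1(\omega,-f)(X)$ and $D\mathcal J_1(\omega,f)(X)$ exist and $$D\mathcal J_1(\omega,-f)(X)=D\mathcal J_1(\omega,f)(X).$$ -/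

import Mathlib

open MeasureTheory Set Filter Topology
open scoped NNReal

noncomputable section

namespace ActuatorDesign

/-- The Euclidean space `ℝ^d`. -/
abbrev E (d : ℕ) := EuclideanSpace ℝ (Fin d)

/-- The real space `L₂(Ω)`. -/
abbrev L2 {d : ℕ} (Ω : Set (E d)) := Lp ℝ 2 (volume.restrict Ω)

/-- The space `L₂(Ω, ℝ^d)` of square integrable vector fields. -/
abbrev L2Vec {d : ℕ} (Ω : Set (E d)) := Lp (E d) 2 (volume.restrict Ω)

/-- The pairs `(φ, ∇φ)` with `φ ∈ C_c^∞(Ω)`, seen in `L₂(Ω) × L₂(Ω, ℝ^d)`. -/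
def testGraph {d : ℕ} (Ω : Set (E d)) : Set (WithLp 2 (L2 Ω × L2Vec Ω)) :=
  {p | ∃ φ : E d → ℝ, ContDiff ℝ (⊤ : ℕ∞) φ ∧ HasCompactSupport φ ∧ tsupport φ ⊆ Ω ∧
    p.fst =ᵐ[volume.restrict Ω] φ ∧ p.snd =ᵐ[volume.restrict Ω] gradient φ}

/-- The Hilbert space `H¹₀(Ω)`: the closure of `C_c^∞(Ω)` in the `H¹`-norm
`(‖v‖² + ‖∇v‖²)^{1/2}`. An element is stored as the pair `(v, ∇v)` of a function and its weak
gradient. -/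
def H10 {d : ℕ} (Ω : Set (E d)) : Submodule ℝ (WithLp 2 (L2 Ω × L2Vec Ω)) :=
  (Submodule.span ℝ (testGraph Ω)).topologicalClosure

/-- The function `v ∈ L₂(Ω)` underlying an element of `H¹₀(Ω)`. -/
def H10.val {d : ℕ} {Ω : Set (E d)} : H10 Ω →L[ℝ] L2 Ω :=
  (WithLp.fstL 2 ℝ (L2 Ω) (L2Vec Ω)).comp (H10 Ω).subtypeL

/-- The weak gradient of an element of `H¹₀(Ω)`. -/
def H10.grad {d : ℕ} {Ω : Set (E d)} : H10 Ω →L[ℝ] L2Vec Ω :=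
  (WithLp.sndL 2 ℝ (L2 Ω) (L2Vec Ω)).comp (H10 Ω).subtypeL

/-- The space `H⁻¹(Ω)`, the dual of `H¹₀(Ω)`. -/
abbrev Hneg1 {d : ℕ} (Ω : Set (E d)) := StrongDual ℝ (H10 Ω)

/-- Lebesgue measure on the time interval. -/
abbrev timeMeasure (T : ℝ) : Measure ℝ := volume.restrict (Ioc 0 T)

/-- `g` represents an element of the Bochner space `L₂(0,T;V)`. -/
def MemL2Time {V : Type*} [NormedAddCommGroup V] (T : ℝ) (g : ℝ → V) : Prop :=
  MemLp g 2 (timeMeasure T)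

/-- `y'` is the weak time derivative of `y` on `(0,T)` in `H⁻¹(Ω)`, where `H¹₀(Ω)` is embedded
in `H⁻¹(Ω)` through the inner product of `L₂(Ω)`. -/
def IsWeakTimeDeriv {d : ℕ} (Ω : Set (E d)) (T : ℝ) (y : ℝ → H10 Ω) (y' : ℝ → Hneg1 Ω) : Prop :=
  ∀ η : ℝ → ℝ, ContDiff ℝ (⊤ : ℕ∞) η → HasCompactSupport η → tsupport η ⊆ Ioo 0 T →
    ∀ φ : H10 Ω,
      ∫ t, deriv η t * inner ℝ (H10.val (y t)) (H10.val φ) ∂(timeMeasure T) =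
        -∫ t, η t * y' t φ ∂(timeMeasure T)

/-- `y` attains the initial value `f`: the representative of `y` in `C([0,T];L₂(Ω))` equals `f`
at time `0`. -/
def HasInitialValue {d : ℕ} (Ω : Set (E d)) (T : ℝ) (y : ℝ → H10 Ω) (f : L2 Ω) : Prop :=
  ∃ Y : ℝ → L2 Ω, ContinuousOn Y (Icc 0 T) ∧
    (∀ᵐ t ∂(timeMeasure T), Y t = H10.val (y t)) ∧ Y 0 = f

/-- `y` is the weak solution of `∂ₜy - Δy = χ_ω u` in `Ω × (0,T]`, `y = 0` on `∂Ω × (0,T]`,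
`y(0) = f`: it lies in `W(0,T) = {y ∈ L₂(0,T;H¹₀(Ω)) : ∂ₜy ∈ L₂(0,T;H⁻¹(Ω))}`, satisfies
`⟨∂ₜy, φ⟩ + ∫_Ω ∇y · ∇φ = ∫_Ω χ_ω u φ` for all `φ ∈ H¹₀(Ω)` and almost every `t`, and has the
initial value `f`. -/
def IsState {d : ℕ} (Ω : Set (E d)) (T : ℝ) (ω : Set (E d))
    (u : ℝ → L2 Ω) (f : H10 Ω) (y : ℝ → H10 Ω) : Prop :=
  MemL2Time T y ∧
  (∃ y' : ℝ → Hneg1 Ω, MemL2Time T y' ∧ IsWeakTimeDeriv Ω T y y' ∧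
    ∀ φ : H10 Ω, ∀ᵐ t ∂(timeMeasure T),
      y' t φ + inner ℝ (H10.grad (y t)) (H10.grad φ) =
        ∫ x in Ω, ω.indicator (u t) x * H10.val φ x) ∧
  HasInitialValue Ω T y (H10.val f)

/-- The set `L₂(0,T;𝒰)` of admissible controls. -/
def controls {d : ℕ} (Ω : Set (E d)) (T : ℝ) (U : Set (L2 Ω)) : Set (ℝ → L2 Ω) :=
  {u | MemL2Time T u ∧ ∀ᵐ t ∂(timeMeasure T), u t ∈ U}

/-- The cost `∫₀ᵀ ‖y(t)‖² + γ ‖u(t)‖² dt`, with the norms of `L₂(Ω)`. -/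
def cost {d : ℕ} (Ω : Set (E d)) (T γ : ℝ) (u : ℝ → L2 Ω) (y : ℝ → H10 Ω) : ℝ :=
  ∫ t, (‖H10.val (y t)‖ ^ 2 + γ * ‖u t‖ ^ 2) ∂(timeMeasure T)

/-- `𝒥₁(ω,f)`: the infimum of the cost over all controls `u ∈ L₂(0,T;𝒰)`, where `y` is the state
that belongs to `(ω,u,f)` (it exists and is unique almost everywhere in time). -/
def J1 {d : ℕ} (Ω : Set (E d)) (T γ : ℝ) (U : Set (L2 Ω)) (ω : Set (E d)) (f : H10 Ω) : ℝ :=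
  sInf {c | ∃ u ∈ controls Ω T U, ∃ y, IsState Ω T ω u f y ∧ c = cost Ω T γ u y}

/-- Lipschitz continuous vector fields on `closure Ω` that vanish on the boundary of `Ω`.
Boundedness is automatic when `Ω` is bounded; only the values on `closure Ω` matter. -/
structure IsC01Zero {d : ℕ} (Ω : Set (E d)) (X : E d → E d) : Prop where
  lipschitz : ∃ K : ℝ≥0, LipschitzOnWith K X (closure Ω)
  bounded : ∃ M : ℝ, ∀ x ∈ closure Ω, ‖X x‖ ≤ M
  zero_on_boundary : ∀ x ∈ frontier Ω, X x = 0

/-- The `C^{0,1}`-norm on `closure Ω`: supremum norm plus smallest Lipschitz constant. -/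
def c01Norm {d : ℕ} (Ω : Set (E d)) (X : E d → E d) : ℝ :=
  sSup ((fun x => ‖X x‖) '' closure Ω) +
    sInf {K : ℝ | 0 ≤ K ∧ ∀ x ∈ closure Ω, ∀ y ∈ closure Ω, ‖X x - X y‖ ≤ K * ‖x - y‖}

/-- The number `τ_X = 1 / (2 ‖X‖_{C^{0,1}})`. -/
def tau {d : ℕ} (Ω : Set (E d)) (X : E d → E d) : ℝ := 1 / (2 * c01Norm Ω X)

/-- The perturbation of the identity `T_t(x) = x + t X(x)`. -/
def perturb {d : ℕ} (X : E d → E d) (t : ℝ) (x : E d) : E d := x + t • X x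

/-- For all `X` and all `t ∈ [0, τ_X]`: `u ∈ 𝒰` if and only if `u ∘ T_t ∈ 𝒰`. The element
`u ∘ T_t` of `L₂(Ω)` is called `w`. -/
def InvariantUnderPerturbations {d : ℕ} (Ω : Set (E d)) (U : Set (L2 Ω)) : Prop :=
  ∀ X : E d → E d, IsC01Zero Ω X → ∀ t ∈ Icc 0 (tau Ω X), ∀ u w : L2 Ω,
    (w =ᵐ[volume.restrict Ω] fun x => u (perturb X t x)) → (u ∈ U ↔ w ∈ U)

/-- The shape function `J` has the directional derivative `DJ(ω)(X) = L`, that is,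
`(J(T_t(ω)) - J(ω)) / t` tends to `L` as `t ↘ 0`. -/
def HasShapeDeriv {d : ℕ} (J : Set (E d) → ℝ) (ω : Set (E d)) (X : E d → E d) (L : ℝ) : Prop :=
  Tendsto (fun t : ℝ => (J (perturb X t '' ω) - J ω) / t) (𝓝[>] 0) (𝓝 L)

end ActuatorDesign

end

/-!
The derivative of `𝒥₁(·, -f)` agrees with that of `𝒥₁(·, f)` because the two functions agree: when
`𝒰 = -𝒰`, the pair `(-u, -y)` is admissible for `-f` exactly when `(u, y)` is admissible for `f`, at
the same cost (`J1_neg`). The substance is the existence of the derivative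
(`exists_hasShapeDeriv`).

The moving set is removed by pulling back the controls only, and not the equation. Write
`P_t v = v ∘ T_t⁻¹`; this is a bounded operator on `L₂(Ω)`, it preserves `𝒰` for small `t`, and it
maps `χ_ω u` to `χ_{T_t(ω)} P_t u`. Hence `𝒥₁(T_t(ω), f)` is the infimum over a *fixed* closed convex
set of controls `u` of `‖b + ι Λ P_t χ_ω u‖² + γ ‖P_t u‖²`, where `b` is the free state, `Λ` the heat
solution operator with zero initial value and `ι` the embedding of `H¹₀(Ω)` into `L₂(Ω)`
(`J1_eq_pulledBackValue`).

The operators `P_t` are not differentiable in `L₂(Ω)`, but they are so in a weaker sense that is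
enough (`IsTransportFamily`, `exists_isTransportFamily`). By the change of variables formula,
`⟨P_t v, φ⟩` becomes a pairing of `v` itself with the transported test function `φ ∈ H¹₀(Ω)`, weighted
by the Jacobian, so that `P_t - 1` is `O(t)` from `L₂(Ω)` to `H⁻¹(Ω)`, and its difference quotients converge weakly. The quadratic form `‖P_t v‖²` only sees the
Jacobian of `T_t`. Since `Λ` is bounded with respect to the dual norm of the right-hand side
(`exists_bounded_solution_operator`, from the energy estimate), the states depend on `t` in a
Lipschitz way. The first variation at a fixed control is a pairing of `P_t χ_ω u - χ_ω u` with the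
adjoint state, which lies in `L₂(0,T;H¹₀(Ω))`, and hence has a limit.

Finally, the cost at `t = 0` is strongly convex, so it grows quadratically away from its minimizer
`u₀` (`exists_minimizer_quadratic_growth`). A Danskin type argument (`tendsto_inf_div`) then shows
that the infimum at `t` differs from the cost of `u₀` at `t` by `O(t²)`, and the derivative of the
infimum is the derivative of the cost at `u₀`.

The parabolic theory is developed for a pair of operators `ι : V → H`, `D : V → W` that generates the
inner product of `V`, without compactness or density assumptions. Existence follows by a projection
argument in space-time that rests on the identity `⟨I p, p⟩ = ½ ‖∫₀ᵀ p‖²` for the Volterra operator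
`I` (`inner_volterra_self`); weak solutions in the sense of `IsState` are unique by
`IsWeakSol.val_ae_eq`.
-/

noncomputable section

set_option linter.unusedSectionVars false

namespace ActuatorDesign

/-! ### Products of square integrable functions -/

section ProductL2

variable {α E F : Type*} [MeasurableSpace α] {μ : Measure α} [NormedAddCommGroup E]
  [NormedAddCommGroup F]

theorem integrable_norm_mul_norm (p : Lp E 2 μ) (q : Lp F 2 μ) :
    Integrable (fun s => ‖p s‖ * ‖q s‖) μ :=
  (Lp.memLp p).norm.integrable_mul (Lp.memLp q).norm

theorem integral_norm_mul_norm_le (p : Lp E 2 μ) (q : Lp F 2 μ) :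
    ∫ s, ‖p s‖ * ‖q s‖ ∂μ ≤ ‖p‖ * ‖q‖ := by
  have h := real_inner_le_norm ((Lp.memLp p).norm.toLp _) ((Lp.memLp q).norm.toLp _)
  rw [Lp.norm_toLp, Lp.norm_toLp, eLpNorm_norm, eLpNorm_norm, L2.inner_def] at h
  refine le_trans (le_of_eq ?_) h
  refine integral_congr_ae ?_
  filter_upwards [(Lp.memLp p).norm.coeFn_toLp, (Lp.memLp q).norm.coeFn_toLp] with s h1 h2
  rw [h1, h2]
  exact mul_comm _ _

theorem abs_integral_le_of_pointwise (p : Lp E 2 μ) (q : Lp F 2 μ) {θ : α → ℝ} {c : ℝ}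
    (hc : 0 ≤ c) (h : ∀ᵐ s ∂μ, |θ s| ≤ c * (‖p s‖ * ‖q s‖)) :
    |∫ s, θ s ∂μ| ≤ c * (‖p‖ * ‖q‖) := by
  have h1 := norm_integral_le_of_norm_le (f := θ) ((integrable_norm_mul_norm p q).const_mul c) h
  rw [integral_const_mul] at h1
  exact h1.trans (mul_le_mul_of_nonneg_left (integral_norm_mul_norm_le p q) hc)

end ProductL2

/-! ### The Volterra operator on square integrable functions of time -/

section Volterra

variable {E F : Type*} [NormedAddCommGroup E] [InnerProductSpace ℝ E] [CompleteSpace E]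
  [NormedAddCommGroup F] [InnerProductSpace ℝ F] [CompleteSpace F] {T : ℝ}

/-- The Bochner space `L₂(0,T;E)`. -/
abbrev TimeL2 (T : ℝ) (E : Type*) [NormedAddCommGroup E] := Lp E 2 (timeMeasure T)

theorem integrable_of_timeL2 (p : TimeL2 T E) : Integrable p (timeMeasure T) :=
  (Lp.memLp p).integrable one_le_two

/-- The norm of the embedding of `L₂(0,T;E)` into `L₁(0,T;E)`. -/
def embConst (T : ℝ) : ℝ := ((timeMeasure T) univ ^ (1 / 2 : ℝ)).toReal

theorem embConst_nonneg : 0 ≤ embConst T := ENNReal.toReal_nonneg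

theorem integral_norm_le (p : TimeL2 T E) : ∫ t, ‖p t‖ ∂(timeMeasure T) ≤ embConst T * ‖p‖ := by
  have h := eLpNorm_le_eLpNorm_mul_rpow_measure_univ (μ := timeMeasure T) (p := 1) (q := 2)
    one_le_two (Lp.memLp p).1
  have hfin : eLpNorm p 2 (timeMeasure T) * (timeMeasure T) univ ^
      (1 / (1 : ENNReal).toReal - 1 / (2 : ENNReal).toReal) ≠ ⊤ := by
    refine ENNReal.mul_ne_top (Lp.memLp p).2.ne (ENNReal.rpow_ne_top_of_nonneg (by norm_num) ?_)
    exact measure_ne_top _ _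
  have h2 := ENNReal.toReal_mono hfin h
  rw [ENNReal.toReal_mul, eLpNorm_one_eq_lintegral_enorm] at h2
  rw [integral_norm_eq_lintegral_enorm (Lp.memLp p).1, Lp.norm_def, mul_comm]
  convert h2 using 3
  unfold embConst
  norm_num

/-- The primitive `t ↦ ∫₀ᵗ p`. -/
def primitive (T : ℝ) (p : ℝ → E) (t : ℝ) : E := ∫ s in (0 : ℝ)..t, p s ∂(timeMeasure T)

theorem primitive_zero (p : ℝ → E) : primitive T p 0 = 0 := by simp [primitive]

theorem continuous_primitive {p : ℝ → E} (hp : Integrable p (timeMeasure T)) :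
    Continuous (primitive T p) :=
  intervalIntegral.continuous_primitive (fun _ _ => hp.intervalIntegrable) 0

theorem norm_primitive_le (p : TimeL2 T E) (t : ℝ) : ‖primitive T p t‖ ≤ embConst T * ‖p‖ := by
  refine le_trans ?_ (integral_norm_le p)
  refine (intervalIntegral.norm_integral_le_integral_norm_uIoc).trans ?_
  exact setIntegral_le_integral (integrable_of_timeL2 p).norm
    (Eventually.of_forall fun _ => norm_nonneg _)

theorem primitive_congr {p q : ℝ → E} (h : p =ᵐ[timeMeasure T] q) :
    primitive T p = primitive T q := by
  funext t
  exact intervalIntegral.integral_congr_ae' (h.mono fun _ hx _ => hx) (h.mono fun _ hx _ => hx)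

theorem primitive_comp (L : E →L[ℝ] F) {p : ℝ → E} (hp : Integrable p (timeMeasure T)) (t : ℝ) :
    primitive T (fun s => L (p s)) t = L (primitive T p t) :=
  L.intervalIntegral_comp_comm hp.intervalIntegrable

theorem primitive_end (hT : 0 ≤ T) (p : ℝ → E) :
    primitive T p T = ∫ t, p t ∂(timeMeasure T) := by
  unfold primitive
  rw [intervalIntegral.integral_of_le hT, Measure.restrict_restrict measurableSet_Ioc, inter_self]

theorem primitive_eq_interval {p : ℝ → E} {t : ℝ} (ht : t ∈ Icc 0 T) :
    primitive T p t = ∫ s in (0 : ℝ)..t, p s := by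
  unfold primitive
  rw [intervalIntegral.integral_of_le ht.1, intervalIntegral.integral_of_le ht.1,
    Measure.restrict_restrict measurableSet_Ioc, inter_eq_left.2 (Ioc_subset_Ioc_right ht.2)]

theorem memLp_primitive (p : TimeL2 T E) : MemLp (primitive T p) 2 (timeMeasure T) :=
  MemLp.of_bound (continuous_primitive (integrable_of_timeL2 p)).aestronglyMeasurable
    (embConst T * ‖p‖) (Eventually.of_forall (norm_primitive_le p))

/-- The Volterra operator `p ↦ ∫₀ᵗ p` on `L₂(0,T;E)`. -/
def volterra (T : ℝ) (E : Type*) [NormedAddCommGroup E] [InnerProductSpace ℝ E]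
    [CompleteSpace E] : TimeL2 T E →L[ℝ] TimeL2 T E :=
  LinearMap.mkContinuous
    { toFun := fun p => (memLp_primitive p).toLp _
      map_add' := fun p q => by
        rw [← MemLp.toLp_add]
        refine MemLp.toLp_congr _ _ (Eventually.of_forall fun t => ?_)
        rw [primitive_congr (Lp.coeFn_add p q)]
        exact intervalIntegral.integral_add (integrable_of_timeL2 p).intervalIntegrable
          (integrable_of_timeL2 q).intervalIntegrable
      map_smul' := fun c p => by
        rw [RingHom.id_apply, ← MemLp.toLp_const_smul]
        refine MemLp.toLp_congr _ _ (Eventually.of_forall fun t => ?_)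
        rw [primitive_congr (Lp.coeFn_smul c p)]
        exact intervalIntegral.integral_smul c _ }
    (embConst T * embConst T)
    (fun p => by
      have := Lp.norm_le_of_ae_bound (p := 2) (μ := timeMeasure T)
        (f := (memLp_primitive p).toLp _) (C := embConst T * ‖p‖)
        (mul_nonneg embConst_nonneg (norm_nonneg _)) (by
          filter_upwards [MemLp.coeFn_toLp (memLp_primitive p)] with t ht
          rw [ht]; exact norm_primitive_le p t)
      refine this.trans (le_of_eq ?_)
      rw [← mul_assoc]
      congr 2
      unfold embConst measureUnivNNReal
      norm_num
      rw [← ENNReal.toReal_rpow]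
      rfl)

theorem volterra_coe (p : TimeL2 T E) : volterra T E p =ᵐ[timeMeasure T] primitive T p :=
  MemLp.coeFn_toLp (memLp_primitive p)

/-- The integral `p ↦ ∫₀ᵀ p` on `L₂(0,T;E)`. -/
def total (T : ℝ) (E : Type*) [NormedAddCommGroup E] [InnerProductSpace ℝ E]
    [CompleteSpace E] : TimeL2 T E →L[ℝ] E :=
  LinearMap.mkContinuous
    { toFun := fun p => ∫ t, p t ∂(timeMeasure T)
      map_add' := fun p q => by
        rw [integral_congr_ae (Lp.coeFn_add p q)]
        exact integral_add (integrable_of_timeL2 p) (integrable_of_timeL2 q)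
      map_smul' := fun c p => by
        rw [integral_congr_ae (Lp.coeFn_smul c p)]
        exact integral_smul c _ }
    (embConst T) (fun p => (norm_integral_le_integral_norm _).trans (integral_norm_le p))

theorem total_apply (p : TimeL2 T E) : total T E p = ∫ t, p t ∂(timeMeasure T) := rfl

/-- The pointwise action of a bounded operator on `L₂(0,T;E)`. -/
abbrev lift (T : ℝ) (L : E →L[ℝ] F) : TimeL2 T E →L[ℝ] TimeL2 T F :=
  L.compLpL 2 (timeMeasure T)

theorem lift_coe (L : E →L[ℝ] F) (p : TimeL2 T E) :
    lift T L p =ᵐ[timeMeasure T] fun t => L (p t) := L.coeFn_compLpL p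

theorem volterra_lift (L : E →L[ℝ] F) (p : TimeL2 T E) :
    volterra T F (lift T L p) = lift T L (volterra T E p) := by
  refine Lp.ext ?_
  filter_upwards [volterra_coe (lift T L p), lift_coe L (volterra T E p), volterra_coe p]
    with t h1 h2 h3
  rw [h1, h2, h3, primitive_congr (lift_coe L p), primitive_comp L (integrable_of_timeL2 p)]

theorem inner_lift_adjoint (L : E →L[ℝ] F) (p : TimeL2 T E) (q : TimeL2 T F) :
    inner ℝ (lift T L p) q = inner ℝ p (lift T (ContinuousLinearMap.adjoint L) q) := by
  rw [L2.inner_def, L2.inner_def]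
  refine integral_congr_ae ?_
  filter_upwards [lift_coe L p, lift_coe (ContinuousLinearMap.adjoint L) q] with t h1 h2
  rw [h1, h2, ContinuousLinearMap.adjoint_inner_right]

theorem inner_volterra_self_of_continuous (hT : 0 ≤ T) {c : ℝ → E} (hc : Continuous c) :
    ∫ t, inner ℝ (primitive T c t) (c t) ∂(timeMeasure T) =
      1 / 2 * ‖∫ t, c t ∂(timeMeasure T)‖ ^ 2 := by
  have hd : ∀ t, HasDerivAt (fun t => ∫ s in (0 : ℝ)..t, c s) (c t) t := fun t =>
    intervalIntegral.integral_hasDerivAt_right (hc.intervalIntegrable _ _)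
      (hc.stronglyMeasurableAtFilter _ _) hc.continuousAt
  have hd2 : ∀ t, HasDerivAt (fun t => ‖∫ s in (0 : ℝ)..t, c s‖ ^ 2)
      (2 * inner ℝ (∫ s in (0 : ℝ)..t, c s) (c t)) t := fun t => (hd t).norm_sq
  have hcp : Continuous fun t => ∫ s in (0 : ℝ)..t, c s :=
    continuous_iff_continuousAt.2 fun t => (hd t).continuousAt
  have key := intervalIntegral.integral_eq_sub_of_hasDerivAt (a := 0) (b := T)
    (fun t _ => hd2 t) ((continuous_const.mul (hcp.inner hc)).intervalIntegrable _ _)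
  rw [intervalIntegral.integral_const_mul, intervalIntegral.integral_of_le hT] at key
  have h1 : ∫ t, inner ℝ (primitive T c t) (c t) ∂(timeMeasure T) =
      ∫ t in Ioc 0 T, inner ℝ (∫ s in (0 : ℝ)..t, c s) (c t) :=
    setIntegral_congr_fun measurableSet_Ioc fun t ht => by
      simp only [primitive_eq_interval (p := c) ⟨ht.1.le, ht.2⟩]
  rw [h1]
  rw [intervalIntegral.integral_of_le hT] at key
  simp at key
  simp only [timeMeasure]
  linarith

/-- `⟨∫₀ᵗ p, p⟩ = ½ ‖∫₀ᵀ p‖²`, the integrated form of `d/dt ½‖P‖² = ⟨P, P'⟩`. -/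
theorem inner_volterra_self (hT : 0 ≤ T) (p : TimeL2 T E) :
    inner ℝ (volterra T E p) p = 1 / 2 * ‖total T E p‖ ^ 2 := by
  have hdense := BoundedContinuousFunction.toLp_denseRange (p := 2) E (timeMeasure T) ℝ (by simp)
  refine hdense.induction_on (p := fun p : TimeL2 T E =>
    inner ℝ (volterra T E p) p = 1 / 2 * ‖total T E p‖ ^ 2) p ?_ ?_
  · exact isClosed_eq ((volterra T E).continuous.inner continuous_id)
      (continuous_const.mul ((total T E).continuous.norm.pow 2))
  · intro c
    have hc := BoundedContinuousFunction.coeFn_toLp (p := 2) (𝕜 := ℝ) (timeMeasure T) c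
    rw [total_apply, integral_congr_ae hc, ← inner_volterra_self_of_continuous hT c.continuous,
      L2.inner_def]
    refine integral_congr_ae ?_
    filter_upwards [hc, volterra_coe (BoundedContinuousFunction.toLp 2 (timeMeasure T) ℝ c)]
      with t h1 h2
    rw [h1, h2, primitive_congr hc]

/-- Integration by parts: the polarized form of `inner_volterra_self`. -/
theorem inner_volterra_add (hT : 0 ≤ T) (p q : TimeL2 T E) :
    inner ℝ (volterra T E p) q + inner ℝ p (volterra T E q) =
      inner ℝ (total T E p) (total T E q) := by
  have h := inner_volterra_self hT (p + q)
  have hp := inner_volterra_self hT p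
  have hq := inner_volterra_self hT q
  rw [map_add, map_add, inner_add_left, inner_add_right, inner_add_right,
    norm_add_sq_real] at h
  rw [real_inner_comm (volterra T E q) p]
  linarith

theorem inner_volterra_self_nonneg (hT : 0 ≤ T) (p : TimeL2 T E) :
    0 ≤ inner ℝ (volterra T E p) p := by
  rw [inner_volterra_self hT]; positivity

theorem adjoint_volterra_lift (L : E →L[ℝ] F) (p : TimeL2 T E) :
    ContinuousLinearMap.adjoint (volterra T F) (lift T L p) =
      lift T L (ContinuousLinearMap.adjoint (volterra T E) p) := by
  refine ext_inner_right ℝ fun q => ?_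
  rw [ContinuousLinearMap.adjoint_inner_left, inner_lift_adjoint, inner_lift_adjoint,
    ContinuousLinearMap.adjoint_inner_left, volterra_lift]

/-- The constant function with value `f`. -/
def constTime (T : ℝ) (f : E) : TimeL2 T E := (memLp_const (μ := timeMeasure T) (p := 2) f).toLp _

theorem constTime_coe (f : E) : constTime T f =ᵐ[timeMeasure T] fun _ => f :=
  MemLp.coeFn_toLp _

theorem inner_constTime (f : E) (p : TimeL2 T E) :
    inner ℝ (constTime T f) p = inner ℝ f (total T E p) := by
  rw [L2.inner_def, total_apply, ← integral_inner (integrable_of_timeL2 p)]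
  refine integral_congr_ae ?_
  filter_upwards [constTime_coe (T := T) f] with t h
  rw [h]

end Volterra

/-! ### Abstract parabolic equations: existence, energy estimate and adjoint states -/

/-- A linear functional that is dominated by a linear map `K` into a Hilbert space is represented
by a vector through `K`. -/
theorem exists_inner_eq_of_abs_le {Φ Y : Type*} [AddCommGroup Φ] [Module ℝ Φ]
    [NormedAddCommGroup Y] [InnerProductSpace ℝ Y] [CompleteSpace Y] (K : Φ →ₗ[ℝ] Y)
    (l : Φ →ₗ[ℝ] ℝ) (C : ℝ) (h : ∀ χ, |l χ| ≤ C * ‖K χ‖) :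
    ∃ y : Y, ∀ χ, l χ = inner ℝ y (K χ) := by
  obtain ⟨s, hs⟩ := K.rangeRestrict.exists_rightInverse_of_surjective K.range_rangeRestrict
  have hs' : ∀ r : LinearMap.range K, K (s r) = r := fun r =>
    congrArg Subtype.val (LinearMap.congr_fun hs r)
  have hl : ∀ χ, l (s (K.rangeRestrict χ)) = l χ := fun χ => by
    have h1 := h (s (K.rangeRestrict χ) - χ)
    rw [map_sub, map_sub, hs', show ((K.rangeRestrict χ : LinearMap.range K) : Y) = K χ from rfl,
      sub_self, norm_zero, mul_zero] at h1
    exact sub_eq_zero.1 (abs_nonpos_iff.1 h1)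
  let f : StrongDual ℝ (LinearMap.range K) :=
    LinearMap.mkContinuous (l ∘ₗ s) C (fun r => by
      have := h (s r)
      rw [hs' r] at this
      exact this)
  obtain ⟨F, hF, -⟩ := exists_extension_norm_eq (LinearMap.range K) f
  refine ⟨(InnerProductSpace.toDual ℝ Y).symm F, fun χ => ?_⟩
  rw [InnerProductSpace.toDual_symm_apply, ← hl χ]
  exact (hF (K.rangeRestrict χ)).symm

section Parabolic

variable {V H W : Type*} [NormedAddCommGroup V] [InnerProductSpace ℝ V] [CompleteSpace V]
  [NormedAddCommGroup H] [InnerProductSpace ℝ H] [CompleteSpace H]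
  [NormedAddCommGroup W] [InnerProductSpace ℝ W] [CompleteSpace W]
  {ι : V →L[ℝ] H} {D : V →L[ℝ] W} {T : ℝ}

/-- The inner product of `V` is the graph inner product of `ι` and `D`; for `V = H¹₀(Ω)`, these
are the embedding into `L₂(Ω)` and the gradient. -/
def IsGraphInner (ι : V →L[ℝ] H) (D : V →L[ℝ] W) : Prop :=
  ∀ v w : V, inner ℝ v w = inner ℝ (ι v) (ι w) + inner ℝ (D v) (D w)

theorem IsGraphInner.inner_time (hV : IsGraphInner ι D) (p q : TimeL2 T V) :
    inner ℝ p q = inner ℝ (lift T ι p) (lift T ι q) + inner ℝ (lift T D p) (lift T D q) := by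
  rw [L2.inner_def, L2.inner_def, L2.inner_def, ← integral_add (L2.integrable_inner _ _)
    (L2.integrable_inner _ _)]
  refine integral_congr_ae ?_
  filter_upwards [lift_coe ι p, lift_coe ι q, lift_coe D p, lift_coe D q] with t h1 h2 h3 h4
  rw [h1, h2, h3, h4, hV]

theorem IsGraphInner.norm_sq_time (hV : IsGraphInner ι D) (p : TimeL2 T V) :
    ‖p‖ ^ 2 = ‖lift T ι p‖ ^ 2 + ‖lift T D p‖ ^ 2 := by
  have := hV.inner_time p p
  simpa only [real_inner_self_eq_norm_sq] using this

/-- The function `f + y` is the solution of `∂ₜ(f + y) + D†D (f + y) = g` with initial value `f`,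
where `z ∈ L₂(0,T;H)` is the time derivative of `y`. The initial value is encoded in `y = ∫₀ᵗ z`. -/
structure IsStrongSol (ι : V →L[ℝ] H) (D : V →L[ℝ] W) (T : ℝ) (f : V) (g z : TimeL2 T H)
    (y : TimeL2 T V) : Prop where
  eq_volterra : lift T ι y = volterra T H z
  weak : ∀ ψ : TimeL2 T V, inner ℝ z (lift T ι ψ) +
    inner ℝ (constTime T (D f) + lift T D y) (lift T D ψ) = inner ℝ g (lift T ι ψ)

/-- The range is dense because `I` is monotone: a vector `p` orthogonal to it satisfies
`‖p‖² + ⟨I p, p⟩ = 0`. -/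
theorem dense_range_one_add_volterra (hT : 0 ≤ T) :
    DenseRange fun χ : TimeL2 T V => χ + volterra T V χ := by
  set A : TimeL2 T V →L[ℝ] TimeL2 T V := ContinuousLinearMap.id ℝ _ + volterra T V with hA
  have hbot : (LinearMap.range A.toLinearMap)ᗮ = ⊥ := by
    rw [Submodule.eq_bot_iff]
    intro p hp
    have h1 : inner ℝ (A p) p = 0 := (Submodule.mem_orthogonal _ _).1 hp _ ⟨p, rfl⟩
    have h2 : inner ℝ p p + inner ℝ (volterra T V p) p = 0 := by
      rw [← inner_add_left]; exact h1
    have h3 := inner_volterra_self_nonneg hT p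
    have h4 : inner ℝ p p ≤ 0 := by linarith
    rw [real_inner_self_eq_norm_sq] at h4
    exact norm_eq_zero.1 (by nlinarith [norm_nonneg p])
  have := (Submodule.topologicalClosure_eq_top_iff (K := LinearMap.range A.toLinearMap)).2 hbot
  have h5 := (Submodule.dense_iff_topologicalClosure_eq_top).2 this
  intro x
  have h6 := h5 x
  exact h6

/-- Existence by the projection theorem of Lions. Testing with `ψ = χ + ∫₀ᵗ χ` makes the
space-time form coercive with respect to `‖χ‖²_H + ½‖∫₀ᵀ Dχ‖² + ‖∫₀ᵗ Dχ‖²`. -/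
theorem exists_isStrongSol (hV : IsGraphInner ι D) (hT : 0 ≤ T) (f : V) (g : TimeL2 T H) :
    ∃ z y, IsStrongSol ι D T f g z y := by
  set IH := volterra T H
  set IV := volterra T V
  let S : Submodule ℝ (WithLp 2 (TimeL2 T H × TimeL2 T V)) :=
    LinearMap.ker ((lift T ι).comp (WithLp.sndL 2 ℝ _ _) -
      IH.comp (WithLp.fstL 2 ℝ _ _) :
        WithLp 2 (TimeL2 T H × TimeL2 T V) →L[ℝ] TimeL2 T H).toLinearMap
  have hSmem : ∀ x : WithLp 2 (TimeL2 T H × TimeL2 T V), x ∈ S ↔ lift T ι x.snd = IH x.fst := by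
    intro x
    exact sub_eq_zero
  have hSclosed : IsClosed (S : Set (WithLp 2 (TimeL2 T H × TimeL2 T V))) :=
    ContinuousLinearMap.isClosed_ker ((lift T ι).comp (WithLp.sndL 2 ℝ _ _) -
      IH.comp (WithLp.fstL 2 ℝ _ _) :
        WithLp 2 (TimeL2 T H × TimeL2 T V) →L[ℝ] TimeL2 T H)
  have : CompleteSpace S := hSclosed.completeSpace_coe
  let ψ : TimeL2 T V →ₗ[ℝ] TimeL2 T V := LinearMap.id + IV.toLinearMap
  have hψ : ∀ χ, ψ χ = χ + IV χ := fun χ => rfl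
  let D' := ContinuousLinearMap.adjoint (lift T D)
  let K0 : TimeL2 T V →ₗ[ℝ] WithLp 2 (TimeL2 T H × TimeL2 T V) :=
    (WithLp.linearEquiv 2 ℝ _).symm.toLinearMap ∘ₗ
      ((lift T ι).toLinearMap.prod (D' ∘L lift T D).toLinearMap) ∘ₗ ψ
  have hK0 : ∀ χ (x : WithLp 2 (TimeL2 T H × TimeL2 T V)), inner ℝ x (K0 χ) =
      inner ℝ x.fst (lift T ι (ψ χ)) + inner ℝ (lift T D x.snd) (lift T D (ψ χ)) := by
    intro χ x
    rw [WithLp.prod_inner_apply, ← ContinuousLinearMap.adjoint_inner_right (lift T D)]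
    rfl
  let K : TimeL2 T V →ₗ[ℝ] S := S.orthogonalProjectionOnto.toLinearMap ∘ₗ K0
  have hK : ∀ χ (x : S), inner ℝ x (K χ) = inner ℝ (x : WithLp 2 (TimeL2 T H × TimeL2 T V)) (K0 χ) :=
    fun χ x => Submodule.inner_orthogonalProjectionOnto_eq_of_mem_left x (K0 χ)
  let l : TimeL2 T V →ₗ[ℝ] ℝ :=
    ((innerSL ℝ g).comp (lift T ι) -
      (innerSL ℝ (constTime T (D f))).comp (lift T D)).toLinearMap ∘ₗ ψ
  have hl : ∀ χ, l χ = inner ℝ g (lift T ι (ψ χ)) -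
      inner ℝ (constTime T (D f)) (lift T D (ψ χ)) := fun χ => rfl
  set i := ‖IH‖
  have hi : 0 ≤ i := norm_nonneg IH
  set M := ‖g‖ * (1 + i) + ‖D f‖ + ‖constTime T (D f)‖
  obtain ⟨x, hx⟩ := exists_inner_eq_of_abs_le K l (M * (4 * (1 + i))) (by
    intro χ
    have hιI : lift T ι (IV χ) = IH (lift T ι χ) := (volterra_lift ι χ).symm
    have hDI : lift T D (IV χ) = volterra T W (lift T D χ) := (volterra_lift D χ).symm
    set a := ‖lift T ι χ‖ with ha
    set b := ‖total T W (lift T D χ)‖ with hb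
    set c := ‖lift T D (IV χ)‖ with hc
    have ha0 : 0 ≤ a := norm_nonneg _
    have hb0 : 0 ≤ b := norm_nonneg _
    have hc0 : 0 ≤ c := norm_nonneg _
    let x : S := ⟨WithLp.toLp 2 (lift T ι χ, IV χ), (hSmem _).2 hιI⟩
    have hIa : ‖IH (lift T ι χ)‖ ≤ i * a := IH.le_opNorm _
    have hxn : ‖x‖ ≤ (1 + i) * a + c := by
      have h1 : ‖x‖ ^ 2 = a ^ 2 + ‖IV χ‖ ^ 2 := WithLp.prod_norm_sq_eq_of_L2 _
      rw [hV.norm_sq_time, hιI] at h1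
      refine le_of_sq_le_sq ?_ (by positivity)
      have h2 : ‖IH (lift T ι χ)‖ ^ 2 ≤ (i * a) ^ 2 := by gcongr
      rw [h1]
      nlinarith [mul_nonneg hi ha0, mul_nonneg ha0 hc0, mul_nonneg (mul_nonneg hi ha0) ha0,
        mul_nonneg (mul_nonneg hi ha0) hc0]
    have hB : a ^ 2 + 1 / 2 * b ^ 2 + c ^ 2 ≤ ‖x‖ * ‖K χ‖ := by
      refine le_trans ?_ (real_inner_le_norm x (K χ))
      rw [hK, hK0]
      change _ ≤ inner ℝ (lift T ι χ) (lift T ι (ψ χ)) + inner ℝ (lift T D (IV χ)) (lift T D (ψ χ))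
      rw [hψ, map_add, map_add, inner_add_right, inner_add_right, real_inner_self_eq_norm_sq,
        real_inner_self_eq_norm_sq, hιI, real_inner_comm (IH _) (lift T ι χ)]
      have h1 := inner_volterra_self_nonneg hT (lift T ι χ)
      have h2 := inner_volterra_self hT (lift T D χ)
      rw [← hDI] at h2
      linarith
    have hlb : |l χ| ≤ M * (a + b + c) := by
      rw [hl, hψ, map_add, map_add, inner_add_right, inner_add_right, hιI,
        inner_constTime (D f) (lift T D χ)]
      have h1 := abs_real_inner_le_norm g (lift T ι χ)
      have h2 := (abs_real_inner_le_norm g (IH (lift T ι χ))).trans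
        (mul_le_mul_of_nonneg_left hIa (norm_nonneg g))
      have h3 := abs_real_inner_le_norm (D f) (total T W (lift T D χ))
      have h4 := abs_real_inner_le_norm (constTime T (D f)) (lift T D (IV χ))
      rw [← ha] at h1
      rw [← hb] at h3
      rw [← hc] at h4
      have hg := norm_nonneg g
      have hDf := norm_nonneg (D f)
      have hcf := norm_nonneg (constTime T (D f))
      have : M * (a + b + c) = ‖g‖ * a + ‖g‖ * (i * a) + ‖D f‖ * b + ‖constTime T (D f)‖ * c +
        (‖g‖ * (1 + i) * (b + c) + ‖D f‖ * (a + c) + ‖constTime T (D f)‖ * (a + b)) := by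
        simp only [M]; ring
      have hpos : 0 ≤ ‖g‖ * (1 + i) * (b + c) + ‖D f‖ * (a + c) +
        ‖constTime T (D f)‖ * (a + b) := by positivity
      rw [abs_le] at h1 h2 h3 h4 ⊢
      constructor <;> linarith [h1.1, h1.2, h2.1, h2.2, h3.1, h3.2, h4.1, h4.2]
    have hM : 0 ≤ M := by positivity
    have hN : a + b + c ≤ 4 * (1 + i) * ‖K χ‖ := by
      rcases (add_nonneg (add_nonneg ha0 hb0) hc0).eq_or_lt with h0 | h0
      · rw [← h0]; positivity
      · refine le_of_mul_le_mul_left ?_ h0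
        have h1 : (a + b + c) * (a + b + c) ≤ 4 * (a ^ 2 + 1 / 2 * b ^ 2 + c ^ 2) := by
          nlinarith [sq_nonneg (a - c), sq_nonneg (b - 2 * a), sq_nonneg (b - 2 * c)]
        have h2 : (1 + i) * a + c ≤ (1 + i) * (a + b + c) := by nlinarith
        have h3 : ‖x‖ * ‖K χ‖ ≤ (1 + i) * (a + b + c) * ‖K χ‖ :=
          mul_le_mul_of_nonneg_right (hxn.trans h2) (norm_nonneg _)
        linarith
    calc |l χ| ≤ M * (a + b + c) := hlb
      _ ≤ M * (4 * (1 + i) * ‖K χ‖) := mul_le_mul_of_nonneg_left hN hM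
      _ = M * (4 * (1 + i)) * ‖K χ‖ := by ring)
  refine ⟨(x : WithLp 2 (TimeL2 T H × TimeL2 T V)).fst,
    (x : WithLp 2 (TimeL2 T H × TimeL2 T V)).snd, (hSmem _).1 x.2, fun p => ?_⟩
  refine (dense_range_one_add_volterra (V := V) hT).induction_on p ?_ ?_
  · exact isClosed_eq (by fun_prop) (by fun_prop)
  · intro χ
    have h1 := hx χ
    rw [hK, hK0, hl, hψ] at h1
    rw [inner_add_left]
    linarith

namespace IsStrongSol

variable {f f' : V} {g g' z z' : TimeL2 T H} {y y' : TimeL2 T V}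

theorem add (h : IsStrongSol ι D T f g z y) (h' : IsStrongSol ι D T f' g' z' y') :
    IsStrongSol ι D T (f + f') (g + g') (z + z') (y + y') where
  eq_volterra := by rw [map_add, map_add, h.eq_volterra, h'.eq_volterra]
  weak ψ := by
    have h1 := h.weak ψ
    have h2 := h'.weak ψ
    have h3 : constTime T (D (f + f')) = constTime T (D f) + constTime T (D f') := by
      rw [map_add]; rfl
    rw [h3, map_add]
    simp only [inner_add_left] at *
    linarith

theorem smul (c : ℝ) (h : IsStrongSol ι D T f g z y) :
    IsStrongSol ι D T (c • f) (c • g) (c • z) (c • y) where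
  eq_volterra := by rw [map_smul, map_smul, h.eq_volterra]
  weak ψ := by
    have h1 := h.weak ψ
    have h3 : constTime T (D (c • f)) = c • constTime T (D f) := by
      rw [map_smul]; rfl
    rw [h3, map_smul, ← smul_add, real_inner_smul_left, real_inner_smul_left,
      real_inner_smul_left, ← mul_add, h1]

/-- The energy estimate with respect to the dual norm of the right-hand side. It results from
testing with `y + I†y`, where `I†` is the adjoint of the Volterra operator: `⟨z, I†ιy⟩ = ‖ιy‖²`. -/
theorem energy (hV : IsGraphInner ι D) (hT : 0 ≤ T) (h : IsStrongSol ι D T 0 g z y) :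
    ‖y‖ ^ 2 ≤ inner ℝ g (lift T ι (y + ContinuousLinearMap.adjoint (volterra T V) y)) := by
  have h0 : constTime T (D 0) = 0 := by rw [map_zero]; rfl
  rw [← h.weak, h0, zero_add, map_add, map_add, inner_add_right, inner_add_right,
    hV.norm_sq_time, ← adjoint_volterra_lift, ← adjoint_volterra_lift,
    ContinuousLinearMap.adjoint_inner_right, ContinuousLinearMap.adjoint_inner_right,
    ← h.eq_volterra, real_inner_self_eq_norm_sq, real_inner_self_eq_norm_sq]
  have h1 := inner_volterra_self_nonneg hT (lift T D y)
  have h2 := inner_volterra_self_nonneg hT z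
  rw [← h.eq_volterra, real_inner_comm] at h2
  linarith

theorem unique (hV : IsGraphInner ι D) (hT : 0 ≤ T) (h : IsStrongSol ι D T f g z y)
    (h' : IsStrongSol ι D T f g z' y') : y = y' := by
  have h1 := h.add (h'.smul (-1))
  have e1 : f + (-1 : ℝ) • f = 0 := by simp
  have e2 : g + (-1 : ℝ) • g = 0 := by simp
  rw [e1, e2] at h1
  have h2 := h1.energy hV hT
  rw [inner_zero_left] at h2
  have h3 : ‖y + (-1 : ℝ) • y'‖ = 0 := by
    have := norm_nonneg (y + (-1 : ℝ) • y')
    nlinarith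
  rw [norm_eq_zero] at h3
  simpa [add_neg_eq_zero] using h3

end IsStrongSol

/-- Uniqueness makes the choice of a solution linear in the right-hand side. -/
theorem exists_solution_operator (hV : IsGraphInner ι D) (hT : 0 ≤ T) :
    ∃ Λ : TimeL2 T H →ₗ[ℝ] TimeL2 T V, ∀ g, ∃ z, IsStrongSol ι D T 0 g z (Λ g) := by
  choose z y hy using fun g => exists_isStrongSol (ι := ι) (D := D) hV hT 0 g
  refine ⟨{ toFun := y, map_add' := fun g g' => ?_, map_smul' := fun c g => ?_ },
    fun g => ⟨z g, hy g⟩⟩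
  · have := (hy g).add (hy g')
    rw [add_zero] at this
    exact (hy (g + g')).unique hV hT this
  · have := (hy g).smul c
    rw [smul_zero] at this
    exact (hy (c • g)).unique hV hT this

/-- The solution operator `g ↦ y` of `∂ₜy + D†D y = g`, `y(0) = 0`, together with the bound of
`y` by the dual norm of `g` and the adjoint state `p` of a functional `⟨·, h⟩` of the solution. -/
theorem exists_bounded_solution_operator (hV : IsGraphInner ι D) (hT : 0 ≤ T) :
    ∃ (Λ : TimeL2 T H →L[ℝ] TimeL2 T V) (C : ℝ), 0 ≤ C ∧
      (∀ g, ∃ z, IsStrongSol ι D T 0 g z (Λ g)) ∧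
      (∀ g (δ : ℝ), 0 ≤ δ → (∀ ψ, |inner ℝ g (lift T ι ψ)| ≤ δ * ‖ψ‖) → ‖Λ g‖ ≤ C * δ) ∧
      ∀ h : TimeL2 T V, ∃ p : TimeL2 T V, ∀ g, inner ℝ (Λ g) h = inner ℝ g (lift T ι p) := by
  obtain ⟨Λ, hΛ⟩ := exists_solution_operator (T := T) hV hT
  set C := 1 + ‖ContinuousLinearMap.adjoint (volterra T V)‖ with hC
  have hC0 : 0 ≤ C := by positivity
  have hb : ∀ g (δ : ℝ), 0 ≤ δ → (∀ ψ, |inner ℝ g (lift T ι ψ)| ≤ δ * ‖ψ‖) → ‖Λ g‖ ≤ C * δ := by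
    intro g δ hδ0 hδ
    obtain ⟨z, hz⟩ := hΛ g
    have h1 := (hz.energy hV hT).trans ((le_abs_self _).trans (hδ _))
    have h2 : ‖Λ g + ContinuousLinearMap.adjoint (volterra T V) (Λ g)‖ ≤ C * ‖Λ g‖ := by
      refine (norm_add_le _ _).trans ?_
      have := (ContinuousLinearMap.adjoint (volterra T V)).le_opNorm (Λ g)
      rw [hC, add_mul, one_mul]
      linarith
    rcases (norm_nonneg (Λ g)).eq_or_lt with h0 | h0
    · rw [← h0]; positivity
    · refine le_of_mul_le_mul_left ?_ h0
      have h3 := mul_le_mul_of_nonneg_left h2 hδ0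
      nlinarith
  have hK : ∀ g, ‖Λ g‖ ≤ C * ‖lift T (ContinuousLinearMap.adjoint ι) g‖ := fun g =>
    hb g _ (norm_nonneg _) fun ψ => by
      rw [real_inner_comm, inner_lift_adjoint, mul_comm]
      exact abs_real_inner_le_norm _ _
  refine ⟨LinearMap.mkContinuous Λ (C * ‖lift T (ContinuousLinearMap.adjoint ι)‖) fun g => ?_,
    C, hC0, hΛ, hb, fun h => ?_⟩
  · rw [mul_assoc]
    exact (hK g).trans (mul_le_mul_of_nonneg_left (ContinuousLinearMap.le_opNorm _ _) hC0)
  · obtain ⟨p, hp⟩ := exists_inner_eq_of_abs_le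
      (lift T (ContinuousLinearMap.adjoint ι)).toLinearMap
      ((innerSL ℝ h).toLinearMap ∘ₗ Λ) (‖h‖ * C) (fun g => by
        refine (abs_real_inner_le_norm h (Λ g)).trans ?_
        rw [mul_assoc]
        exact mul_le_mul_of_nonneg_left (hK g) (norm_nonneg _))
    refine ⟨p, fun g => ?_⟩
    rw [real_inner_comm, real_inner_comm (lift T ι p), inner_lift_adjoint]
    exact hp g

end Parabolic

/-! ### The lemma of du Bois-Reymond on the time interval -/

section WeakDerivative

variable {T : ℝ}

/-- `η` is a test function on the open interval `(0,T)`. -/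
structure IsTimeTest (T : ℝ) (η : ℝ → ℝ) : Prop where
  contDiff : ContDiff ℝ (⊤ : ℕ∞) η
  hasCompactSupport : HasCompactSupport η
  tsupport_subset : tsupport η ⊆ Ioo 0 T

theorem IsTimeTest.eq_zero {η : ℝ → ℝ} (hη : IsTimeTest T η) {t : ℝ} (ht : t ∉ Ioo 0 T) :
    η t = 0 := image_eq_zero_of_notMem_tsupport fun h => ht (hη.tsupport_subset h)

theorem IsTimeTest.continuous_deriv {η : ℝ → ℝ} (hη : IsTimeTest T η) : Continuous (deriv η) :=
  hη.contDiff.continuous_deriv (by simp)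

theorem IsTimeTest.integral_deriv {η : ℝ → ℝ} (hη : IsTimeTest T η) {t : ℝ} :
    ∫ s in (0 : ℝ)..t, deriv η s = η t := by
  rw [intervalIntegral.integral_deriv_eq_sub
    (fun x _ => (hη.contDiff.differentiable (by simp)).differentiableAt)
    (hη.continuous_deriv.intervalIntegrable _ _), hη.eq_zero (t := 0) (by simp), sub_zero]

/-- A function in `L₂(0,T)` is the weak derivative of its primitive. -/
theorem IsTimeTest.integral_deriv_mul_primitive (hT : 0 ≤ T) {η : ℝ → ℝ} (hη : IsTimeTest T η)
    (θ : TimeL2 T ℝ) :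
    ∫ t, deriv η t * primitive T θ t ∂(timeMeasure T) = -∫ t, η t * θ t ∂(timeMeasure T) := by
  have hq : MemLp (deriv η) 2 (timeMeasure T) :=
    (hη.continuous_deriv.memLp_of_hasCompactSupport hη.hasCompactSupport.deriv).restrict _
  have hqc := MemLp.coeFn_toLp hq
  have h1 := inner_volterra_add hT θ (hq.toLp _)
  have h2 : total T ℝ (hq.toLp _) = 0 := by
    rw [total_apply, integral_congr_ae hqc, ← primitive_end hT,
      primitive_eq_interval (right_mem_Icc.2 hT), hη.integral_deriv, hη.eq_zero (by simp)]
  rw [h2, inner_zero_right, L2.inner_def, L2.inner_def] at h1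
  have h3 : ∫ t, inner ℝ (volterra T ℝ θ t) (hq.toLp _ t) ∂(timeMeasure T) =
      ∫ t, deriv η t * primitive T θ t ∂(timeMeasure T) := by
    refine integral_congr_ae ?_
    filter_upwards [volterra_coe θ, hqc] with t e1 e2
    rw [e1, e2]; rfl
  have h4 : ∫ t, inner ℝ (θ t) (volterra T ℝ (hq.toLp _) t) ∂(timeMeasure T) =
      ∫ t, η t * θ t ∂(timeMeasure T) := by
    refine integral_congr_ae ?_
    filter_upwards [volterra_coe (hq.toLp _), ae_restrict_mem measurableSet_Ioc] with t e1 e2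
    rw [e1, primitive_congr hqc, primitive_eq_interval ⟨e2.1.le, e2.2⟩, hη.integral_deriv]; rfl
  rw [h3, h4] at h1
  linarith

theorem IsTimeTest.integral_deriv_eq_zero (hT : 0 ≤ T) {η : ℝ → ℝ} (hη : IsTimeTest T η) :
    ∫ t, deriv η t ∂(timeMeasure T) = 0 := by
  rw [← primitive_end hT, primitive_eq_interval (right_mem_Icc.2 hT), hη.integral_deriv,
    hη.eq_zero (by simp)]

/-- The primitive of a test function with mean zero is a test function. -/
theorem IsTimeTest.primitive_of_integral_eq_zero {θ : ℝ → ℝ} (hθ : IsTimeTest T θ)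
    (h0 : ∫ t in (0 : ℝ)..T, θ t = 0) :
    IsTimeTest T (fun t => ∫ s in (0 : ℝ)..t, θ s) ∧
      deriv (fun t => ∫ s in (0 : ℝ)..t, θ s) = θ := by
  have hc := hθ.contDiff.continuous
  have hd : ∀ t, HasDerivAt (fun t => ∫ s in (0 : ℝ)..t, θ s) (θ t) t := fun t =>
    intervalIntegral.integral_hasDerivAt_right (hc.intervalIntegrable _ _)
      (hc.stronglyMeasurableAtFilter _ _) hc.continuousAt
  have hderiv : deriv (fun t => ∫ s in (0 : ℝ)..t, θ s) = θ := funext fun t => (hd t).deriv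
  obtain ⟨a, b, hab, hK⟩ : ∃ a b, Icc a b ⊆ Ioo 0 T ∧ tsupport θ ⊆ Icc a b := by
    rcases (tsupport θ).eq_empty_or_nonempty with h | h
    · exact ⟨1, 0, by simp, by simp [h]⟩
    · have hcp : IsCompact (tsupport θ) := hθ.hasCompactSupport
      refine ⟨sInf (tsupport θ), sSup (tsupport θ), ?_, fun x hx =>
        ⟨csInf_le hcp.bddBelow hx, le_csSup hcp.bddAbove hx⟩⟩
      have h1 := hθ.tsupport_subset (hcp.sInf_mem h)
      have h2 := hθ.tsupport_subset (hcp.sSup_mem h)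
      exact fun x hx => ⟨h1.1.trans_le hx.1, hx.2.trans_lt h2.2⟩
  have hz : ∀ t ∉ Icc a b, θ t = 0 := fun t ht =>
    image_eq_zero_of_notMem_tsupport fun h => ht (hK h)
  have hsupp : tsupport (fun t => ∫ s in (0 : ℝ)..t, θ s) ⊆ Icc a b := by
    refine closure_minimal (fun t ht => ?_) isClosed_Icc
    by_contra hn
    refine ht ?_
    rcases not_and_or.1 hn with h | h
    · push Not at h
      refine intervalIntegral.integral_zero_ae (Eventually.of_forall fun x hx => ?_)
      by_cases hxI : x ∈ Ioo 0 T
      · refine hz x fun hx2 => ?_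
        rcases le_total 0 t with h3 | h3
        · rw [uIoc_of_le h3] at hx; linarith [hx.2, hx2.1]
        · rw [uIoc_of_ge h3] at hx; linarith [hx.2, hxI.1]
      · exact hθ.eq_zero hxI
    · push Not at h
      have h2 : ∫ s in t..T, θ s = 0 := by
        refine intervalIntegral.integral_zero_ae (Eventually.of_forall fun x hx => ?_)
        by_cases hxI : x ∈ Ioo 0 T
        · refine hz x fun hx2 => ?_
          rcases le_total t T with h3 | h3
          · rw [uIoc_of_le h3] at hx; linarith [hx.1, hx2.2]
          · rw [uIoc_of_ge h3] at hx; linarith [hx.1, hxI.2]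
        · exact hθ.eq_zero hxI
      have h3 := intervalIntegral.integral_add_adjacent_intervals
        (hc.intervalIntegrable (μ := volume) 0 t) (hc.intervalIntegrable t T)
      rw [h0, h2, add_zero] at h3
      exact h3
  refine ⟨⟨?_, isCompact_Icc.of_isClosed_subset (isClosed_tsupport _) hsupp, hsupp.trans hab⟩,
    hderiv⟩
  rw [contDiff_infty_iff_deriv, hderiv]
  exact ⟨fun t => (hd t).differentiableAt, hθ.contDiff⟩

/-- The lemma of du Bois-Reymond. -/
theorem eq_zero_of_integral_deriv_eq_zero (hT : 0 < T) {k : ℝ → ℝ} (hk : ContinuousOn k (Icc 0 T))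
    (hk0 : k 0 = 0)
    (h : ∀ η, IsTimeTest T η → ∫ t, deriv η t * k t ∂(timeMeasure T) = 0) :
    ∀ t ∈ Icc 0 T, k t = 0 := by
  let b : ContDiffBump (T / 2) := ⟨T / 8, T / 4, by linarith, by linarith⟩
  set ρ := b.normed volume with hρdef
  have hρ : IsTimeTest T ρ := by
    refine ⟨b.contDiff_normed, b.hasCompactSupport_normed, ?_⟩
    rw [b.tsupport_normed_eq, Real.closedBall_eq_Icc]
    intro x hx
    have h1 : T / 2 - T / 4 ≤ x := hx.1
    have h2 : x ≤ T / 2 + T / 4 := hx.2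
    exact ⟨by linarith, by linarith⟩
  have hρ1 : ∫ t in (0 : ℝ)..T, ρ t = 1 := by
    rw [intervalIntegral.integral_of_le hT.le,
      setIntegral_eq_integral_of_forall_compl_eq_zero, b.integral_normed]
    intro x hx
    exact hρ.eq_zero fun h => hx ⟨h.1, h.2.le⟩
  have hkint : IntegrableOn k (Ioc 0 T) :=
    (hk.integrableOn_Icc).mono_set Ioc_subset_Icc_self
  set c := ∫ t in Ioc 0 T, ρ t * k t with hc
  have hmul : ∀ ψ, IsTimeTest T ψ → IntegrableOn (fun t => ψ t * k t) (Ioc 0 T) := by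
    intro ψ hψ
    refine (ContinuousOn.integrableOn_Icc ?_).mono_set Ioc_subset_Icc_self
    exact hψ.contDiff.continuous.continuousOn.mul hk
  have hint : ∀ ψ, IsTimeTest T ψ → IntegrableOn ψ (Ioc 0 T) := fun ψ hψ =>
    (hψ.contDiff.continuous.continuousOn.integrableOn_Icc).mono_set Ioc_subset_Icc_self
  have key : ∀ ψ, IsTimeTest T ψ → ∫ t in Ioc 0 T, ψ t * (k t - c) = 0 := by
    intro ψ hψ
    set m := ∫ t in (0 : ℝ)..T, ψ t with hm
    have hθ : IsTimeTest T (fun t => ψ t - m * ρ t) := by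
      refine ⟨hψ.contDiff.sub (contDiff_const.mul hρ.contDiff), ?_, ?_⟩
      · exact hψ.hasCompactSupport.sub (hρ.hasCompactSupport.mul_left)
      · refine (tsupport_sub _ _).trans (union_subset hψ.tsupport_subset ?_)
        exact (closure_mono (Function.support_mul_subset_right _ _)).trans hρ.tsupport_subset
    have h0 : ∫ t in (0 : ℝ)..T, (ψ t - m * ρ t) = 0 := by
      rw [intervalIntegral.integral_sub (hψ.contDiff.continuous.intervalIntegrable _ _)
        ((hρ.contDiff.continuous.intervalIntegrable _ _).const_mul m),
        intervalIntegral.integral_const_mul, hρ1, ← hm]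
      ring
    obtain ⟨hη, hηd⟩ := hθ.primitive_of_integral_eq_zero h0
    have h1 := h _ hη
    rw [hηd] at h1
    have e1 : ∫ t in Ioc 0 T, (ψ t - m * ρ t) * k t =
        (∫ t in Ioc 0 T, ψ t * k t) - m * c := by
      rw [hc, ← integral_const_mul, ← integral_sub (hmul ψ hψ) ((hmul ρ hρ).const_mul m)]
      congr 1 with t
      ring
    have e2 : ∫ t in Ioc 0 T, ψ t * (k t - c) = (∫ t in Ioc 0 T, ψ t * k t) - m * c := by
      rw [hm, intervalIntegral.integral_of_le hT.le, ← integral_mul_const,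
        ← integral_sub (hmul ψ hψ) ((hint ψ hψ).mul_const c)]
      congr 1 with t
      ring
    rw [e2, ← e1]
    exact h1
  have hae : ∀ᵐ t, t ∈ Ioo 0 T → k t - c = 0 := by
    refine isOpen_Ioo.ae_eq_zero_of_integral_contDiff_smul_eq_zero ?_ ?_
    · refine IntegrableOn.locallyIntegrableOn ?_
      exact (hkint.sub (integrableOn_const (by simp))).mono_set Ioo_subset_Ioc_self
    · intro ψ h1 h2 h3
      have h4 := key ψ ⟨h1, h2, h3⟩
      rw [setIntegral_eq_integral_of_forall_compl_eq_zero] at h4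
      · exact h4
      · intro x hx
        rw [IsTimeTest.eq_zero (T := T) ⟨h1, h2, h3⟩ fun h => hx ⟨h.1, h.2.le⟩, zero_mul]
  have heq : EqOn k (fun _ => c) (Icc 0 T) := by
    refine Measure.eqOn_Icc_of_ae_eq volume hT.ne ?_ hk continuousOn_const
    rw [← restrict_Ioo_eq_restrict_Icc]
    rw [EventuallyEq, ae_restrict_iff' measurableSet_Ioo]
    filter_upwards [hae] with t ht h'
    exact sub_eq_zero.1 (ht h')
  have hc0 : c = 0 := by rw [← hk0]; exact (heq (left_mem_Icc.2 hT.le)).symm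
  intro t ht
  rw [heq ht, hc0]

end WeakDerivative

/-! ### Weak solutions and their uniqueness -/

section State

variable {V H W : Type*} [NormedAddCommGroup V] [InnerProductSpace ℝ V] [CompleteSpace V]
  [NormedAddCommGroup H] [InnerProductSpace ℝ H] [CompleteSpace H]
  [NormedAddCommGroup W] [InnerProductSpace ℝ W] [CompleteSpace W]
  {ι : V →L[ℝ] H} {D : V →L[ℝ] W} {T : ℝ}

theorem inner_lift_toSpanSingleton (a : H) (p : TimeL2 T H) (θ : TimeL2 T ℝ) :
    inner ℝ p (lift T (ContinuousLinearMap.toSpanSingleton ℝ a) θ) =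
      inner ℝ (lift T (innerSL ℝ a) p) θ := by
  rw [L2.inner_def, L2.inner_def]
  refine integral_congr_ae ?_
  filter_upwards [lift_coe (ContinuousLinearMap.toSpanSingleton ℝ a) θ, lift_coe (innerSL ℝ a) p]
    with t h1 h2
  rw [h1, h2, ContinuousLinearMap.toSpanSingleton_apply, real_inner_smul_right, innerSL_apply_apply,
    real_inner_comm]
  rfl

theorem lift_lift_toSpanSingleton (ι : V →L[ℝ] H) (a : V) (θ : TimeL2 T ℝ) :
    lift T ι (lift T (ContinuousLinearMap.toSpanSingleton ℝ a) θ) =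
      lift T (ContinuousLinearMap.toSpanSingleton ℝ (ι a)) θ := by
  refine Lp.ext ?_
  filter_upwards [lift_coe ι (lift T (ContinuousLinearMap.toSpanSingleton ℝ a) θ),
    lift_coe (ContinuousLinearMap.toSpanSingleton ℝ a) θ,
    lift_coe (ContinuousLinearMap.toSpanSingleton ℝ (ι a)) θ] with t h1 h2 h3
  rw [h1, h2, h3]
  simp

/-- The weak equation against functions in `L₂(0,T;V)` holds pointwise in time against
vectors in `V`. -/
theorem IsStrongSol.weak_pointwise {f : V} {g z : TimeL2 T H} {y : TimeL2 T V}
    (h : IsStrongSol ι D T f g z y) (φ : V) :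
    ∀ᵐ t ∂(timeMeasure T), inner ℝ (z t) (ι φ) + inner ℝ (D (f + y t)) (D φ) =
      inner ℝ (g t) (ι φ) := by
  set w := constTime T (D f) + lift T D y with hw
  have h0 : lift T (innerSL ℝ (ι φ)) z + lift T (innerSL ℝ (D φ)) w -
      lift T (innerSL ℝ (ι φ)) g = 0 := by
    refine ext_inner_right ℝ fun θ => ?_
    have h1 := h.weak (lift T (ContinuousLinearMap.toSpanSingleton ℝ φ) θ)
    rw [lift_lift_toSpanSingleton, lift_lift_toSpanSingleton, inner_lift_toSpanSingleton,
      inner_lift_toSpanSingleton, inner_lift_toSpanSingleton] at h1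
    rw [inner_sub_left, inner_add_left, inner_zero_left, h1, sub_self]
  have h1 := Lp.coeFn_zero ℝ 2 (timeMeasure T)
  rw [← h0] at h1
  filter_upwards [h1, Lp.coeFn_sub (lift T (innerSL ℝ (ι φ)) z + lift T (innerSL ℝ (D φ)) w)
    (lift T (innerSL ℝ (ι φ)) g), Lp.coeFn_add (lift T (innerSL ℝ (ι φ)) z)
    (lift T (innerSL ℝ (D φ)) w), lift_coe (innerSL ℝ (ι φ)) z, lift_coe (innerSL ℝ (D φ)) w,
    lift_coe (innerSL ℝ (ι φ)) g, Lp.coeFn_add (constTime T (D f)) (lift T D y), lift_coe D y,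
    constTime_coe (T := T) (D f)] with t e1 e2 e3 e4 e5 e6 e7 e8 e9
  rw [e2, Pi.sub_apply, e3, Pi.add_apply, e4, e5, e6, hw, e7, Pi.add_apply, e8, e9] at e1
  simp only [innerSL_apply_apply, Pi.zero_apply] at e1
  rw [map_add, real_inner_comm, real_inner_comm (D φ), real_inner_comm (ι φ) (g t)]
  linarith

/-- A vector of `H` as a functional on `V`. -/
def toDualOf (ι : V →L[ℝ] H) : H →L[ℝ] StrongDual ℝ V :=
  ((ContinuousLinearMap.compL ℝ V H ℝ).flip ι).comp (innerSL ℝ)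

theorem toDualOf_apply (z : H) (φ : V) : toDualOf ι z φ = inner ℝ z (ι φ) := rfl

/-- The weak formulation of `∂ₜy + D†D y = g`, `y(0) = f`, for an abstract pair `ι : V → H`,
`D : V → W`. -/
def IsWeakSol (ι : V →L[ℝ] H) (D : V →L[ℝ] W) (T : ℝ) (g : ℝ → H) (f : V) (y : ℝ → V) : Prop :=
  MemL2Time T y ∧
  (∃ y' : ℝ → StrongDual ℝ V, MemL2Time T y' ∧
    (∀ η, IsTimeTest T η → ∀ φ : V, ∫ t, deriv η t * inner ℝ (ι (y t)) (ι φ) ∂(timeMeasure T) =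
        -∫ t, η t * y' t φ ∂(timeMeasure T)) ∧
    ∀ φ : V, ∀ᵐ t ∂(timeMeasure T),
      y' t φ + inner ℝ (D (y t)) (D φ) = inner ℝ (g t) (ι φ)) ∧
  ∃ Y : ℝ → H, ContinuousOn Y (Icc 0 T) ∧ (∀ᵐ t ∂(timeMeasure T), Y t = ι (y t)) ∧ Y 0 = ι f

theorem IsStrongSol.isWeakSol (hT : 0 < T) {f : V} {g z : TimeL2 T H} {y : TimeL2 T V}
    (h : IsStrongSol ι D T f g z y) : IsWeakSol ι D T g f (fun t => f + y t) := by
  have hy : ∀ᵐ t ∂(timeMeasure T), ι (y t) = primitive T z t := by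
    have h1 := lift_coe ι y
    rw [h.eq_volterra] at h1
    filter_upwards [h1, volterra_coe z] with t e1 e2
    rw [← e1, e2]
  refine ⟨(memLp_const f).add (Lp.memLp y), ⟨fun t => toDualOf ι (z t),
    (toDualOf ι).comp_memLp' (Lp.memLp z), ?_, ?_⟩, ?_⟩
  · intro η hη φ
    set θ := lift T (innerSL ℝ (ι φ)) z with hθ
    have hθc := lift_coe (innerSL ℝ (ι φ)) z
    have e1 := hη.integral_deriv_mul_primitive hT.le θ
    have e2 := hη.integral_deriv_eq_zero hT.le
    have e3 : ∫ t, η t * θ t ∂(timeMeasure T) =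
        ∫ t, η t * toDualOf ι (z t) φ ∂(timeMeasure T) := by
      refine integral_congr_ae ?_
      filter_upwards [hθc] with t ht
      rw [hθ, ht, toDualOf_apply, innerSL_apply_apply, real_inner_comm]
    have e4 : ∫ t, deriv η t * inner ℝ (ι (f + y t)) (ι φ) ∂(timeMeasure T) =
        ∫ t, (deriv η t * primitive T θ t +
          deriv η t * inner ℝ (ι f) (ι φ)) ∂(timeMeasure T) := by
      refine integral_congr_ae ?_
      filter_upwards [hy] with t ht
      rw [hθ, primitive_congr hθc, primitive_comp _ (integrable_of_timeL2 z), map_add, ht,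
        inner_add_left, innerSL_apply_apply, real_inner_comm (ι φ) (primitive T z t)]
      ring
    have hi : Integrable (deriv η) (timeMeasure T) :=
      (hη.continuous_deriv.integrable_of_hasCompactSupport hη.hasCompactSupport.deriv).restrict
    have hi2 : Integrable (fun t => deriv η t * primitive T θ t) (timeMeasure T) :=
      ((hη.continuous_deriv.mul
        (continuous_primitive (integrable_of_timeL2 θ))).integrable_of_hasCompactSupport
          hη.hasCompactSupport.deriv.mul_right).restrict
    rw [e4, integral_add hi2 (hi.mul_const _), integral_mul_const, e2, e1, e3]
    ring
  · intro φ
    exact h.weak_pointwise φ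
  · refine ⟨fun t => ι f + primitive T z t,
      (continuous_const.add (continuous_primitive (integrable_of_timeL2 z))).continuousOn, ?_, ?_⟩
    · filter_upwards [hy] with t ht
      rw [map_add, ht]
    · simp [primitive_zero]

theorem integrable_testDeriv_mul {η : ℝ → ℝ} (hη : IsTimeTest T η) {θ : ℝ → ℝ}
    (hθ : Integrable θ (timeMeasure T)) :
    Integrable (fun t => deriv η t * θ t) (timeMeasure T) := by
  obtain ⟨C, hC⟩ := hη.continuous_deriv.bounded_above_of_compact_support
    hη.hasCompactSupport.deriv
  exact hθ.bdd_mul hη.continuous_deriv.aestronglyMeasurable (Eventually.of_forall hC)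

theorem integrable_test_mul {η : ℝ → ℝ} (hη : IsTimeTest T η) {θ : ℝ → ℝ}
    (hθ : Integrable θ (timeMeasure T)) :
    Integrable (fun t => η t * θ t) (timeMeasure T) := by
  obtain ⟨C, hC⟩ := hη.contDiff.continuous.bounded_above_of_compact_support
    hη.hasCompactSupport
  exact hθ.bdd_mul hη.contDiff.continuous.aestronglyMeasurable (Eventually.of_forall hC)

/-- The difference `w` of two weak solutions satisfies `∂ₜw + D†D w = 0`, tested in time with `η`
and in `V` with `φ`. -/
theorem IsWeakSol.integral_deriv_sub {g : ℝ → H} {f : V}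
    {y₁ y₂ : ℝ → V} (h₁ : IsWeakSol ι D T g f y₁) (h₂ : IsWeakSol ι D T g f y₂)
    {η : ℝ → ℝ} (hη : IsTimeTest T η) (φ : V) :
    ∫ t, deriv η t * inner ℝ (ι (y₁ t - y₂ t)) (ι φ) ∂(timeMeasure T) =
      ∫ t, η t * inner ℝ (D (y₁ t - y₂ t)) (D φ) ∂(timeMeasure T) := by
  obtain ⟨hm₁, ⟨y₁', hm₁', hw₁, he₁⟩, -⟩ := h₁
  obtain ⟨hm₂, ⟨y₂', hm₂', hw₂, he₂⟩, -⟩ := h₂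
  have e1 := hw₁ η hη φ
  have e2 := hw₂ η hη φ
  have i1 : Integrable (fun t => inner ℝ (ι (y₁ t)) (ι φ)) (timeMeasure T) :=
    ((ι.comp_memLp' hm₁).integrable one_le_two).inner_const _
  have i2 : Integrable (fun t => inner ℝ (ι (y₂ t)) (ι φ)) (timeMeasure T) :=
    ((ι.comp_memLp' hm₂).integrable one_le_two).inner_const _
  have j1 : Integrable (fun t => y₁' t φ) (timeMeasure T) :=
    (ContinuousLinearMap.apply ℝ ℝ φ).integrable_comp (hm₁'.integrable one_le_two)
  have j2 : Integrable (fun t => y₂' t φ) (timeMeasure T) :=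
    (ContinuousLinearMap.apply ℝ ℝ φ).integrable_comp (hm₂'.integrable one_le_two)
  have l1 : ∫ t, deriv η t * inner ℝ (ι (y₁ t - y₂ t)) (ι φ) ∂(timeMeasure T) =
      (∫ t, deriv η t * inner ℝ (ι (y₁ t)) (ι φ) ∂(timeMeasure T)) -
      ∫ t, deriv η t * inner ℝ (ι (y₂ t)) (ι φ) ∂(timeMeasure T) := by
    rw [← integral_sub (integrable_testDeriv_mul hη i1) (integrable_testDeriv_mul hη i2)]
    congr 1 with t
    rw [map_sub, inner_sub_left]
    ring
  have l2 : ∫ t, η t * inner ℝ (D (y₁ t - y₂ t)) (D φ) ∂(timeMeasure T) =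
      (∫ t, η t * y₂' t φ ∂(timeMeasure T)) - ∫ t, η t * y₁' t φ ∂(timeMeasure T) := by
    rw [← integral_sub (integrable_test_mul hη j2) (integrable_test_mul hη j1)]
    refine integral_congr_ae ?_
    filter_upwards [he₁ φ, he₂ φ] with t a1 a2
    rw [← mul_sub, map_sub, inner_sub_left]
    congr 1
    linarith
  rw [l1, l2, e1, e2]
  ring

/-- Uniqueness of weak solutions. Integration in time of the equation for the difference `w` gives
`⟨ι w(t), ι φ⟩ + ⟨D ∫₀ᵗ w, D φ⟩ = 0` for all `φ ∈ V`. The choices `φ = ∫₀ᵗ w` and `φ = w(t)`,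
integrated over `(0,T)`, then suffice; no chain rule for `‖ι w(t)‖²` is needed. -/
theorem IsWeakSol.val_ae_eq (hT : 0 < T) {g : ℝ → H} {f : V}
    {y₁ y₂ : ℝ → V} (h₁ : IsWeakSol ι D T g f y₁) (h₂ : IsWeakSol ι D T g f y₂) :
    ∀ᵐ t ∂(timeMeasure T), ι (y₁ t) = ι (y₂ t) := by
  obtain ⟨Y₁, hc₁, hY₁, hf₁⟩ := h₁.2.2
  obtain ⟨Y₂, hc₂, hY₂, hf₂⟩ := h₂.2.2
  have hm : MemLp (fun t => y₁ t - y₂ t) 2 (timeMeasure T) := h₁.1.sub h₂.1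
  set p : TimeL2 T (V) := hm.toLp _ with hp
  have hpc : p =ᵐ[timeMeasure T] fun t => y₁ t - y₂ t := hm.coeFn_toLp
  have hY : ∀ᵐ t ∂(timeMeasure T), Y₁ t - Y₂ t = ι (p t) := by
    filter_upwards [hY₁, hY₂, hpc] with t e1 e2 e3
    rw [e1, e2, e3, map_sub]
  -- The left-hand side is continuous, has zero weak derivative and vanishes at time zero.
  have key : ∀ t ∈ Icc 0 T, ∀ φ : V, inner ℝ (Y₁ t - Y₂ t) (ι φ) +
      inner ℝ (D (primitive T p t)) (D φ) = 0 := by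
    intro t ht φ
    set θ := lift T (innerSL ℝ (D φ)) (lift T D p) with hθ
    have hθc : θ =ᵐ[timeMeasure T] fun t => inner ℝ (D φ) (D (p t)) := by
      filter_upwards [lift_coe (innerSL ℝ (D φ)) (lift T D p),
        lift_coe D p] with t a1 a2
      rw [hθ, a1, a2]; rfl
    have hprim : ∀ t, primitive T θ t =
        inner ℝ (D (primitive T p t)) (D φ) := by
      intro t
      rw [hθ, primitive_congr (lift_coe _ _), primitive_comp _ (integrable_of_timeL2 _),
        primitive_congr (lift_coe _ _), primitive_comp _ (integrable_of_timeL2 _),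
        innerSL_apply_apply, real_inner_comm]
    rw [← hprim]
    refine eq_zero_of_integral_deriv_eq_zero hT
      (k := fun t => inner ℝ (Y₁ t - Y₂ t) (ι φ) + primitive T θ t) ?_ ?_ ?_ t ht
    · exact ((hc₁.sub hc₂).inner continuousOn_const).add
        (continuous_primitive (integrable_of_timeL2 θ)).continuousOn
    · simp [hf₁, hf₂, primitive_zero]
    · intro η hη
      have a1 := h₁.integral_deriv_sub h₂ hη φ
      have a2 := hη.integral_deriv_mul_primitive hT.le θ
      have i1 : Integrable (fun t => inner ℝ (ι (p t)) (ι φ)) (timeMeasure T) :=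
        (ι.integrable_comp (integrable_of_timeL2 p)).inner_const _
      have i2 : Integrable (primitive T θ) (timeMeasure T) :=
        (memLp_primitive θ).integrable one_le_two
      have a3 : ∫ t, deriv η t * (inner ℝ (Y₁ t - Y₂ t) (ι φ) + primitive T θ t)
          ∂(timeMeasure T) = ∫ t, (deriv η t * inner ℝ (ι (p t)) (ι φ) +
            deriv η t * primitive T θ t) ∂(timeMeasure T) := by
        refine integral_congr_ae ?_
        filter_upwards [hY] with t b1
        rw [b1, mul_add]
      have a4 : ∫ t, deriv η t * inner ℝ (ι (p t)) (ι φ) ∂(timeMeasure T) =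
          ∫ t, η t * θ t ∂(timeMeasure T) := by
        calc _ = ∫ t, deriv η t * inner ℝ (ι (y₁ t - y₂ t)) (ι φ)
              ∂(timeMeasure T) := by
              refine integral_congr_ae ?_
              filter_upwards [hpc] with t b1
              rw [b1]
          _ = _ := a1
          _ = _ := by
              refine integral_congr_ae ?_
              filter_upwards [hpc, hθc] with t b1 b2
              rw [b2, b1, real_inner_comm]
      rw [a3, integral_add (integrable_testDeriv_mul hη i1) (integrable_testDeriv_mul hη i2),
        a4, a2, add_neg_cancel]
  have weak : ∀ ψ : TimeL2 T (V), inner ℝ (lift T ι p) (lift T ι ψ) +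
      inner ℝ (lift T D (volterra T _ p)) (lift T D ψ) = 0 := by
    intro ψ
    rw [L2.inner_def, L2.inner_def, ← integral_add (L2.integrable_inner _ _)
      (L2.integrable_inner _ _)]
    refine integral_eq_zero_of_ae ?_
    filter_upwards [lift_coe ι p, lift_coe ι ψ, lift_coe D (volterra T _ p),
      lift_coe D ψ, volterra_coe p, hY, ae_restrict_mem measurableSet_Ioc]
      with t b1 b2 b3 b4 b5 b6 b7
    rw [b1, b2, b3, b4, b5, ← b6]
    exact key t ⟨b7.1.le, b7.2⟩ (ψ t)
  have w1 := weak (volterra T _ p)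
  rw [← volterra_lift, real_inner_self_eq_norm_sq] at w1
  have w2 := inner_volterra_self_nonneg hT.le (lift T ι p)
  rw [real_inner_comm] at w2
  have w3 : lift T D (volterra T _ p) = 0 := by
    rw [← norm_eq_zero]
    have := norm_nonneg (lift T D (volterra T (V) p))
    nlinarith
  have w4 := weak p
  rw [w3, inner_zero_left, add_zero, real_inner_self_eq_norm_sq] at w4
  have w5 : lift T ι p = 0 := by
    rw [← norm_eq_zero]
    exact pow_eq_zero_iff two_ne_zero |>.1 w4
  have w6 := lift_coe ι p
  rw [w5] at w6
  filter_upwards [w6, Lp.coeFn_zero (H) 2 (timeMeasure T), hpc] with t c1 c2 c3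
  rw [c2, c3, map_sub] at c1
  exact (sub_eq_zero.1 c1.symm)

variable {d : ℕ} {Ω : Set (E d)}

instance H10.instCompleteSpace : CompleteSpace (H10 Ω) :=
  (Submodule.isClosed_topologicalClosure _).completeSpace_coe

theorem H10.isGraphInner : IsGraphInner (H10.val (Ω := Ω)) H10.grad := fun v w =>
  WithLp.prod_inner_apply (v : WithLp 2 (L2 Ω × L2Vec Ω)) w

/-- A state is a weak solution with right-hand side `χ_ω u`. -/
theorem isState_iff_isWeakSol {ω : Set (E d)} {u : ℝ → L2 Ω} {f : H10 Ω}
    {g : ℝ → L2 Ω} {y : ℝ → H10 Ω}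
    (hg : ∀ᵐ t ∂(timeMeasure T), g t =ᵐ[volume.restrict Ω] ω.indicator (u t)) :
    IsState Ω T ω u f y ↔ IsWeakSol H10.val H10.grad T g f y := by
  have hr : ∀ φ : H10 Ω, ∀ᵐ t ∂(timeMeasure T),
      ∫ x in Ω, ω.indicator (u t) x * H10.val φ x = inner ℝ (g t) (H10.val φ) := by
    intro φ
    filter_upwards [hg] with t ht
    rw [L2.inner_def]
    refine integral_congr_ae ?_
    filter_upwards [ht] with x hx
    rw [hx]
    exact mul_comm _ _
  constructor
  · rintro ⟨h1, ⟨y', h2, h3, h4⟩, h5⟩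
    refine ⟨h1, ⟨y', h2, fun η hη => h3 η hη.1 hη.2 hη.3, fun φ => ?_⟩, h5⟩
    filter_upwards [hr φ, h4 φ] with t e1 e2
    exact e2.trans e1
  · rintro ⟨h1, ⟨y', h2, h3, h4⟩, h5⟩
    refine ⟨h1, ⟨y', h2, fun η a b c => h3 η ⟨a, b, c⟩, fun φ => ?_⟩, h5⟩
    filter_upwards [hr φ, h4 φ] with t e1 e2
    exact e2.trans e1.symm

end State

/-! ### Differentiability of the optimal value of a least squares problem -/

section Danskin

/-- A regularized least squares problem over a closed convex set has a minimizer, and the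
functional grows quadratically away from it. -/
theorem exists_minimizer_quadratic_growth {X Y : Type*} [NormedAddCommGroup X]
    [InnerProductSpace ℝ X] [CompleteSpace X] [NormedAddCommGroup Y] [InnerProductSpace ℝ Y]
    [CompleteSpace Y] (A : X →L[ℝ] Y) (b : Y) {γ : ℝ} (hγ : 0 < γ) {K : Set X}
    (hK : IsClosed K) (hconv : Convex ℝ K) (hne : K.Nonempty) :
    ∃ u₀ ∈ K, ∀ u ∈ K, ‖b + A u₀‖ ^ 2 + γ * ‖u₀‖ ^ 2 + γ * ‖u - u₀‖ ^ 2 ≤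
      ‖b + A u‖ ^ 2 + γ * ‖u‖ ^ 2 := by
  have hsq : (√γ) ^ 2 = γ := Real.sq_sqrt hγ.le
  have hs : 0 < √γ := Real.sqrt_pos.2 hγ
  -- The functional is the squared distance of `j u` to the origin.
  let j : X → WithLp 2 (Y × X) := fun u => WithLp.toLp 2 (b + A u, √γ • u)
  have hj : ∀ u, ‖j u‖ ^ 2 = ‖b + A u‖ ^ 2 + γ * ‖u‖ ^ 2 := fun u => by
    rw [WithLp.prod_norm_sq_eq_of_L2]
    change ‖b + A u‖ ^ 2 + ‖√γ • u‖ ^ 2 = _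
    rw [norm_smul, mul_pow, Real.norm_eq_abs, sq_abs, hsq]
  have hjs : ∀ u v, γ * ‖u - v‖ ^ 2 ≤ ‖j u - j v‖ ^ 2 := fun u v => by
    rw [WithLp.prod_norm_sq_eq_of_L2]
    have : (j u - j v).snd = √γ • (u - v) := by simp [j, smul_sub]
    rw [this, norm_smul, mul_pow, Real.norm_eq_abs, sq_abs, hsq]
    have := sq_nonneg ‖(j u - j v).fst‖
    linarith
  have hcont : UniformContinuous j :=
    (WithLp.prod_uniformContinuous_toLp 2 Y X).comp
      ((uniformContinuous_const.add A.uniformContinuous).prodMk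
        (uniformContinuous_id.const_smul _))
  have hanti : AntilipschitzWith (Real.toNNReal (√γ)⁻¹) j := by
    refine AntilipschitzWith.of_le_mul_dist fun u v => ?_
    rw [Real.coe_toNNReal _ (by positivity), dist_eq_norm, dist_eq_norm, inv_mul_eq_div,
      le_div_iff₀ hs]
    refine le_of_sq_le_sq ?_ (norm_nonneg _)
    have := hjs u v
    rw [mul_pow, hsq]
    linarith
  have hcomplete : IsComplete (j '' K) :=
    ((hanti.isClosedEmbedding hcont).isClosedMap K hK).isComplete
  have hjconv : Convex ℝ (j '' K) := by
    rintro _ ⟨u, hu, rfl⟩ _ ⟨v, hv, rfl⟩ a c ha hc hac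
    refine ⟨a • u + c • v, hconv hu hv ha hc hac, ?_⟩
    have e1 : b + A (a • u + c • v) = a • (b + A u) + c • (b + A v) := by
      rw [smul_add, smul_add, map_add, map_smul, map_smul]
      nth_rewrite 1 [← one_smul ℝ b]
      rw [← hac, add_smul]
      abel
    have e2 : √γ • (a • u + c • v) = a • √γ • u + c • √γ • v := by
      rw [smul_add, smul_comm _ a, smul_comm _ c]
    simp only [j, e1, e2]
    rfl
  obtain ⟨x, ⟨u₀, hu₀, rfl⟩, hx⟩ :=
    exists_norm_eq_iInf_of_complete_convex (hne.image j) hcomplete hjconv 0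
  rw [norm_eq_iInf_iff_real_inner_le_zero hjconv (mem_image_of_mem j hu₀)] at hx
  refine ⟨u₀, hu₀, fun u hu => ?_⟩
  have h1 := hx (j u) (mem_image_of_mem j hu)
  rw [zero_sub, inner_neg_left] at h1
  have h2 : ‖j u‖ ^ 2 = ‖j u₀‖ ^ 2 + 2 * inner ℝ (j u₀) (j u - j u₀) + ‖j u - j u₀‖ ^ 2 := by
    rw [← norm_add_sq_real, add_sub_cancel]
  have h3 := hjs u u₀
  rw [hj, hj] at h2
  linarith

/-- Differentiation of an infimum. Quadratic growth of `G₀` at its minimizer `u₀` and the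
Lipschitz bound for `u ↦ G t u - G₀ u` show that `inf G t = G t u₀ + O(t²)`. -/
theorem tendsto_inf_div {X : Type*} [NormedAddCommGroup X] {K : Set X} {G : ℝ → X → ℝ}
    {G₀ : X → ℝ} {u₀ : X} (hu₀ : u₀ ∈ K) {γ C t₀ L : ℝ} (hγ : 0 < γ) (hC : 0 ≤ C) (ht₀ : 0 < t₀)
    (hmin : ∀ u ∈ K, G₀ u₀ + γ * ‖u - u₀‖ ^ 2 ≤ G₀ u)
    (hlip : ∀ t ∈ Ioo 0 t₀, ∀ u ∈ K, |(G t u - G₀ u) - (G t u₀ - G₀ u₀)| ≤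
      C * t * (‖u - u₀‖ * (1 + ‖u - u₀‖)))
    (hlim : Tendsto (fun t => (G t u₀ - G₀ u₀) / t) (𝓝[>] 0) (𝓝 L)) :
    Tendsto (fun t => (sInf (G t '' K) - sInf (G₀ '' K)) / t) (𝓝[>] 0) (𝓝 L) := by
  have h0 : sInf (G₀ '' K) = G₀ u₀ := by
    refine IsLeast.csInf_eq ⟨mem_image_of_mem _ hu₀, ?_⟩
    rintro _ ⟨u, hu, rfl⟩
    have := hmin u hu
    have := mul_nonneg hγ.le (sq_nonneg ‖u - u₀‖)
    linarith
  set B := C ^ 2 / (2 * γ) with hB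
  have hsmall : ∀ᶠ t : ℝ in 𝓝[>] 0, 0 < t ∧ t < t₀ ∧ C * t ≤ γ / 2 := by
    have h1 : ∀ᶠ t : ℝ in 𝓝[>] 0, t ∈ Ioo 0 (min t₀ (γ / (2 * (C + 1)))) :=
      Ioo_mem_nhdsGT (lt_min ht₀ (by positivity))
    filter_upwards [h1] with t ht
    have h2 := ht.2.trans_le (min_le_right _ _)
    refine ⟨ht.1, ht.2.trans_le (min_le_left _ _), ?_⟩
    rw [lt_div_iff₀ (by positivity)] at h2
    nlinarith [ht.1]
  have hlow : ∀ᶠ t : ℝ in 𝓝[>] 0, ∀ u ∈ K, G t u₀ - B * t ^ 2 ≤ G t u := by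
    filter_upwards [hsmall] with t ht u hu
    have h1 := (abs_le.1 (hlip t ⟨ht.1, ht.2.1⟩ u hu)).1
    have h2 := hmin u hu
    set r := ‖u - u₀‖
    have hr : 0 ≤ r := norm_nonneg _
    have h3 : C * t * (r * (1 + r)) ≤ C * t * r + γ / 2 * r ^ 2 := by
      have := mul_le_mul_of_nonneg_right ht.2.2 (sq_nonneg r)
      nlinarith
    have h4 : C * t * r ≤ γ / 2 * r ^ 2 + B * t ^ 2 := by
      have h5 : γ / 2 * r ^ 2 + B * t ^ 2 - C * t * r = (γ * r - C * t) ^ 2 / (2 * γ) := by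
        rw [hB]; field_simp; ring
      have h6 : 0 ≤ (γ * r - C * t) ^ 2 / (2 * γ) := by positivity
      linarith
    linarith
  have hlim2 : Tendsto (fun t => (G t u₀ - G₀ u₀) / t - B * t) (𝓝[>] 0) (𝓝 L) := by
    have : Tendsto (fun t : ℝ => B * t) (𝓝[>] 0) (𝓝 0) := by
      have h := (continuous_const.mul continuous_id (X := ℝ) (M := ℝ)).tendsto' (x := 0)
        (f := fun t => B * t) 0 (by simp)
      exact h.mono_left nhdsWithin_le_nhds
    simpa using hlim.sub this
  refine tendsto_of_tendsto_of_tendsto_of_le_of_le' hlim2 hlim ?_ ?_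
  · filter_upwards [hsmall, hlow] with t ht hl
    have h1 : G t u₀ - B * t ^ 2 ≤ sInf (G t '' K) := by
      refine le_csInf ⟨_, mem_image_of_mem _ hu₀⟩ ?_
      rintro _ ⟨u, hu, rfl⟩
      exact hl u hu
    rw [h0, le_div_iff₀ ht.1, sub_mul, div_mul_cancel₀ _ ht.1.ne']
    linarith
  · filter_upwards [hsmall, hlow] with t ht hl
    have h1 : sInf (G t '' K) ≤ G t u₀ := by
      refine csInf_le ⟨G t u₀ - B * t ^ 2, ?_⟩ (mem_image_of_mem _ hu₀)
      rintro _ ⟨u, hu, rfl⟩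
      exact hl u hu
    rw [h0]
    exact div_le_div_of_nonneg_right (by linarith) ht.1.le

end Danskin

/-! ### The optimal value along a transport family -/

section Perturbation

variable {V H W E F : Type*} [NormedAddCommGroup V] [InnerProductSpace ℝ V] [CompleteSpace V]
  [NormedAddCommGroup H] [InnerProductSpace ℝ H] [CompleteSpace H]
  [NormedAddCommGroup W] [InnerProductSpace ℝ W] [CompleteSpace W]
  [NormedAddCommGroup E] [NormedAddCommGroup F]
  {ι : V →L[ℝ] H} {D : V →L[ℝ] W} {T : ℝ}

/-- The transport operators `P t` are, in the weak sense, differentiable at `t = 0` with values in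
the dual of `V`, and their squares `(P t)†(P t)` are so in the bounded operators. -/
structure IsTransportFamily (ι : V →L[ℝ] H) (P : ℝ → H →L[ℝ] H) (C t₀ : ℝ) : Prop where
  nonneg : 0 ≤ C
  pos : 0 < t₀
  bound_sub : ∀ t ∈ Ioo 0 t₀, ∀ v φ, |inner ℝ (P t v - v) (ι φ)| ≤ C * t * (‖v‖ * ‖φ‖)
  lim_sub : ∀ v φ, ∃ l, Tendsto (fun t => inner ℝ (P t v - v) (ι φ) / t) (𝓝[>] 0) (𝓝 l)
  bound_sq : ∀ t ∈ Ioo 0 t₀, ∀ v w, |inner ℝ (P t v) (P t w) - inner ℝ v w| ≤ C * t * (‖v‖ * ‖w‖)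
  lim_sq : ∀ v, ∃ l, Tendsto (fun t => (inner ℝ (P t v) (P t v) - inner ℝ v v) / t) (𝓝[>] 0) (𝓝 l)

/-- Difference quotients that converge for every `s` and are dominated converge after
integration in `s`. -/
theorem exists_tendsto_integral_div (p : TimeL2 T E) (q : TimeL2 T F) {θ : ℝ → ℝ → ℝ} {C t₀ : ℝ}
    (ht₀ : 0 < t₀)
    (hm : ∀ t, AEStronglyMeasurable (θ t) (timeMeasure T))
    (h : ∀ t ∈ Ioo 0 t₀, ∀ s, |θ t s| ≤ C * t * (‖p s‖ * ‖q s‖))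
    (hl : ∀ s, ∃ l, Tendsto (fun t => θ t s / t) (𝓝[>] 0) (𝓝 l)) :
    ∃ l, Tendsto (fun t => (∫ s, θ t s ∂(timeMeasure T)) / t) (𝓝[>] 0) (𝓝 l) := by
  choose l hl using hl
  refine ⟨∫ s, l s ∂(timeMeasure T), ?_⟩
  simp_rw [← integral_div]
  refine tendsto_integral_filter_of_dominated_convergence (fun s => C * (‖p s‖ * ‖q s‖))
    (Eventually.of_forall fun t => by simpa only [div_eq_mul_inv] using (hm t).mul_const t⁻¹) ?_
    ((integrable_norm_mul_norm p q).const_mul C) (Eventually.of_forall hl)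
  filter_upwards [Ioo_mem_nhdsGT ht₀] with t ht
  refine Eventually.of_forall fun s => ?_
  rw [Real.norm_eq_abs, abs_div, abs_of_pos ht.1, div_le_iff₀ ht.1]
  refine (h t ht s).trans (le_of_eq ?_)
  ring

/-- A transport family on `H` acts on `L₂(0,T;H)` as a transport family. -/
theorem IsTransportFamily.lift {P : ℝ → H →L[ℝ] H} {C t₀ : ℝ} (h : IsTransportFamily ι P C t₀)
    (T : ℝ) :
    IsTransportFamily (ActuatorDesign.lift T ι) (fun t => ActuatorDesign.lift T (P t)) C t₀ := by
  have e1 : ∀ t (v : TimeL2 T H) (φ : TimeL2 T V),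
      inner ℝ (ActuatorDesign.lift T (P t) v - v) (ActuatorDesign.lift T ι φ) =
        ∫ s, inner ℝ (P t (v s) - v s) (ι (φ s)) ∂(timeMeasure T) := by
    intro t v φ
    rw [L2.inner_def]
    refine integral_congr_ae ?_
    filter_upwards [Lp.coeFn_sub (ActuatorDesign.lift T (P t) v) v, lift_coe (P t) v,
      lift_coe ι φ] with s a1 a2 a3
    rw [a1, Pi.sub_apply, a2, a3]
  have e2 : ∀ t (v w : TimeL2 T H),
      inner ℝ (ActuatorDesign.lift T (P t) v) (ActuatorDesign.lift T (P t) w) - inner ℝ v w =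
        ∫ s, (inner ℝ (P t (v s)) (P t (w s)) - inner ℝ (v s) (w s)) ∂(timeMeasure T) := by
    intro t v w
    rw [L2.inner_def, L2.inner_def, ← integral_sub (L2.integrable_inner _ _)
      (L2.integrable_inner _ _)]
    refine integral_congr_ae ?_
    filter_upwards [lift_coe (P t) v, lift_coe (P t) w] with s a1 a2
    rw [a1, a2]
  have m1 : ∀ t (v : TimeL2 T H), AEStronglyMeasurable (fun s => P t (v s)) (timeMeasure T) :=
    fun t v => (P t).continuous.comp_aestronglyMeasurable (Lp.memLp v).1
  refine ⟨h.nonneg, h.pos, fun t ht v φ => ?_, fun v φ => ?_, fun t ht v w => ?_, fun v => ?_⟩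
  · rw [e1]
    exact abs_integral_le_of_pointwise v φ (mul_nonneg h.nonneg ht.1.le)
      (Eventually.of_forall fun s => h.bound_sub t ht _ _)
  · simp_rw [e1]
    exact exists_tendsto_integral_div v φ h.pos
      (fun t => ((m1 t v).sub (Lp.memLp v).1).inner
        (ι.continuous.comp_aestronglyMeasurable (Lp.memLp φ).1))
      (fun t ht s => h.bound_sub t ht _ _) (fun s => h.lim_sub _ _)
  · rw [e2]
    exact abs_integral_le_of_pointwise v w (mul_nonneg h.nonneg ht.1.le)
      (Eventually.of_forall fun s => h.bound_sq t ht _ _)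
  · simp_rw [e2]
    exact exists_tendsto_integral_div v v h.pos
      (fun t => ((m1 t v).inner (m1 t v)).sub ((Lp.memLp v).1.inner (Lp.memLp v).1))
      (fun t ht s => h.bound_sq t ht _ _) (fun s => h.lim_sq _)

/-- The constant in the Lipschitz estimate of the variation of the cost. Here `r` is the distance of
the control to the minimizer, whose norm is `R`; `β` and `a` are the norms of the affine state map,
and `c`, `k` the Lipschitz constants in `t` of the state and of the squared control. -/
theorem variation_bound {β a c k γ R r t t₀ : ℝ} (hβ : 0 ≤ β) (ha : 0 ≤ a) (hc : 0 ≤ c)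
    (hk : 0 ≤ k) (hγ : 0 ≤ γ) (hR : 0 ≤ R) (hr : 0 ≤ r) (ht : 0 ≤ t) (htt : t ≤ t₀) :
    2 * (c * t * r * (β + a * (R + r)) + c * t * R * (a * r)) +
        c * t * r * (c * t * (2 * R + r)) + γ * (k * t * (r * (R + r)) + k * t * (R * r)) ≤
      (2 * c * (β + a * (R + 1)) + 2 * c * R * a + c ^ 2 * t₀ * (2 * R + 1) +
        γ * k * (2 * R + 1)) * t * (r * (1 + r)) := by
  have f1 : β + a * (R + r) ≤ (β + a * (R + 1)) * (1 + r) := by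
    have : 0 ≤ β * r + a * R * r + a := by positivity
    linarith
  have f2 : 2 * R + r ≤ (2 * R + 1) * (1 + r) := by
    have := mul_nonneg hR hr
    linarith
  have f3 : (1 : ℝ) ≤ 1 + r := by linarith
  have h1 := mul_le_mul_of_nonneg_left f1 (by positivity : 0 ≤ 2 * (c * t * r))
  have h2 := mul_le_mul_of_nonneg_left f3 (by positivity : 0 ≤ 2 * (c * t * R * (a * r)))
  have h3 := mul_le_mul_of_nonneg_left
    (mul_le_mul htt f2 (by positivity) (ht.trans htt)) (by positivity : 0 ≤ c * t * r * c)
  have h4 := mul_le_mul_of_nonneg_left f2 (by positivity : 0 ≤ γ * (k * t * r))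
  linarith

/-- The optimal value of the transported control problems is differentiable at `t = 0`. The state
`ι Λ (P t) χ u` depends on `t` in a Lipschitz way, since `Λ` is bounded with respect to the dual
norm, and the first variation of `‖b + ι Λ (P t) χ u‖²` is computed with the adjoint state. -/
theorem exists_tendsto_optimal_value {P : ℝ → H →L[ℝ] H} {C₀ t₀ : ℝ}
    (hP : IsTransportFamily ι P C₀ t₀) (χ : H →L[ℝ] H)
    {Λ : TimeL2 T H →L[ℝ] TimeL2 T V} {C₁ : ℝ} (hC₁ : 0 ≤ C₁)
    (hb : ∀ g (δ : ℝ), 0 ≤ δ → (∀ ψ, |inner ℝ g (lift T ι ψ)| ≤ δ * ‖ψ‖) → ‖Λ g‖ ≤ C₁ * δ)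
    (hadj : ∀ h : TimeL2 T V, ∃ p : TimeL2 T V, ∀ g, inner ℝ (Λ g) h = inner ℝ g (lift T ι p))
    (b : TimeL2 T H) {γ : ℝ} (hγ : 0 < γ) {K : Set (TimeL2 T H)} (hK : IsClosed K)
    (hconv : Convex ℝ K) (hne : K.Nonempty) :
    ∃ L, Tendsto (fun t => (sInf ((fun u => ‖b + lift T ι (Λ (lift T (P t) (lift T χ u)))‖ ^ 2 +
      γ * ‖lift T (P t) u‖ ^ 2) '' K) -
      sInf ((fun u => ‖b + lift T ι (Λ (lift T χ u))‖ ^ 2 + γ * ‖u‖ ^ 2) '' K)) / t)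
      (𝓝[>] 0) (𝓝 L) := by
  have hQ := hP.lift T
  set X := lift T χ with hX
  set A : TimeL2 T H →L[ℝ] TimeL2 T H := (lift T ι).comp (Λ.comp X) with hA
  obtain ⟨u₀, hu₀, hmin⟩ := exists_minimizer_quadratic_growth A b hγ hK hconv hne
  -- `e t u` is the difference of the states for the parameters `t` and `0`.
  let e : ℝ → TimeL2 T H → TimeL2 T H := fun t u => lift T ι (Λ (lift T (P t) (X u) - X u))
  let q : ℝ → TimeL2 T H → TimeL2 T H → ℝ := fun t u v =>
    inner ℝ (lift T (P t) u) (lift T (P t) v) - inner ℝ u v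
  set Ce := ‖lift T ι‖ * (C₁ * (C₀ * ‖X‖)) with hCe
  have hC₀ := hP.nonneg
  have hCe0 : 0 ≤ Ce := by positivity
  have he : ∀ t ∈ Ioo 0 t₀, ∀ u, ‖e t u‖ ≤ Ce * t * ‖u‖ := by
    intro t ht u
    have h1 := hb (lift T (P t) (X u) - X u) (C₀ * t * (‖X‖ * ‖u‖))
      (by have := ht.1.le; positivity) (fun ψ => by
        refine (hQ.bound_sub t ht (X u) ψ).trans ?_
        rw [mul_assoc (C₀ * t)]
        refine mul_le_mul_of_nonneg_left ?_ (mul_nonneg hC₀ ht.1.le)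
        exact mul_le_mul_of_nonneg_right (X.le_opNorm u) (norm_nonneg _))
    have h2 := ((lift T ι).le_opNorm (Λ (lift T (P t) (X u) - X u))).trans
      (mul_le_mul_of_nonneg_left h1 (norm_nonneg _))
    refine h2.trans (le_of_eq ?_)
    rw [hCe]; ring
  have hesub : ∀ t u v, e t u - e t v = e t (u - v) := by
    intro t u v
    simp only [e, map_sub]
    abel
  have hG : ∀ t u, ‖b + lift T ι (Λ (lift T (P t) (X u)))‖ ^ 2 + γ * ‖lift T (P t) u‖ ^ 2 -
      (‖b + A u‖ ^ 2 + γ * ‖u‖ ^ 2) =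
        2 * inner ℝ (e t u) (b + A u) + ‖e t u‖ ^ 2 + γ * q t u u := by
    intro t u
    have h1 : b + lift T ι (Λ (lift T (P t) (X u))) = (b + A u) + e t u := by
      simp only [e, hA, map_sub, ContinuousLinearMap.comp_apply]
      abel
    rw [h1, norm_add_sq_real]
    simp only [q]
    rw [real_inner_self_eq_norm_sq, real_inner_self_eq_norm_sq, real_inner_comm (e t u)]
    ring
  obtain ⟨p, hp⟩ := hadj (ContinuousLinearMap.adjoint (lift T ι) (b + A u₀))
  obtain ⟨l₁, hl₁⟩ := hQ.lim_sub (X u₀) p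
  obtain ⟨l₂, hl₂⟩ := hQ.lim_sq u₀
  set R := ‖u₀‖ with hR
  have hR0 : 0 ≤ R := norm_nonneg _
  set a := ‖A‖ with ha
  have ha0 : 0 ≤ a := norm_nonneg A
  set C := 2 * Ce * (‖b‖ + a * (R + 1)) + 2 * Ce * R * a + Ce ^ 2 * t₀ * (2 * R + 1) +
    γ * C₀ * (2 * R + 1) with hC
  have ht₀ := hP.pos
  refine ⟨2 * l₁ + γ * l₂, tendsto_inf_div
    (G := fun t u => ‖b + lift T ι (Λ (lift T (P t) (X u)))‖ ^ 2 + γ * ‖lift T (P t) u‖ ^ 2)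
    (G₀ := fun u => ‖b + A u‖ ^ 2 + γ * ‖u‖ ^ 2) (C := C) (t₀ := t₀)
    hu₀ hγ (by positivity) ht₀ hmin ?_ ?_⟩
  · intro t ht u _
    rw [hG, hG]
    have ht0 := ht.1.le
    set w := u - u₀ with hw
    have hu : u = u₀ + w := by rw [hw]; abel
    set r := ‖w‖ with hr
    have hr0 : 0 ≤ r := norm_nonneg _
    have huR : ‖u‖ ≤ R + r := by rw [hu]; exact norm_add_le _ _
    have hew : e t u = e t u₀ + e t w := by rw [← hesub t u u₀]; abel
    have n1 : ‖e t w‖ ≤ Ce * t * r := he t ht w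
    have n2 : ‖e t u₀‖ ≤ Ce * t * R := he t ht u₀
    have n3 : ‖A w‖ ≤ a * r := A.le_opNorm w
    have n4 : ‖A u‖ ≤ a * (R + r) :=
      (A.le_opNorm u).trans (mul_le_mul_of_nonneg_left huR ha0)
    have n5 : ‖b + A u‖ ≤ ‖b‖ + a * (R + r) := (norm_add_le _ _).trans (by linarith)
    have b1 : |inner ℝ (e t w) (b + A u)| ≤ Ce * t * r * (‖b‖ + a * (R + r)) :=
      (abs_real_inner_le_norm _ _).trans (mul_le_mul n1 n5 (norm_nonneg _) (by positivity))
    have b2 : |inner ℝ (e t u₀) (A w)| ≤ Ce * t * R * (a * r) :=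
      (abs_real_inner_le_norm _ _).trans (mul_le_mul n2 n3 (norm_nonneg _) (by positivity))
    have b3 : |inner ℝ (e t w) (e t u + e t u₀)| ≤ Ce * t * r * (Ce * t * (2 * R + r)) := by
      refine (abs_real_inner_le_norm _ _).trans (mul_le_mul n1 ?_ (norm_nonneg _) (by positivity))
      refine (norm_add_le _ _).trans ?_
      have := (he t ht u).trans (mul_le_mul_of_nonneg_left huR (by positivity))
      linarith
    have b4 : |q t w u| ≤ C₀ * t * (r * (R + r)) :=
      (hQ.bound_sq t ht w u).trans (mul_le_mul_of_nonneg_left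
        (mul_le_mul_of_nonneg_left huR hr0) (by positivity))
    have b5 : |q t u₀ w| ≤ C₀ * t * (R * r) := hQ.bound_sq t ht u₀ w
    have d1 : inner ℝ (e t u) (b + A u) - inner ℝ (e t u₀) (b + A u₀) =
        inner ℝ (e t w) (b + A u) + inner ℝ (e t u₀) (A w) := by
      rw [hew, hu, map_add, ← add_assoc b, inner_add_left, inner_add_right (e t u₀) (b + A u₀)]
      ring
    have d2 : ‖e t u‖ ^ 2 - ‖e t u₀‖ ^ 2 = inner ℝ (e t w) (e t u + e t u₀) := by
      rw [show e t w = e t u - e t u₀ by rw [hew]; abel, inner_sub_left, inner_add_right,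
        inner_add_right, real_inner_self_eq_norm_sq, real_inner_self_eq_norm_sq,
        real_inner_comm (e t u₀)]
      ring
    have d3 : q t u u - q t u₀ u₀ = q t w u + q t u₀ w := by
      simp only [q]
      rw [hu]
      simp only [map_add, inner_add_left, inner_add_right]
      ring
    have hsplit : 2 * inner ℝ (e t u) (b + A u) + ‖e t u‖ ^ 2 + γ * q t u u -
        (2 * inner ℝ (e t u₀) (b + A u₀) + ‖e t u₀‖ ^ 2 + γ * q t u₀ u₀) =
        2 * (inner ℝ (e t w) (b + A u) + inner ℝ (e t u₀) (A w)) +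
          inner ℝ (e t w) (e t u + e t u₀) + γ * (q t w u + q t u₀ w) := by
      rw [← d1, ← d2, ← d3]; ring
    have hsum : |2 * (inner ℝ (e t w) (b + A u) + inner ℝ (e t u₀) (A w)) +
        inner ℝ (e t w) (e t u + e t u₀) + γ * (q t w u + q t u₀ w)| ≤
        2 * (Ce * t * r * (‖b‖ + a * (R + r)) + Ce * t * R * (a * r)) +
          Ce * t * r * (Ce * t * (2 * R + r)) +
          γ * (C₀ * t * (r * (R + r)) + C₀ * t * (R * r)) := by
      refine (abs_add_le _ _).trans (add_le_add ((abs_add_le _ _).trans (add_le_add ?_ b3)) ?_)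
      · rw [abs_mul, abs_two]
        linarith [abs_add_le (inner ℝ (e t w) (b + A u)) (inner ℝ (e t u₀) (A w))]
      · rw [abs_mul, abs_of_pos hγ]
        exact mul_le_mul_of_nonneg_left ((abs_add_le _ _).trans (add_le_add b4 b5)) hγ.le
    rw [hsplit]
    refine hsum.trans ?_
    exact variation_bound (norm_nonneg b) ha0 hCe0 hC₀ hγ.le hR0 hr0 ht0 ht.2.le
  · simp only [hG]
    have hE : Tendsto (fun t => ‖e t u₀‖ ^ 2 / t) (𝓝[>] 0) (𝓝 0) := by
      have h1 : Tendsto (fun t : ℝ => (Ce * R) ^ 2 * t) (𝓝[>] 0) (𝓝 0) := by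
        have h : Continuous fun t : ℝ => (Ce * R) ^ 2 * t := by fun_prop
        exact (h.tendsto' 0 0 (by simp)).mono_left nhdsWithin_le_nhds
      refine squeeze_zero' ?_ ?_ h1
      · filter_upwards [self_mem_nhdsWithin] with t ht
        exact div_nonneg (sq_nonneg _) (le_of_lt ht)
      · filter_upwards [Ioo_mem_nhdsGT ht₀] with t ht
        rw [div_le_iff₀ ht.1]
        have := pow_le_pow_left₀ (norm_nonneg _) (he t ht u₀) 2
        refine this.trans (le_of_eq ?_)
        rw [← hR]; ring
    have hS : Tendsto (fun t => 2 * (inner ℝ (lift T (P t) (X u₀) - X u₀) (lift T ι p) / t) +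
        ‖e t u₀‖ ^ 2 / t + γ * (q t u₀ u₀ / t)) (𝓝[>] 0) (𝓝 (2 * l₁ + 0 + γ * l₂)) :=
      ((hl₁.const_mul 2).add hE).add (hl₂.const_mul γ)
    rw [add_zero] at hS
    refine hS.congr fun t => ?_
    have h1 : inner ℝ (e t u₀) (b + A u₀) =
        inner ℝ (lift T (P t) (X u₀) - X u₀) (lift T ι p) := by
      rw [← hp, ContinuousLinearMap.adjoint_inner_right]
    rw [h1]
    ring

end Perturbation

/-! ### Lipschitz perturbations of the identity and their Jacobians -/

section Flow

variable {d : ℕ} {Ω : Set (E d)} {X Y : E d → E d} {K : ℝ≥0} {t : ℝ}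

/-- Extension of a Lipschitz field by zero is Lipschitz, because the field vanishes on the boundary,
which every segment from inside to outside crosses. -/
theorem IsC01Zero.exists_lipschitzWith_indicator (hX : IsC01Zero Ω X) :
    ∃ K : ℝ≥0, LipschitzWith K (Ω.indicator X) := by
  obtain ⟨K, hK⟩ := hX.lipschitz
  have key : ∀ x ∈ Ω, ∀ y ∉ Ω, ‖X x‖ ≤ K * dist x y := by
    intro x hx y hy
    obtain ⟨z, hz, hzf⟩ : (segment ℝ x y ∩ frontier Ω).Nonempty := by
      have hc : IsPreconnected (segment ℝ x y) := (convex_segment x y).isPreconnected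
      by_contra hne
      have := isPreconnected_iff_subset_of_disjoint.1 hc (interior Ω) (closure Ω)ᶜ
        isOpen_interior isClosed_closure.isOpen_compl (fun w hw => by
          by_contra hn
          rw [mem_union, not_or, mem_compl_iff, not_not] at hn
          exact hne ⟨w, hw, hn.2, hn.1⟩) (by
          rw [eq_empty_iff_forall_notMem]
          rintro w ⟨-, h1, h2⟩
          exact h2 (subset_closure (interior_subset h1)))
      rcases this with h | h
      · exact hy (interior_subset (h (right_mem_segment ℝ x y)))
      · exact h (left_mem_segment ℝ x y) (subset_closure hx)
    have h1 := hK.dist_le_mul x (subset_closure hx) z (frontier_subset_closure hzf)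
    rw [hX.zero_on_boundary z hzf, dist_zero_right] at h1
    have h2 := dist_add_dist_of_mem_segment hz
    have h3 : dist x z ≤ dist x y := by linarith [dist_nonneg (x := z) (y := y)]
    exact h1.trans (mul_le_mul_of_nonneg_left h3 K.2)
  refine ⟨K, LipschitzWith.of_dist_le_mul fun x y => ?_⟩
  by_cases hx : x ∈ Ω <;> by_cases hy : y ∈ Ω
  · rw [indicator_of_mem hx, indicator_of_mem hy]
    exact hK.dist_le_mul x (subset_closure hx) y (subset_closure hy)
  · rw [indicator_of_mem hx, indicator_of_notMem hy, dist_zero_right]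
    exact key x hx y hy
  · rw [indicator_of_notMem hx, indicator_of_mem hy, dist_zero_left, dist_comm]
    exact key y hy x hx
  · rw [indicator_of_notMem hx, indicator_of_notMem hy, dist_self]
    positivity

/-- For `t K ≤ 1/2` the map `x ↦ x + t Y(x)` is a homeomorphism, as a perturbation of the identity
by a contraction. -/
theorem exists_homeomorph_perturb (hY : LipschitzWith K Y) (ht : 0 ≤ t) (htK : t * K ≤ 1 / 2) :
    ∃ Θ : E d ≃ₜ E d, ∀ x, Θ x = perturb Y t x := by
  have h1 : ApproximatesLinearOn (perturb Y t)
      ((ContinuousLinearEquiv.refl ℝ (E d) : E d ≃L[ℝ] E d) : E d →L[ℝ] E d) univ (1 / 2) := by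
    intro x _ y _
    have e : perturb Y t x - perturb Y t y -
        ((ContinuousLinearEquiv.refl ℝ (E d) : E d ≃L[ℝ] E d) : E d →L[ℝ] E d) (x - y) =
          t • (Y x - Y y) := by
      simp only [perturb, ContinuousLinearEquiv.coe_coe, ContinuousLinearEquiv.refl_apply, smul_sub]
      abel
    rw [e, norm_smul, Real.norm_eq_abs, abs_of_nonneg ht]
    have := hY.norm_sub_le x y
    calc t * ‖Y x - Y y‖ ≤ t * (K * ‖x - y‖) := mul_le_mul_of_nonneg_left this ht
      _ = (t * K) * ‖x - y‖ := by ring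
      _ ≤ _ := by
        refine mul_le_mul_of_nonneg_right (htK.trans (le_of_eq ?_)) (norm_nonneg _)
        simp
  have h2 : Subsingleton (E d) ∨ (1 / 2 : ℝ≥0) <
      ‖((ContinuousLinearEquiv.refl ℝ (E d)).symm : E d →L[ℝ] E d)‖₊⁻¹ := by
    rcases subsingleton_or_nontrivial (E d) with h | h
    · exact Or.inl h
    · right
      have : ‖((ContinuousLinearEquiv.refl ℝ (E d)).symm : E d →L[ℝ] E d)‖₊ = 1 := by
        ext
        exact ContinuousLinearMap.norm_id
      rw [this, inv_one]
      exact NNReal.half_lt_self one_ne_zero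
  exact ⟨h1.toHomeomorph _ h2, fun x => rfl⟩

theorem lipschitzWith_perturb (hY : LipschitzWith K Y) (ht : 0 ≤ t) (htK : t * K ≤ 1 / 2) :
    LipschitzWith 2 (perturb Y t) := by
  refine LipschitzWith.of_dist_le_mul fun x y => ?_
  rw [dist_eq_norm, dist_eq_norm]
  have e : perturb Y t x - perturb Y t y = (x - y) + t • (Y x - Y y) := by
    simp only [perturb, smul_sub]; abel
  rw [e]
  refine (norm_add_le _ _).trans ?_
  rw [norm_smul, Real.norm_eq_abs, abs_of_nonneg ht]
  have h1 := mul_le_mul_of_nonneg_left (hY.norm_sub_le x y) ht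
  have h2 := mul_le_mul_of_nonneg_right htK (norm_nonneg (x - y))
  have h3 := norm_nonneg (x - y)
  rw [NNReal.coe_ofNat]
  linarith

/-- A homeomorphism that is a perturbation of the identity by a field vanishing off `Ω` fixes
the complement of `Ω` and hence maps `Ω` onto itself. -/
theorem homeomorph_mem_iff (hY0 : ∀ x ∉ Ω, Y x = 0) {Θ : E d ≃ₜ E d}
    (hΘ : ∀ x, Θ x = perturb Y t x) (x : E d) : Θ x ∈ Ω ↔ x ∈ Ω := by
  have hfix : ∀ y ∉ Ω, Θ y = y := fun y hy => by rw [hΘ, perturb, hY0 y hy, smul_zero, add_zero]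
  constructor
  · intro h
    by_contra hx
    rw [hfix x hx] at h
    exact hx h
  · intro hx
    by_contra h
    have := Θ.injective (hfix _ h)
    rw [this] at h
    exact h hx

theorem homeomorph_image_eq (hY0 : ∀ x ∉ Ω, Y x = 0) {Θ : E d ≃ₜ E d}
    (hΘ : ∀ x, Θ x = perturb Y t x) : Θ '' Ω = Ω := by
  ext y
  constructor
  · rintro ⟨x, hx, rfl⟩
    exact (homeomorph_mem_iff hY0 hΘ x).2 hx
  · intro hy
    refine ⟨Θ.symm y, (homeomorph_mem_iff hY0 hΘ _).1 (by simpa using hy), by simp⟩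

/-- Lipschitz maps preserve null sets, since the volume is equivalent to the Hausdorff measure of
dimension `d`. -/
theorem volume_image_eq_zero_of_lipschitzWith {φ : E d → E d} {C : ℝ≥0} (hφ : LipschitzWith C φ)
    {s : Set (E d)} (hs : volume s = 0) : volume (φ '' s) = 0 := by
  have h1 : (volume : Measure (E d)) ≪ Measure.hausdorffMeasure (d : ℝ) :=
    Measure.absolutelyContinuous_isAddHaarMeasure _ _
  have h2 : (Measure.hausdorffMeasure (d : ℝ) : Measure (E d)) ≪ volume :=
    Measure.absolutelyContinuous_isAddHaarMeasure _ _
  refine h1 (le_antisymm ((hφ.hausdorffMeasure_image_le (Nat.cast_nonneg d) s).trans ?_) bot_le)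
  rw [h2 hs, mul_zero]

/-- The Jacobian `|det(1 + t DY)|` of `x ↦ x + t Y(x)`. -/
def jacobian (Y : E d → E d) (t : ℝ) (x : E d) : ℝ :=
  |(ContinuousLinearMap.id ℝ (E d) + t • fderiv ℝ Y x).det|

theorem jacobian_nonneg (x : E d) : 0 ≤ jacobian Y t x := abs_nonneg _

theorem contDiff_det : ContDiff ℝ 1 (fun A : E d →L[ℝ] E d => A.det) := by
  have : (fun A : E d →L[ℝ] E d => A.det) = fun A => ∑ σ : Equiv.Perm (Fin d),
      (Equiv.Perm.sign σ : ℤ) • ∏ i, (A (EuclideanSpace.single i 1)) (σ i) := by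
    funext A
    rw [ContinuousLinearMap.det, ← LinearMap.det_toMatrix (EuclideanSpace.basisFun (Fin d) ℝ).toBasis,
      Matrix.det_apply]
    refine Finset.sum_congr rfl fun σ _ => ?_
    rfl
  rw [this]
  refine ContDiff.sum fun σ _ => ?_
  refine ContDiff.const_smul _ ?_
  refine contDiff_prod fun i _ => ?_
  fun_prop

theorem exists_det_bound (d : ℕ) : ∃ δ > 0, ∃ C : ℝ, 0 ≤ C ∧ ∀ A : E d →L[ℝ] E d, ‖A‖ ≤ δ →
    |(ContinuousLinearMap.id ℝ (E d) + A).det - 1| ≤ C * ‖A‖ := by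
  obtain ⟨C, s, hs, hC⟩ := (contDiff_det (d := d)).contDiffAt.exists_lipschitzOnWith
    (x := ContinuousLinearMap.id ℝ (E d))
  obtain ⟨δ, hδ, hball⟩ := Metric.nhds_basis_closedBall.mem_iff.1 hs
  refine ⟨δ, hδ, C, C.2, fun A hA => ?_⟩
  have h := hC.dist_le_mul (ContinuousLinearMap.id ℝ (E d) + A)
    (hball (by simpa [dist_eq_norm] using hA)) (ContinuousLinearMap.id ℝ (E d)) (mem_of_mem_nhds hs)
  rw [dist_eq_norm, dist_eq_norm, add_sub_cancel_left] at h
  have h1 : (ContinuousLinearMap.id ℝ (E d)).det = 1 := LinearMap.det_id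
  rwa [h1] at h

/-- The one-sided derivative of the Jacobian at `t = 0`. The absolute value is harmless because the
determinant is close to `1`. -/
theorem exists_tendsto_det (A : E d →L[ℝ] E d) : ∃ l, Tendsto (fun t : ℝ =>
    (|(ContinuousLinearMap.id ℝ (E d) + t • A).det| - 1) / t) (𝓝[>] 0) (𝓝 l) := by
  have h0 : DifferentiableAt ℝ (fun t : ℝ => (ContinuousLinearMap.id ℝ (E d) + t • A).det) 0 := by
    have := (contDiff_det (d := d)).differentiable one_ne_zero
    exact (this _).comp (0 : ℝ) (by fun_prop)
  have h1 := h0.hasDerivAt.tendsto_slope_zero_right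
  have hz : ContinuousLinearMap.id ℝ (E d) + (0 : ℝ) • A = ContinuousLinearMap.id ℝ (E d) := by
    ext1 x
    simp
  have hid : (ContinuousLinearMap.id ℝ (E d) + (0 : ℝ) • A).det = 1 := by
    rw [hz]
    exact LinearMap.det_id
  have hpos : ∀ᶠ t : ℝ in 𝓝[>] 0, 0 < (ContinuousLinearMap.id ℝ (E d) + t • A).det := by
    refine nhdsWithin_le_nhds ?_
    refine h0.continuousAt.eventually_const_lt ?_
    change (0 : ℝ) < (ContinuousLinearMap.id ℝ (E d) + (0 : ℝ) • A).det
    rw [hid]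
    exact one_pos
  refine ⟨_, h1.congr' ?_⟩
  filter_upwards [hpos] with t ht
  rw [zero_add, hid, abs_of_pos ht, smul_eq_mul, inv_mul_eq_div]

theorem measurable_jacobian : Measurable (jacobian Y t) := by
  have h1 : Measurable fun x => ContinuousLinearMap.id ℝ (E d) + t • fderiv ℝ Y x :=
    measurable_const.add ((measurable_fderiv ℝ Y).const_smul t)
  exact (((contDiff_det (d := d)).continuous.measurable).comp h1).abs

/-- The change of variables formula for the Lipschitz homeomorphism `Θ`. By Rademacher's theorem
`Θ` is differentiable off a null set, and the image of this null set is a null set. -/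
theorem map_withDensity_jacobian (hΩ : IsOpen Ω) (hY : LipschitzWith K Y)
    (hY0 : ∀ x ∉ Ω, Y x = 0) (ht : 0 ≤ t) (htK : t * K ≤ 1 / 2) {Θ : E d ≃ₜ E d}
    (hΘ : ∀ x, Θ x = perturb Y t x) :
    Measure.map Θ ((volume.restrict Ω).withDensity fun x => ENNReal.ofReal (jacobian Y t x)) =
      volume.restrict Ω := by
  set s := Ω ∩ {x | DifferentiableAt ℝ Y x} with hs
  have hsm : MeasurableSet s := hΩ.measurableSet.inter (measurableSet_of_differentiableAt ℝ Y)
  have hnull : volume (Ω \ s) = 0 := by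
    refine measure_mono_null ?_ hY.ae_differentiableAt
    rintro x ⟨h1, h2⟩ h3
    exact h2 ⟨h1, h3⟩
  have hsΩ : s =ᵐ[volume] Ω := by
    refine Filter.EventuallyLE.antisymm (LE.le.eventuallyLE inter_subset_left) ?_
    exact ae_le_set.2 hnull
  have himg : Θ '' s =ᵐ[volume] Ω := by
    refine Filter.EventuallyLE.antisymm ?_ (ae_le_set.2 ?_)
    · refine LE.le.eventuallyLE ?_
      exact (image_mono inter_subset_left).trans (homeomorph_image_eq hY0 hΘ).subset
    · have h1 : Ω \ Θ '' s ⊆ perturb Y t '' (Ω \ s) := by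
        rw [← funext hΘ, image_sdiff Θ.injective, homeomorph_image_eq hY0 hΘ]
      exact measure_mono_null h1
        (volume_image_eq_zero_of_lipschitzWith (lipschitzWith_perturb hY ht htK) hnull)
  have h := map_withDensity_abs_det_fderiv_eq_addHaar volume (f := Θ)
    (f' := fun x => ContinuousLinearMap.id ℝ (E d) + t • fderiv ℝ Y x) hsm.nullMeasurableSet
    (fun x hx => by
      have : HasFDerivAt (perturb Y t) (ContinuousLinearMap.id ℝ (E d) + t • fderiv ℝ Y x) x :=
        (hasFDerivAt_id x).add (hx.2.hasFDerivAt.const_smul t)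
      rw [← funext hΘ] at this
      exact this.hasFDerivWithinAt) Θ.injective.injOn
  rw [Measure.restrict_congr_set hsΩ, Measure.restrict_congr_set himg] at h
  exact h

/-- The threshold `t₀` makes `x ↦ x + t Y(x)` invertible and keeps its Jacobian in `[1/2, 3/2]`. -/
theorem exists_jacobian_bound (hY : LipschitzWith K Y) : ∃ t₀ > 0, t₀ ≤ 1 ∧ ∃ C : ℝ, 0 ≤ C ∧
    ∀ t : ℝ, 0 ≤ t → t < t₀ → t * K ≤ 1 / 2 ∧
      ∀ x, |jacobian Y t x - 1| ≤ C * t ∧ |jacobian Y t x - 1| ≤ 1 / 2 := by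
  obtain ⟨δ, hδ, C, hC, h⟩ := exists_det_bound d
  have hK : (0 : ℝ) ≤ K := K.2
  set m := min (min 1 δ) (1 / (2 * (C + 1))) with hm
  have hm0 : 0 < m := lt_min (lt_min one_pos hδ) (by positivity)
  refine ⟨m / (2 * (K + 1)), by positivity, ?_, C * K, by positivity, fun t ht htt => ?_⟩
  · rw [div_le_one (by positivity)]
    have : m ≤ 1 := (min_le_left _ _).trans (min_le_left _ _)
    linarith
  · rw [lt_div_iff₀ (by positivity)] at htt
    have htK0 : 0 ≤ t * K := mul_nonneg ht hK
    have htm : t * K ≤ m / 2 := by nlinarith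
    have hm1 : m ≤ 1 := (min_le_left _ _).trans (min_le_left _ _)
    have hmδ : m ≤ δ := (min_le_left _ _).trans (min_le_right _ _)
    have hmC : m ≤ 1 / (2 * (C + 1)) := min_le_right _ _
    rw [le_div_iff₀ (by positivity)] at hmC
    refine ⟨by linarith, fun x => ?_⟩
    have hn : ‖t • fderiv ℝ Y x‖ ≤ t * K := by
      rw [norm_smul, Real.norm_eq_abs, abs_of_nonneg ht]
      exact mul_le_mul_of_nonneg_left (norm_fderiv_le_of_lipschitz ℝ hY) ht
    have h1 := h (t • fderiv ℝ Y x) (by linarith)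
    have h2 : |jacobian Y t x - 1| ≤ C * (t * K) := by
      refine le_trans ?_ (h1.trans (mul_le_mul_of_nonneg_left hn hC))
      have := abs_abs_sub_abs_le
        ((ContinuousLinearMap.id ℝ (E d) + t • fderiv ℝ Y x).det) 1
      rwa [abs_one] at this
    refine ⟨h2.trans (le_of_eq (by ring)), h2.trans ?_⟩
    nlinarith

/-- Composition with `σ` acts on `L₂` when the image measure is dominated by a multiple of `μ`. -/
theorem exists_comp_operator {α : Type*} [MeasurableSpace α] {μ : Measure α} {σ : α → α}
    (hσ : Measurable σ) {c : ENNReal} (hc : c ≠ ⊤) (h : μ.map σ ≤ c • μ) :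
    ∃ L : Lp ℝ 2 μ →L[ℝ] Lp ℝ 2 μ, ∀ v, L v =ᵐ[μ] v ∘ σ := by
  have hmp : MeasurePreserving σ μ (μ.map σ) := ⟨hσ, rfl⟩
  refine ⟨(Lp.compMeasurePreservingₗᵢ ℝ σ hmp).toContinuousLinearMap.comp
    (Lp.LpToLpOfMeasureLeSMul hc h), fun v => ?_⟩
  have h1 := Lp.coeFn_compMeasurePreserving (Lp.LpToLpOfMeasureLeSMul hc h v) hmp
  have h2 := Lp.coeFn_LpToLpOfMeasureLeSMul hc h v
  exact h1.trans (ae_eq_comp hσ.aemeasurable h2)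

/-- The homeomorphism `Θ` is `x ↦ x + t Y(x)`, its Jacobian is close to `1`, and the change of
variables formula on `Ω` holds. -/
structure IsFlow (Ω : Set (E d)) (Y : E d → E d) (t : ℝ) (Θ : E d ≃ₜ E d) : Prop where
  apply_eq : ∀ x, Θ x = perturb Y t x
  jacobian_near : ∀ x, |jacobian Y t x - 1| ≤ 1 / 2
  map_jacobian : Measure.map Θ
    ((volume.restrict Ω).withDensity fun x => ENNReal.ofReal (jacobian Y t x)) = volume.restrict Ω

theorem exists_isFlow (hΩ : IsOpen Ω) (hY : LipschitzWith K Y) (hY0 : ∀ x ∉ Ω, Y x = 0) :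
    ∃ t₀ > 0, t₀ ≤ 1 ∧ ∃ C : ℝ, 0 ≤ C ∧ ∀ t : ℝ, 0 ≤ t → t < t₀ →
      (∀ x, |jacobian Y t x - 1| ≤ C * t) ∧ ∃ Θ, IsFlow Ω Y t Θ := by
  obtain ⟨t₀, ht₀, ht₁, C, hC, h⟩ := exists_jacobian_bound hY
  refine ⟨t₀, ht₀, ht₁, C, hC, fun t ht htt => ⟨fun x => ((h t ht htt).2 x).1, ?_⟩⟩
  obtain ⟨Θ, hΘ⟩ := exists_homeomorph_perturb hY ht (h t ht htt).1
  exact ⟨Θ, hΘ, fun x => ((h t ht htt).2 x).2,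
    map_withDensity_jacobian hΩ hY hY0 ht (h t ht htt).1 hΘ⟩

namespace IsFlow

variable {Θ : E d ≃ₜ E d}

theorem map_symm_eq_withDensity_jacobian (h : IsFlow Ω Y t Θ) :
    Measure.map Θ.symm (volume.restrict Ω) =
      (volume.restrict Ω).withDensity fun x => ENNReal.ofReal (jacobian Y t x) := by
  conv_lhs => rw [← h.map_jacobian]
  rw [Measure.map_map Θ.symm.measurable Θ.measurable]
  simp

theorem map_symm_le (h : IsFlow Ω Y t Θ) :
    Measure.map Θ.symm (volume.restrict Ω) ≤ (2 : ENNReal) • volume.restrict Ω := by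
  rw [h.map_symm_eq_withDensity_jacobian, ← withDensity_const]
  refine withDensity_mono (Eventually.of_forall fun x => ?_)
  have := (abs_le.1 (h.jacobian_near x)).2
  rw [← ENNReal.ofReal_ofNat]
  exact ENNReal.ofReal_le_ofReal (by linarith)

theorem map_le (h : IsFlow Ω Y t Θ) :
    Measure.map Θ (volume.restrict Ω) ≤ (2 : ENNReal) • volume.restrict Ω := by
  conv_rhs => rw [← h.map_jacobian]
  rw [← Measure.map_smul]
  refine Measure.map_mono ?_ Θ.measurable
  rw [← withDensity_smul _ (measurable_jacobian.ennreal_ofReal)]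
  conv_lhs => rw [← withDensity_one (μ := volume.restrict Ω)]
  refine withDensity_mono (Eventually.of_forall fun x => ?_)
  have := (abs_le.1 (h.jacobian_near x)).1
  simp only [Pi.one_apply, Pi.smul_apply, smul_eq_mul]
  rw [← ENNReal.ofReal_ofNat, ← ENNReal.ofReal_mul (by norm_num), ← ENNReal.ofReal_one]
  exact ENNReal.ofReal_le_ofReal (by linarith)

theorem integral_eq_integral_jacobian (h : IsFlow Ω Y t Θ) (F : E d → ℝ) :
    ∫ x in Ω, F x = ∫ x in Ω, jacobian Y t x * F (Θ x) := by
  conv_lhs => rw [← h.map_jacobian]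
  rw [Θ.measurableEmbedding.integral_map]
  have := integral_withDensity_eq_integral_smul (μ := volume.restrict Ω)
    (f := fun x => Real.toNNReal (jacobian Y t x)) measurable_jacobian.real_toNNReal
    (fun x => F (Θ x))
  refine this.trans ?_
  congr 1 with x
  rw [NNReal.smul_def, Real.coe_toNNReal _ (jacobian_nonneg x), smul_eq_mul]

end IsFlow

end Flow

/-! ### Transport operators on `L₂(Ω)` -/

section Transport

variable {d : ℕ} {Ω : Set (E d)} {X Y : E d → E d} {K : ℝ≥0} {t : ℝ} {Θ : E d ≃ₜ E d}
  {P Q : L2 Ω →L[ℝ] L2 Ω}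

/-- The operators `P v = v ∘ Θ⁻¹` and `Q v = v ∘ Θ` on `L₂(Ω)`. -/
structure IsTransport (Ω : Set (E d)) (Θ : E d ≃ₜ E d) (P Q : L2 Ω →L[ℝ] L2 Ω) : Prop where
  push_coe : ∀ v, P v =ᵐ[volume.restrict Ω] v ∘ Θ.symm
  pull_coe : ∀ v, Q v =ᵐ[volume.restrict Ω] v ∘ Θ

theorem IsFlow.exists_isTransport (h : IsFlow Ω Y t Θ) : ∃ P Q, IsTransport Ω Θ P Q := by
  obtain ⟨P, hP⟩ := exists_comp_operator Θ.symm.measurable ENNReal.ofNat_ne_top h.map_symm_le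
  obtain ⟨Q, hQ⟩ := exists_comp_operator Θ.measurable ENNReal.ofNat_ne_top h.map_le
  exact ⟨P, Q, hP, hQ⟩

theorem IsFlow.ae_eq_comp (h : IsFlow Ω Y t Θ) {v w : E d → ℝ} (hvw : v =ᵐ[volume.restrict Ω] w) :
    v ∘ Θ =ᵐ[volume.restrict Ω] w ∘ Θ :=
  MeasureTheory.ae_eq_comp Θ.measurable.aemeasurable
    ((Measure.absolutelyContinuous_of_le_smul h.map_le).ae_eq hvw)

theorem IsFlow.ae_eq_comp_symm (h : IsFlow Ω Y t Θ) {v w : E d → ℝ}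
    (hvw : v =ᵐ[volume.restrict Ω] w) : v ∘ Θ.symm =ᵐ[volume.restrict Ω] w ∘ Θ.symm :=
  MeasureTheory.ae_eq_comp Θ.symm.measurable.aemeasurable
    ((Measure.absolutelyContinuous_of_le_smul h.map_symm_le).ae_eq hvw)

namespace IsTransport

theorem push_comp (hT : IsTransport Ω Θ P Q) (h : IsFlow Ω Y t Θ) (v : L2 Ω) :
    P v ∘ Θ =ᵐ[volume.restrict Ω] v :=
  (h.ae_eq_comp (hT.push_coe v)).trans (Eventually.of_forall fun x => by simp)

theorem push_pull (hT : IsTransport Ω Θ P Q) (h : IsFlow Ω Y t Θ) (v : L2 Ω) : P (Q v) = v := by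
  refine Lp.ext ((hT.push_coe _).trans ((h.ae_eq_comp_symm (hT.pull_coe v)).trans ?_))
  exact Eventually.of_forall fun x => by simp

theorem inner_push (hT : IsTransport Ω Θ P Q) (h : IsFlow Ω Y t Θ) (v w : L2 Ω) :
    inner ℝ (P v) w = ∫ x in Ω, jacobian Y t x * (v x * Q w x) := by
  rw [L2.inner_def, h.integral_eq_integral_jacobian]
  refine integral_congr_ae ?_
  filter_upwards [hT.push_comp h v, hT.pull_coe w] with x h1 h2
  rw [Function.comp_apply] at h1 h2
  rw [h1, h2]
  exact congrArg _ (mul_comm _ _)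

theorem inner_push_push (hT : IsTransport Ω Θ P Q) (h : IsFlow Ω Y t Θ) (v w : L2 Ω) :
    inner ℝ (P v) (P w) = ∫ x in Ω, jacobian Y t x * (v x * w x) := by
  rw [L2.inner_def, h.integral_eq_integral_jacobian]
  refine integral_congr_ae ?_
  filter_upwards [hT.push_comp h v, hT.push_comp h w] with x h1 h2
  rw [Function.comp_apply] at h1 h2
  rw [h1, h2]
  exact congrArg _ (mul_comm _ _)

end IsTransport

theorem integrable_mul_L2 (v w : L2 Ω) : Integrable (fun x => v x * w x) (volume.restrict Ω) :=
  (Lp.memLp v).integrable_mul (Lp.memLp w)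

theorem inner_eq_integral_mul (v w : L2 Ω) : inner ℝ v w = ∫ x in Ω, v x * w x := by
  rw [L2.inner_def]
  congr 1 with x
  exact mul_comm _ _

theorem abs_integral_mul_L2_le {a : E d → ℝ} {c : ℝ} (hc : 0 ≤ c) (ha : ∀ x, |a x| ≤ c)
    (v w : L2 Ω) : |∫ x in Ω, a x * (v x * w x)| ≤ c * (‖v‖ * ‖w‖) := by
  refine abs_integral_le_of_pointwise v w hc (Eventually.of_forall fun x => ?_)
  rw [abs_mul, abs_mul]
  exact mul_le_mul_of_nonneg_right (ha x) (by positivity)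

theorem integrable_jacobian_mul (h : IsFlow Ω Y t Θ) (v w : L2 Ω) :
    Integrable (fun x => jacobian Y t x * (v x * w x)) (volume.restrict Ω) := by
  refine (integrable_mul_L2 v w).bdd_mul (c := 2) measurable_jacobian.aestronglyMeasurable
    (Eventually.of_forall fun x => ?_)
  rw [Real.norm_eq_abs, abs_of_nonneg (jacobian_nonneg x)]
  linarith [(abs_le.1 (h.jacobian_near x)).2]

theorem IsTransport.norm_pull_le (hT : IsTransport Ω Θ P Q) (h : IsFlow Ω Y t Θ) (v : L2 Ω) :
    ‖Q v‖ ≤ 2 * ‖v‖ := by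
  have h1 : ‖v‖ ^ 2 = ∫ x in Ω, jacobian Y t x * (Q v x * Q v x) := by
    rw [← real_inner_self_eq_norm_sq, L2.inner_def, h.integral_eq_integral_jacobian]
    refine integral_congr_ae ?_
    filter_upwards [hT.pull_coe v] with x h2
    rw [Function.comp_apply] at h2
    rw [h2]
    rfl
  have h2 : 1 / 2 * ‖Q v‖ ^ 2 ≤ ‖v‖ ^ 2 := by
    rw [h1, ← real_inner_self_eq_norm_sq, inner_eq_integral_mul, ← integral_const_mul]
    refine integral_mono ((integrable_mul_L2 _ _).const_mul _) (integrable_jacobian_mul h _ _) ?_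
    intro x
    refine mul_le_mul_of_nonneg_right ?_ (mul_self_nonneg _)
    linarith [(abs_le.1 (h.jacobian_near x)).1]
  refine le_of_sq_le_sq ?_ (by positivity)
  rw [mul_pow]
  nlinarith [sq_nonneg ‖v‖]

/-- The mean value formula along the segment from `x` to `x + t v`, squared. -/
theorem sq_sub_le_integral {φ : E d → ℝ} (hφ : ContDiff ℝ (⊤ : ℕ∞) φ) (x v : E d) {M : ℝ}
    (ht : 0 ≤ t) (hv : ‖v‖ ≤ M) :
    (φ (x + t • v) - φ x) ^ 2 ≤
      (t * M) ^ 2 * ∫ s in Ioc (0 : ℝ) 1, ‖gradient φ (x + (s * t) • v)‖ ^ 2 := by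
  have hM : 0 ≤ M := (norm_nonneg v).trans hv
  have hdiff := hφ.differentiable (by simp)
  have hcf : Continuous (fderiv ℝ φ) := hφ.continuous_fderiv (by simp)
  have hline : Continuous fun s : ℝ => x + (s * t) • v := by fun_prop
  have hnorm : ∀ y, ‖gradient φ y‖ = ‖fderiv ℝ φ y‖ := fun y =>
    (InnerProductSpace.toDual ℝ (E d)).symm.norm_map _
  simp only [hnorm]
  set g : ℝ → ℝ := fun s => fderiv ℝ φ (x + (s * t) • v) (t • v) with hg
  have hgc : Continuous g := (hcf.comp hline).clm_apply continuous_const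
  have hd : ∀ s : ℝ, HasDerivAt (fun s : ℝ => φ (x + (s * t) • v)) (g s) s := by
    intro s
    have h1 : HasDerivAt (fun s : ℝ => x + (s * t) • v) (t • v) s := by
      have := (((hasDerivAt_id s).mul_const t).smul_const v).const_add x
      simpa using this
    exact (hdiff _).hasFDerivAt.comp_hasDerivAt s h1
  have hint : ∫ s in (0 : ℝ)..1, g s = φ (x + t • v) - φ x := by
    rw [intervalIntegral.integral_eq_sub_of_hasDerivAt (fun s _ => hd s)
      (hgc.intervalIntegrable _ _)]
    simp
  rw [← hint]
  set m := ∫ s in (0 : ℝ)..1, g s with hm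
  have hgi : ∀ {k : ℝ → ℝ}, Continuous k → IntervalIntegrable k volume 0 1 :=
    fun hk => hk.intervalIntegrable _ _
  have hcs : m ^ 2 ≤ ∫ s in (0 : ℝ)..1, g s ^ 2 := by
    have h0 : 0 ≤ ∫ s in (0 : ℝ)..1, (g s - m) ^ 2 :=
      intervalIntegral.integral_nonneg zero_le_one fun _ _ => sq_nonneg _
    have h1 : ∫ s in (0 : ℝ)..1, (g s - m) ^ 2 = (∫ s in (0 : ℝ)..1, g s ^ 2) - m ^ 2 := by
      have e : ∀ s, (g s - m) ^ 2 = g s ^ 2 - (2 * m) * g s + m ^ 2 := fun s => by ring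
      simp_rw [e]
      rw [intervalIntegral.integral_add (hgi (by fun_prop)) (hgi (by fun_prop)),
        intervalIntegral.integral_sub (hgi (by fun_prop)) (hgi (by fun_prop)),
        intervalIntegral.integral_const_mul, ← hm]
      simp
      ring
    linarith
  refine hcs.trans ?_
  rw [intervalIntegral.integral_of_le zero_le_one, ← integral_const_mul]
  have hc1 : Continuous fun s => (t * M) ^ 2 * ‖fderiv ℝ φ (x + (s * t) • v)‖ ^ 2 :=
    continuous_const.mul ((hcf.comp hline).norm.pow 2)
  refine setIntegral_mono ((hgi (hgc.pow 2)).1) ((hgi hc1).1) fun s => ?_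
  simp only
  rw [← mul_pow, ← sq_abs (g s)]
  refine pow_le_pow_left₀ (abs_nonneg _) ?_ 2
  refine ((fderiv ℝ φ (x + (s * t) • v)).le_opNorm (t • v)).trans ?_
  rw [norm_smul, Real.norm_eq_abs, abs_of_nonneg ht, mul_comm]
  exact mul_le_mul_of_nonneg_right (mul_le_mul_of_nonneg_left hv ht) (norm_nonneg _)

theorem lintegral_ofReal_norm_sq {α F : Type*} [MeasurableSpace α] {μ : Measure α}
    [NormedAddCommGroup F] [InnerProductSpace ℝ F] (w : Lp F 2 μ) :
    ∫⁻ x, ENNReal.ofReal (‖w x‖ ^ 2) ∂μ = ENNReal.ofReal (‖w‖ ^ 2) := by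
  rw [← real_inner_self_eq_norm_sq w, L2.inner_def]
  simp_rw [real_inner_self_eq_norm_sq]
  rw [ofReal_integral_eq_lintegral_ofReal ((Lp.memLp w).integrable_norm_pow two_ne_zero)
    (Eventually.of_forall fun x => by positivity)]

/-- The difference `φ ∘ Θ - φ` is bounded in `L₂(Ω)` by `t ‖∇φ‖`. The difference is the
integral of `∇φ` along the flow, whose maps at smaller parameters distort the measure by at most
the factor `2`. -/
theorem lintegral_sq_sub_le {M : ℝ} (hYc : Continuous Y) (hM : ∀ x, ‖Y x‖ ≤ M) (ht : 0 ≤ t)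
    (hflow : ∀ s, 0 ≤ s → s ≤ t → ∃ Θ, IsFlow Ω Y s Θ)
    {φ : E d → ℝ} (hφ : ContDiff ℝ (⊤ : ℕ∞) φ) :
    ∫⁻ x in Ω, ENNReal.ofReal ((φ (x + t • Y x) - φ x) ^ 2) ≤
      ENNReal.ofReal ((t * M) ^ 2) *
        (2 * ∫⁻ x in Ω, ENNReal.ofReal (‖gradient φ x‖ ^ 2)) := by
  have hgc : Continuous (gradient φ) :=
    (InnerProductSpace.toDual ℝ (E d)).symm.continuous.comp (hφ.continuous_fderiv (by simp))
  have h1 : ∀ x, ENNReal.ofReal ((φ (x + t • Y x) - φ x) ^ 2) ≤ ENNReal.ofReal ((t * M) ^ 2) *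
      ∫⁻ s in Ioc (0 : ℝ) 1, ENNReal.ofReal (‖gradient φ (x + (s * t) • Y x)‖ ^ 2) := by
    intro x
    have hc : Continuous fun s : ℝ => ‖gradient φ (x + (s * t) • Y x)‖ ^ 2 :=
      (hgc.comp (by fun_prop)).norm.pow 2
    rw [← ofReal_integral_eq_lintegral_ofReal ((hc.intervalIntegrable 0 1).1)
      (Eventually.of_forall fun s => by positivity), ← ENNReal.ofReal_mul (sq_nonneg _)]
    exact ENNReal.ofReal_le_ofReal (sq_sub_le_integral hφ x (Y x) ht (hM x))
  refine (lintegral_mono h1).trans ?_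
  rw [lintegral_const_mul' _ _ ENNReal.ofReal_ne_top]
  refine mul_le_mul_right ?_ _
  have hjc : Continuous fun p : E d × ℝ =>
      ENNReal.ofReal (‖gradient φ (p.1 + (p.2 * t) • Y p.1)‖ ^ 2) :=
    ENNReal.continuous_ofReal.comp ((hgc.comp (by fun_prop)).norm.pow 2)
  rw [lintegral_lintegral_swap hjc.measurable.aemeasurable]
  have h2 : ∀ s ∈ Ioc (0 : ℝ) 1,
      ∫⁻ x in Ω, ENNReal.ofReal (‖gradient φ (x + (s * t) • Y x)‖ ^ 2) ≤
        2 * ∫⁻ x in Ω, ENNReal.ofReal (‖gradient φ x‖ ^ 2) := by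
    intro s hs
    obtain ⟨Θ, hΘ⟩ := hflow (s * t) (mul_nonneg hs.1.le ht) (mul_le_of_le_one_left ht hs.2)
    have e : ∀ x, x + (s * t) • Y x = Θ x := fun x => (hΘ.apply_eq x).symm
    simp_rw [e]
    have hm : Measurable fun x => ENNReal.ofReal (‖gradient φ x‖ ^ 2) :=
      (ENNReal.continuous_ofReal.comp (hgc.norm.pow 2)).measurable
    rw [← lintegral_map hm Θ.measurable, ← smul_eq_mul, ← lintegral_smul_measure]
    exact lintegral_mono' hΘ.map_le le_rfl
  refine (setLIntegral_mono measurable_const h2).trans ?_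
  simp

/-- On test functions `Q` differs from the identity by `O(t)` with respect to the norm of `H¹₀(Ω)`. -/
theorem IsTransport.norm_pull_sub_le_of_test (hT : IsTransport Ω Θ P Q) (h : IsFlow Ω Y t Θ)
    {M : ℝ} (hYc : Continuous Y) (hM : ∀ x, ‖Y x‖ ≤ M) (ht : 0 ≤ t)
    (hflow : ∀ s, 0 ≤ s → s ≤ t → ∃ Θ, IsFlow Ω Y s Θ)
    {p : WithLp 2 (L2 Ω × L2Vec Ω)} (hp : p ∈ testGraph Ω) :
    ‖Q p.fst - p.fst‖ ≤ 2 * M * t * ‖p‖ := by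
  obtain ⟨φ, hφ, -, -, hp1, hp2⟩ := hp
  have hM0 : 0 ≤ M := (norm_nonneg (Y 0)).trans (hM 0)
  have h1 := lintegral_sq_sub_le hYc hM ht hflow hφ
  have e1 : ∫⁻ x in Ω, ENNReal.ofReal ((φ (x + t • Y x) - φ x) ^ 2) =
      ENNReal.ofReal (‖Q p.fst - p.fst‖ ^ 2) := by
    rw [← lintegral_ofReal_norm_sq]
    refine lintegral_congr_ae ?_
    filter_upwards [Lp.coeFn_sub (Q p.fst) p.fst, hT.pull_coe p.fst, h.ae_eq_comp hp1, hp1]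
      with x a1 a2 a3 a4
    rw [a1, Pi.sub_apply, a2, a3, a4, Function.comp_apply, h.apply_eq, Real.norm_eq_abs, sq_abs]
    rfl
  have e2 : ∫⁻ x in Ω, ENNReal.ofReal (‖gradient φ x‖ ^ 2) = ENNReal.ofReal (‖p.snd‖ ^ 2) := by
    rw [← lintegral_ofReal_norm_sq]
    refine lintegral_congr_ae ?_
    filter_upwards [hp2] with x a1
    rw [a1]
  have e3 : 2 * ENNReal.ofReal (‖p.snd‖ ^ 2) = ENNReal.ofReal (2 * ‖p.snd‖ ^ 2) := by
    rw [ENNReal.ofReal_mul zero_le_two, ENNReal.ofReal_ofNat]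
  rw [e1, e2, e3, ← ENNReal.ofReal_mul (by positivity),
    ENNReal.ofReal_le_ofReal_iff (by positivity)] at h1
  have h2 : ‖p.snd‖ ^ 2 ≤ ‖p‖ ^ 2 := by
    rw [WithLp.prod_norm_sq_eq_of_L2 p]
    linarith [sq_nonneg ‖p.fst‖]
  refine le_of_sq_le_sq ?_ (by positivity)
  have h3 := mul_le_mul_of_nonneg_left h2 (by positivity : 0 ≤ (t * M) ^ 2 * 2)
  have h4 : 0 ≤ (t * M) ^ 2 * ‖p‖ ^ 2 := by positivity
  linarith

end Transport

/-! ### Weak differentiability of the transport operators -/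

section TransportFamily

variable {d : ℕ} {Ω : Set (E d)} {X Y : E d → E d} {K : ℝ≥0} {t : ℝ} {Θ : E d ≃ₜ E d}
  {P Q : L2 Ω →L[ℝ] L2 Ω}

theorem gradient_add_apply {φ ψ : E d → ℝ} (hφ : Differentiable ℝ φ) (hψ : Differentiable ℝ ψ)
    (x : E d) : gradient (φ + ψ) x = gradient φ x + gradient ψ x := by
  simp only [gradient]
  rw [fderiv_add (hφ x) (hψ x), map_add]

theorem gradient_smul_apply {φ : E d → ℝ} (hφ : Differentiable ℝ φ) (c : ℝ)
    (x : E d) : gradient (c • φ) x = c • gradient φ x := by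
  simp only [gradient]
  rw [fderiv_const_smul (hφ x), map_smul]

/-- The graph of the gradient on test functions is already a subspace. -/
theorem span_testGraph : (Submodule.span ℝ (testGraph Ω) : Set (WithLp 2 (L2 Ω × L2Vec Ω))) =
    testGraph Ω := by
  let S : Submodule ℝ (WithLp 2 (L2 Ω × L2Vec Ω)) :=
    { carrier := testGraph Ω
      add_mem' := by
        rintro p q ⟨φ, h1, h2, h3, h4, h5⟩ ⟨ψ, k1, k2, k3, k4, k5⟩
        refine ⟨φ + ψ, h1.add k1, h2.add k2,
          (tsupport_add _ _).trans (union_subset h3 k3), ?_, ?_⟩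
        · filter_upwards [Lp.coeFn_add p.fst q.fst, h4, k4] with x a1 a2 a3
          rw [WithLp.add_fst, a1, Pi.add_apply, a2, a3, Pi.add_apply]
        · filter_upwards [Lp.coeFn_add p.snd q.snd, h5, k5] with x a1 a2 a3
          rw [WithLp.add_snd, a1, Pi.add_apply, a2, a3,
            gradient_add_apply (h1.differentiable (by simp)) (k1.differentiable (by simp))]
      zero_mem' := by
        refine ⟨0, contDiff_const, HasCompactSupport.zero, by simp, Lp.coeFn_zero _ _ _, ?_⟩
        filter_upwards [Lp.coeFn_zero (E d) 2 (volume.restrict Ω)] with x a1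
        rw [WithLp.zero_snd, a1]
        simp [gradient]
      smul_mem' := by
        rintro c p ⟨φ, h1, h2, h3, h4, h5⟩
        refine ⟨c • φ, h1.const_smul c, h2.smul_left (f := fun _ => c),
          (closure_mono (Function.support_const_smul_subset c φ)).trans h3, ?_, ?_⟩
        · filter_upwards [Lp.coeFn_smul c p.fst, h4] with x a1 a2
          rw [WithLp.smul_fst, a1, Pi.smul_apply, a2, Pi.smul_apply]
        · filter_upwards [Lp.coeFn_smul c p.snd, h5] with x a1 a2
          rw [WithLp.smul_snd, a1, Pi.smul_apply, a2,
            gradient_smul_apply (h1.differentiable (by simp))] }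
  exact congrArg _ (Submodule.span_eq S)

theorem H10.mem_closure (φ : H10 Ω) :
    (φ : WithLp 2 (L2 Ω × L2Vec Ω)) ∈ closure (testGraph Ω) := by
  have h : (φ : WithLp 2 (L2 Ω × L2Vec Ω)) ∈
      closure (Submodule.span ℝ (testGraph Ω) : Set (WithLp 2 (L2 Ω × L2Vec Ω))) := φ.2
  rwa [span_testGraph] at h

theorem H10.norm_val_le (φ : H10 Ω) : ‖H10.val φ‖ ≤ ‖φ‖ := by
  have h : ‖φ‖ ^ 2 = ‖H10.val φ‖ ^ 2 + ‖H10.grad φ‖ ^ 2 :=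
    WithLp.prod_norm_sq_eq_of_L2 (φ : WithLp 2 (L2 Ω × L2Vec Ω))
  refine le_of_sq_le_sq ?_ (norm_nonneg _)
  linarith [sq_nonneg ‖H10.grad φ‖]

/-- The bound of `IsTransport.norm_pull_sub_le_of_test` extends to `H¹₀(Ω)` by density. -/
theorem IsTransport.norm_pull_sub_le (hT : IsTransport Ω Θ P Q) (h : IsFlow Ω Y t Θ)
    {M : ℝ} (hYc : Continuous Y) (hM : ∀ x, ‖Y x‖ ≤ M) (ht : 0 ≤ t)
    (hflow : ∀ s, 0 ≤ s → s ≤ t → ∃ Θ, IsFlow Ω Y s Θ) (φ : H10 Ω) :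
    ‖Q (H10.val φ) - H10.val φ‖ ≤ 2 * M * t * ‖φ‖ := by
  have hcl : IsClosed {p : WithLp 2 (L2 Ω × L2Vec Ω) |
      ‖Q p.fst - p.fst‖ ≤ 2 * M * t * ‖p‖} := by
    have hf : Continuous fun p : WithLp 2 (L2 Ω × L2Vec Ω) => p.fst :=
      (WithLp.fstL 2 ℝ (L2 Ω) (L2Vec Ω)).continuous
    exact isClosed_le ((Q.continuous.comp hf).sub hf).norm (continuous_const.mul continuous_norm)
  exact closure_minimal (fun p hp => hT.norm_pull_sub_le_of_test h hYc hM ht hflow hp) hcl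
    (H10.mem_closure φ)

/-- The difference `P v - v` consists of a change of the volume element and a translation of the
test function; the latter needs regularity of `w` only, not of `v`. -/
theorem IsTransport.inner_push_sub (hT : IsTransport Ω Θ P Q) (h : IsFlow Ω Y t Θ) (v w : L2 Ω) :
    inner ℝ (P v - v) w =
      (∫ x in Ω, (jacobian Y t x - 1) * (v x * Q w x)) + inner ℝ v (Q w - w) := by
  have e : ∀ x, (jacobian Y t x - 1) * (v x * Q w x) =
      jacobian Y t x * (v x * Q w x) - v x * Q w x := fun x => by ring
  simp_rw [e]
  rw [integral_sub (integrable_jacobian_mul h _ _) (integrable_mul_L2 _ _), inner_sub_left,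
    inner_sub_right, hT.inner_push h, ← inner_eq_integral_mul]
  ring

theorem IsTransport.inner_push_push_sub (hT : IsTransport Ω Θ P Q) (h : IsFlow Ω Y t Θ)
    (v w : L2 Ω) : inner ℝ (P v) (P w) - inner ℝ v w =
      ∫ x in Ω, (jacobian Y t x - 1) * (v x * w x) := by
  have e : ∀ x, (jacobian Y t x - 1) * (v x * w x) =
      jacobian Y t x * (v x * w x) - v x * w x := fun x => by ring
  simp_rw [e]
  rw [integral_sub (integrable_jacobian_mul h _ _) (integrable_mul_L2 _ _),
    hT.inner_push_push h, ← inner_eq_integral_mul]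

/-- A function that is uniformly approximated by convergent functions converges. -/
theorem exists_tendsto_of_approx {g : ℝ → ℝ} {l : Filter ℝ} [l.NeBot]
    (h : ∀ ε > 0, ∃ k : ℝ → ℝ, (∃ a, Tendsto k l (𝓝 a)) ∧ ∀ᶠ t in l, |g t - k t| ≤ ε) :
    ∃ a, Tendsto g l (𝓝 a) := by
  refine cauchy_map_iff_exists_tendsto.1 (Metric.cauchy_iff.2 ⟨inferInstance, fun ε hε => ?_⟩)
  obtain ⟨k, ⟨a, ha⟩, hk⟩ := h (ε / 8) (by positivity)
  refine ⟨Metric.ball a (ε / 2), ?_, fun x hx y hy => ?_⟩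
  · rw [mem_map]
    filter_upwards [ha (Metric.ball_mem_nhds a (by positivity : 0 < ε / 8)), hk] with t h1 h2
    rw [mem_preimage, Metric.mem_ball, Real.dist_eq] at h1 ⊢
    have : g t - a = (g t - k t) + (k t - a) := by ring
    rw [this]
    linarith [abs_add_le (g t - k t) (k t - a)]
  · have := dist_triangle_right x y a
    rw [Metric.mem_ball] at hx hy
    linarith

/-- Against test functions, `(P t v - v) / t` converges by dominated convergence. -/
theorem exists_tendsto_of_test {P Q : ℝ → L2 Ω →L[ℝ] L2 Ω} {C t₀ M : ℝ} (ht₀ : 0 < t₀)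
    (ht₁ : t₀ ≤ 1) (hM : ∀ x, ‖Y x‖ ≤ M)
    (hJ : ∀ t ∈ Ioo 0 t₀, ∀ x, |jacobian Y t x - 1| ≤ C * t)
    (hP : ∀ t ∈ Ioo 0 t₀, ∃ Θ, IsFlow Ω Y t Θ ∧ IsTransport Ω Θ (P t) (Q t)) (v : L2 Ω)
    {p : WithLp 2 (L2 Ω × L2Vec Ω)} (hp : p ∈ testGraph Ω) :
    ∃ l, Tendsto (fun t => inner ℝ (P t v - v) p.fst / t) (𝓝[>] 0) (𝓝 l) := by
  obtain ⟨φ, hφ, hφc, -, hp1, -⟩ := hp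
  have hM0 : 0 ≤ M := (norm_nonneg (Y 0)).trans (hM 0)
  have hdiff := hφ.differentiable (by simp)
  obtain ⟨B, hB⟩ := hφ.continuous.bounded_above_of_compact_support hφc
  obtain ⟨L, hL⟩ : ∃ L : ℝ≥0, LipschitzWith L φ :=
    hφ.lipschitzWith_of_hasCompactSupport hφc (by simp)
  have hB0 : 0 ≤ B := (norm_nonneg _).trans (hB 0)
  have hid : ∀ x, jacobian Y 0 x = 1 := fun x => by
    have h1 : (ContinuousLinearMap.id ℝ (E d)).det = 1 := LinearMap.det_id
    have h2 : ContinuousLinearMap.id ℝ (E d) + (0 : ℝ) • fderiv ℝ Y x =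
        ContinuousLinearMap.id ℝ (E d) := by
      ext1 y
      simp
    rw [jacobian, h2, h1, abs_one]
  set S := Metric.cthickening M (tsupport φ) with hS
  have hScomp : IsCompact S := IsCompact.cthickening hφc
  -- The difference quotients vanish off `S`.
  let q : ℝ → E d → ℝ := fun t x => (jacobian Y t x * φ (x + t • Y x) - φ x) / t
  have hq_bound : ∀ t ∈ Ioo 0 t₀, ∀ x, |q t x| ≤ S.indicator (fun _ => C * B + L * M) x := by
    intro t ht x
    have hC : 0 ≤ C := by
      have := (abs_nonneg _).trans (hJ t ht 0)
      exact nonneg_of_mul_nonneg_left this ht.1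
    by_cases hx : x ∈ S
    · rw [indicator_of_mem hx, abs_div, abs_of_pos ht.1, div_le_iff₀ ht.1]
      have e : jacobian Y t x * φ (x + t • Y x) - φ x =
          (jacobian Y t x - 1) * φ (x + t • Y x) + (φ (x + t • Y x) - φ x) := by ring
      rw [e]
      refine (abs_add_le _ _).trans ?_
      have h1 : |(jacobian Y t x - 1) * φ (x + t • Y x)| ≤ C * t * B := by
        rw [abs_mul]
        exact mul_le_mul (hJ t ht x) (hB _) (abs_nonneg _) (mul_nonneg hC ht.1.le)
      have h2 : |φ (x + t • Y x) - φ x| ≤ L * (t * M) := by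
        refine (hL.norm_sub_le _ _).trans (mul_le_mul_of_nonneg_left ?_ L.2)
        rw [add_sub_cancel_left, norm_smul, Real.norm_eq_abs, abs_of_pos ht.1]
        exact mul_le_mul_of_nonneg_left (hM x) ht.1.le
      linarith
    · have h1 : φ x = 0 := image_eq_zero_of_notMem_tsupport fun h =>
        hx (Metric.self_subset_cthickening _ h)
      have h2 : φ (x + t • Y x) = 0 := image_eq_zero_of_notMem_tsupport fun h => by
        refine hx (Metric.mem_cthickening_of_dist_le x _ M _ h ?_)
        rw [dist_eq_norm, sub_add_cancel_left, norm_neg, norm_smul, Real.norm_eq_abs,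
          abs_of_pos ht.1]
        have := mul_le_mul (ht.2.le.trans ht₁) (hM x) (norm_nonneg _) zero_le_one
        linarith
      rw [indicator_of_notMem hx]
      simp [q, h1, h2]
  have hq_lim : ∀ x, ∃ l, Tendsto (fun t => q t x) (𝓝[>] 0) (𝓝 l) := by
    intro x
    obtain ⟨l, hl⟩ := exists_tendsto_det (fderiv ℝ Y x)
    have hline : HasDerivAt (fun t : ℝ => φ (x + t • Y x)) (fderiv ℝ φ x (Y x)) 0 := by
      have h1 : HasDerivAt (fun t : ℝ => x + t • Y x) (Y x) 0 := by
        simpa using ((hasDerivAt_id (0 : ℝ)).smul_const (Y x)).const_add x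
      have h2 : HasFDerivAt φ (fderiv ℝ φ x) (x + (0 : ℝ) • Y x) := by
        rw [zero_smul, add_zero]
        exact (hdiff x).hasFDerivAt
      exact h2.comp_hasDerivAt 0 h1
    have h1 := hline.tendsto_slope_zero_right
    have h2 : Tendsto (fun t : ℝ => φ (x + t • Y x)) (𝓝[>] 0) (𝓝 (φ x)) := by
      have := hline.continuousAt.tendsto.mono_left (nhdsWithin_le_nhds (s := Ioi 0))
      simpa using this
    refine ⟨_, ((hl.mul h2).add h1).congr fun t => ?_⟩
    simp only [q, jacobian, zero_add, zero_smul, add_zero, smul_eq_mul]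
    ring
  choose l hl using hq_lim
  have heq : ∀ t ∈ Ioo 0 t₀, inner ℝ (P t v - v) p.fst / t = ∫ x in Ω, v x * q t x := by
    intro t ht
    obtain ⟨Θ, hF, hT⟩ := hP t ht
    rw [inner_sub_left, hT.inner_push hF, inner_eq_integral_mul, ← integral_sub
      (integrable_jacobian_mul hF _ _) (integrable_mul_L2 _ _), ← integral_div]
    refine integral_congr_ae ?_
    filter_upwards [hT.pull_coe p.fst, hF.ae_eq_comp hp1, hp1] with x a1 a2 a3
    rw [a1, a2, a3, Function.comp_apply, hF.apply_eq, perturb]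
    simp only [q]
    ring
  refine ⟨∫ x in Ω, v x * l x, ?_⟩
  have hlim : Tendsto (fun t => ∫ x in Ω, v x * q t x) (𝓝[>] 0) (𝓝 (∫ x in Ω, v x * l x)) := by
    refine tendsto_integral_filter_of_dominated_convergence
      (fun x => ‖v x‖ * S.indicator (fun _ => C * B + L * M) x) ?_ ?_ ?_ ?_
    · filter_upwards [Ioo_mem_nhdsGT ht₀] with t ht
      obtain ⟨Θ, hF, hT⟩ := hP t ht
      have hm : Measurable (q t) := by
        have : q t = fun x => (jacobian Y t x * φ (Θ x) - φ x) / t := by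
          funext x
          rw [hF.apply_eq]
          rfl
        rw [this]
        exact ((measurable_jacobian.mul (hφ.continuous.comp Θ.continuous).measurable).sub
          hφ.continuous.measurable).div_const t
      exact (Lp.memLp v).1.mul hm.aestronglyMeasurable
    · filter_upwards [Ioo_mem_nhdsGT ht₀] with t ht
      refine Eventually.of_forall fun x => ?_
      rw [norm_mul]
      exact mul_le_mul_of_nonneg_left (hq_bound t ht x) (norm_nonneg _)
    · have hmem : MemLp (S.indicator fun _ : E d => C * B + L * M) 2 (volume.restrict Ω) :=
        (memLp_indicator_const 2 hScomp.isClosed.measurableSet _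
          (Or.inr hScomp.measure_lt_top.ne)).restrict Ω
      exact (Lp.memLp v).norm.integrable_mul hmem
    · exact Eventually.of_forall fun x => (hl x).const_mul _
  refine hlim.congr' ?_
  filter_upwards [Ioo_mem_nhdsGT ht₀] with t ht
  exact (heq t ht).symm

theorem exists_tendsto_sq {P Q : ℝ → L2 Ω →L[ℝ] L2 Ω} {C t₀ : ℝ} (ht₀ : 0 < t₀)
    (hJ : ∀ t ∈ Ioo 0 t₀, ∀ x, |jacobian Y t x - 1| ≤ C * t)
    (hP : ∀ t ∈ Ioo 0 t₀, ∃ Θ, IsFlow Ω Y t Θ ∧ IsTransport Ω Θ (P t) (Q t)) (v : L2 Ω) :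
    ∃ l, Tendsto (fun t => (inner ℝ (P t v) (P t v) - inner ℝ v v) / t) (𝓝[>] 0) (𝓝 l) := by
  choose l hl using fun x => exists_tendsto_det (fderiv ℝ Y x)
  refine ⟨∫ x in Ω, l x * (v x * v x), ?_⟩
  have hlim : Tendsto (fun t => ∫ x in Ω, (jacobian Y t x - 1) / t * (v x * v x)) (𝓝[>] 0)
      (𝓝 (∫ x in Ω, l x * (v x * v x))) := by
    refine tendsto_integral_filter_of_dominated_convergence
      (fun x => C * ‖v x * v x‖) (Eventually.of_forall fun t => ?_) ?_
      ((integrable_mul_L2 v v).norm.const_mul C)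
      (Eventually.of_forall fun x => (hl x).mul_const _)
    · exact ((measurable_jacobian.sub_const 1).div_const t).aestronglyMeasurable.mul
        (integrable_mul_L2 v v).1
    · filter_upwards [Ioo_mem_nhdsGT ht₀] with t ht
      refine Eventually.of_forall fun x => ?_
      rw [norm_mul]
      refine mul_le_mul_of_nonneg_right ?_ (norm_nonneg _)
      rw [Real.norm_eq_abs, abs_div, abs_of_pos ht.1, div_le_iff₀ ht.1]
      exact hJ t ht x
  refine hlim.congr' ?_
  filter_upwards [Ioo_mem_nhdsGT ht₀] with t ht
  obtain ⟨Θ, hF, hT⟩ := hP t ht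
  rw [hT.inner_push_push_sub hF, ← integral_div]
  congr 1 with x
  ring

/-- `P v - v` is `O(t)` in the dual of `H¹₀(Ω)`, although in general not in `L₂(Ω)`. -/
theorem IsTransport.abs_inner_push_sub_le (hT : IsTransport Ω Θ P Q) (h : IsFlow Ω Y t Θ)
    {M C : ℝ} (hYc : Continuous Y) (hM : ∀ x, ‖Y x‖ ≤ M) (ht : 0 ≤ t) (hC : 0 ≤ C)
    (hJ : ∀ x, |jacobian Y t x - 1| ≤ C * t)
    (hflow : ∀ s, 0 ≤ s → s ≤ t → ∃ Θ, IsFlow Ω Y s Θ) (v : L2 Ω) (φ : H10 Ω) :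
    |inner ℝ (P v - v) (H10.val φ)| ≤ (2 * C + 2 * M) * t * (‖v‖ * ‖φ‖) := by
  rw [hT.inner_push_sub h]
  refine (abs_add_le _ _).trans ?_
  have h1 := abs_integral_mul_L2_le (mul_nonneg hC ht) hJ v (Q (H10.val φ))
  have h2 : ‖Q (H10.val φ)‖ ≤ 2 * ‖φ‖ :=
    (hT.norm_pull_le h _).trans (mul_le_mul_of_nonneg_left (H10.norm_val_le φ) zero_le_two)
  have h3 := abs_real_inner_le_norm v (Q (H10.val φ) - H10.val φ)
  have h4 := hT.norm_pull_sub_le h hYc hM ht hflow φ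
  have h5 := mul_le_mul_of_nonneg_left h2 (mul_nonneg (mul_nonneg hC ht) (norm_nonneg v))
  have h6 := mul_le_mul_of_nonneg_left h4 (norm_nonneg v)
  linarith

theorem H10.dense_testGraph :
    Dense {ψ : H10 Ω | (ψ : WithLp 2 (L2 Ω × L2Vec Ω)) ∈ testGraph Ω} := by
  refine fun φ => Metric.mem_closure_iff.2 fun ε hε => ?_
  obtain ⟨p, hp, hpd⟩ := Metric.mem_closure_iff.1 (H10.mem_closure φ) ε hε
  have hpH : p ∈ H10 Ω := (Submodule.le_topologicalClosure _) (Submodule.subset_span hp)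
  exact ⟨⟨p, hpH⟩, hp, hpd⟩

/-- Uniformly bounded difference quotients that converge on a dense set converge everywhere. -/
theorem exists_tendsto_of_dense {V H : Type*} [NormedAddCommGroup V] [InnerProductSpace ℝ V]
    [NormedAddCommGroup H] [InnerProductSpace ℝ H] {ι : V →L[ℝ] H} {S : Set V} (hS : Dense S)
    {g : ℝ → H} {R t₀ : ℝ} (hR : 0 ≤ R) (ht₀ : 0 < t₀)
    (hb : ∀ t ∈ Ioo 0 t₀, ∀ φ : V, |inner ℝ (g t) (ι φ)| ≤ R * t * ‖φ‖)
    (hg : ∀ p ∈ S, ∃ l, Tendsto (fun t => inner ℝ (g t) (ι p) / t) (𝓝[>] 0) (𝓝 l))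
    (φ : V) : ∃ l, Tendsto (fun t => inner ℝ (g t) (ι φ) / t) (𝓝[>] 0) (𝓝 l) := by
  refine exists_tendsto_of_approx fun ε hε => ?_
  obtain ⟨ψ, hψ, hd⟩ := Metric.mem_closure_iff.1 (hS φ) (ε / (R + 1)) (by positivity)
  refine ⟨fun t => inner ℝ (g t) (ι ψ) / t, hg ψ hψ, ?_⟩
  filter_upwards [Ioo_mem_nhdsGT ht₀] with t ht
  have h3 : inner ℝ (g t) (ι φ) / t - inner ℝ (g t) (ι ψ) / t =
      inner ℝ (g t) (ι (φ - ψ)) / t := by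
    rw [map_sub, inner_sub_right, sub_div]
  rw [h3, abs_div, abs_of_pos ht.1, div_le_iff₀ ht.1]
  have h4 : R * (ε / (R + 1)) ≤ ε := by
    rw [mul_div_assoc', div_le_iff₀ (by positivity)]
    linarith
  rw [dist_eq_norm] at hd
  calc |inner ℝ (g t) (ι (φ - ψ))| ≤ R * t * ‖φ - ψ‖ := hb t ht _
    _ ≤ R * t * (ε / (R + 1)) := mul_le_mul_of_nonneg_left hd.le (mul_nonneg hR ht.1.le)
    _ = R * (ε / (R + 1)) * t := by ring
    _ ≤ ε * t := mul_le_mul_of_nonneg_right h4 ht.1.le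

/-- Transport of functions by `T_t` is a transport family. The field is extended from `Ω` by zero,
which does not change `T_t` on `Ω`. -/
theorem exists_isTransportFamily (hΩ : IsOpen Ω) (hX : IsC01Zero Ω X) :
    ∃ (P Q : ℝ → L2 Ω →L[ℝ] L2 Ω) (C t₀ : ℝ), IsTransportFamily H10.val P C t₀ ∧
      ∀ t ∈ Ioo 0 t₀, ∃ Θ, IsFlow Ω (Ω.indicator X) t Θ ∧ IsTransport Ω Θ (P t) (Q t) := by
  obtain ⟨K, hY⟩ := hX.exists_lipschitzWith_indicator
  obtain ⟨M, hM⟩ : ∃ M, ∀ x, ‖Ω.indicator X x‖ ≤ M := by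
    obtain ⟨M, hM⟩ := hX.bounded
    refine ⟨max M 0, fun x => ?_⟩
    by_cases hx : x ∈ Ω
    · rw [indicator_of_mem hx]
      exact (hM x (subset_closure hx)).trans (le_max_left _ _)
    · rw [indicator_of_notMem hx, norm_zero]
      exact le_max_right _ _
  have hM0 : 0 ≤ M := (norm_nonneg _).trans (hM 0)
  obtain ⟨t₀, ht₀, ht₁, C, hC, hflow⟩ :=
    exists_isFlow hΩ hY (fun x hx => indicator_of_notMem hx X)
  have hex : ∀ t, ∃ P Q : L2 Ω →L[ℝ] L2 Ω, t ∈ Ioo 0 t₀ →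
      ∃ Θ, IsFlow Ω (Ω.indicator X) t Θ ∧ IsTransport Ω Θ P Q := by
    intro t
    by_cases ht : t ∈ Ioo 0 t₀
    · obtain ⟨-, Θ, hΘ⟩ := hflow t ht.1.le ht.2
      obtain ⟨P, Q, hPQ⟩ := hΘ.exists_isTransport
      exact ⟨P, Q, fun _ => ⟨Θ, hΘ, hPQ⟩⟩
    · exact ⟨0, 0, fun h => absurd h ht⟩
  choose P Q hPQ using hex
  have hJ : ∀ t ∈ Ioo 0 t₀, ∀ x, |jacobian (Ω.indicator X) t x - 1| ≤ C * t :=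
    fun t ht => (hflow t ht.1.le ht.2).1
  have hbound : ∀ t ∈ Ioo 0 t₀, ∀ v (φ : H10 Ω), |inner ℝ (P t v - v) (H10.val φ)| ≤
      (2 * C + 2 * M) * t * (‖v‖ * ‖φ‖) := by
    intro t ht v φ
    obtain ⟨Θ, hF, hT⟩ := hPQ t ht
    exact hT.abs_inner_push_sub_le hF hY.continuous hM ht.1.le hC (hJ t ht)
      (fun s hs hst => (hflow s hs (hst.trans_lt ht.2)).2) v φ
  refine ⟨P, Q, 2 * C + 2 * M, t₀, ⟨by positivity, ht₀, hbound, fun v φ => ?_,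
    fun t ht v w => ?_, fun v => exists_tendsto_sq ht₀ hJ hPQ v⟩, hPQ⟩
  · refine exists_tendsto_of_dense H10.dense_testGraph (R := (2 * C + 2 * M) * ‖v‖) (by positivity)
      ht₀ (fun t ht ψ => (hbound t ht v ψ).trans (le_of_eq (by ring)))
      (fun p hp => exists_tendsto_of_test ht₀ ht₁ hM hJ hPQ v hp) φ
  · obtain ⟨Θ, hF, hT⟩ := hPQ t ht
    rw [hT.inner_push_push_sub hF]
    refine (abs_integral_mul_L2_le (mul_nonneg hC ht.1.le) (hJ t ht) v w).trans ?_
    refine mul_le_mul_of_nonneg_right ?_ (by positivity)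
    exact mul_le_mul_of_nonneg_right (by linarith) ht.1.le

end TransportFamily

/-! ### The control-to-state map in abstract form -/

section Abstract

variable {V H W : Type*} [NormedAddCommGroup V] [InnerProductSpace ℝ V] [CompleteSpace V]
  [NormedAddCommGroup H] [InnerProductSpace ℝ H] [CompleteSpace H]
  [NormedAddCommGroup W] [InnerProductSpace ℝ W] [CompleteSpace W]
  {ι : V →L[ℝ] H} {D : V →L[ℝ] W} {T : ℝ}

/-- Weak solutions exist, and they are affine in the right-hand side. -/
theorem exists_state_formula (hV : IsGraphInner ι D) (hT : 0 < T)
    {Λ : TimeL2 T H →L[ℝ] TimeL2 T V} (hΛ : ∀ g, ∃ z, IsStrongSol ι D T 0 g z (Λ g)) (f : V) :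
    ∃ b : TimeL2 T H, ∀ g : TimeL2 T H, (∃ y, IsWeakSol ι D T g f y) ∧
      ∀ y, IsWeakSol ι D T g f y →
        (fun t => ι (y t)) =ᵐ[timeMeasure T] (b + lift T ι (Λ g) : TimeL2 T H) := by
  obtain ⟨z₀, y₀, h₀⟩ := exists_isStrongSol (T := T) hV hT.le f 0
  refine ⟨constTime T (ι f) + lift T ι y₀, fun g => ?_⟩
  obtain ⟨z, hz⟩ := hΛ g
  have h1 := h₀.add hz
  rw [add_zero, zero_add] at h1
  have h2 := h1.isWeakSol hT
  refine ⟨⟨_, h2⟩, fun y hy => ?_⟩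
  filter_upwards [hy.val_ae_eq hT h2, Lp.coeFn_add y₀ (Λ g), lift_coe ι y₀, lift_coe ι (Λ g),
    constTime_coe (T := T) (ι f), Lp.coeFn_add (constTime T (ι f) + lift T ι y₀) (lift T ι (Λ g)),
    Lp.coeFn_add (constTime T (ι f)) (lift T ι y₀)] with t a1 a2 a3 a4 a5 a6 a7
  rw [a1, a6, Pi.add_apply, a7, Pi.add_apply, a3, a4, a5, a2, Pi.add_apply, map_add, map_add,
    add_assoc]

theorem lift_id (p : TimeL2 T H) : lift T (ContinuousLinearMap.id ℝ H) p = p :=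
  Lp.ext (lift_coe _ _)

/-- The infimum over `u ∈ K` of the cost of the control `P u` that acts through `P χ P⁻¹`, where
`g ↦ b + A g` maps a right-hand side to the state. -/
def pulledBackValue (A : TimeL2 T H →L[ℝ] TimeL2 T H) (b : TimeL2 T H) (γ : ℝ)
    (K : Set (TimeL2 T H)) (χ P : H →L[ℝ] H) : ℝ :=
  sInf ((fun u => ‖b + A (lift T P (lift T χ u))‖ ^ 2 + γ * ‖lift T P u‖ ^ 2) '' K)

/-- The control-to-state map `g ↦ b + A g`, together with the derivative of the optimal value
along a transport family. -/
theorem exists_state_formula_and_deriv (hV : IsGraphInner ι D) (hT : 0 < T) (f : V)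
    {P : ℝ → H →L[ℝ] H} {C₀ t₀ : ℝ} (hP : IsTransportFamily ι P C₀ t₀) (χ : H →L[ℝ] H)
    {γ : ℝ} (hγ : 0 < γ) {K : Set (TimeL2 T H)} (hK : IsClosed K) (hconv : Convex ℝ K)
    (hne : K.Nonempty) :
    ∃ (A : TimeL2 T H →L[ℝ] TimeL2 T H) (b : TimeL2 T H) (L : ℝ),
      (∀ g : TimeL2 T H, (∃ y, IsWeakSol ι D T g f y) ∧
        ∀ y, IsWeakSol ι D T g f y →
          (fun t => ι (y t)) =ᵐ[timeMeasure T] (b + A g : TimeL2 T H)) ∧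
      Tendsto (fun t => (pulledBackValue A b γ K χ (P t) -
        pulledBackValue A b γ K χ (ContinuousLinearMap.id ℝ H)) / t) (𝓝[>] 0) (𝓝 L) := by
  obtain ⟨Λ, C₁, hC₁, hΛ, hb, hadj⟩ := exists_bounded_solution_operator (T := T) hV hT.le
  obtain ⟨b, hbs⟩ := exists_state_formula hV hT hΛ f
  obtain ⟨L, hL⟩ := exists_tendsto_optimal_value hP χ hC₁ hb hadj b hγ hK hconv hne
  refine ⟨(lift T ι).comp Λ, b, L, hbs, ?_⟩
  simp only [pulledBackValue, lift_id]
  exact hL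

theorem integral_norm_sq_add {b u : TimeL2 T H} {γ : ℝ} {y v : ℝ → H}
    (hy : y =ᵐ[timeMeasure T] b) (hv : v =ᵐ[timeMeasure T] u) :
    ∫ t, (‖y t‖ ^ 2 + γ * ‖v t‖ ^ 2) ∂(timeMeasure T) = ‖b‖ ^ 2 + γ * ‖u‖ ^ 2 := by
  have hn : ∀ p : TimeL2 T H, ‖p‖ ^ 2 = ∫ t, ‖p t‖ ^ 2 ∂(timeMeasure T) := fun p => by
    rw [← real_inner_self_eq_norm_sq, L2.inner_def]
    simp_rw [real_inner_self_eq_norm_sq]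
  rw [hn, hn, ← integral_const_mul, ← integral_add
    ((Lp.memLp b).integrable_norm_pow two_ne_zero)
    (((Lp.memLp u).integrable_norm_pow two_ne_zero).const_mul γ)]
  refine integral_congr_ae ?_
  filter_upwards [hy, hv] with t a1 a2
  rw [a1, a2]

/-- The set of controls in `L₂(0,T;U)`, as classes modulo null sets. -/
def controlSet (T : ℝ) (U : Set H) : Set (TimeL2 T H) := {u | ∀ᵐ t ∂(timeMeasure T), u t ∈ U}

theorem convex_controlSet {U : Set H} (hU : Convex ℝ U) : Convex ℝ (controlSet T U) := by
  intro u hu v hv a b ha hb hab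
  filter_upwards [hu, hv, Lp.coeFn_add (a • u) (b • v), Lp.coeFn_smul a u, Lp.coeFn_smul b v]
    with t h1 h2 h3 h4 h5
  rw [h3, Pi.add_apply, h4, h5]
  exact hU h1 h2 ha hb hab

theorem zero_mem_controlSet {U : Set H} (hU : (0 : H) ∈ U) : (0 : TimeL2 T H) ∈ controlSet T U := by
  filter_upwards [Lp.coeFn_zero H 2 (timeMeasure T)] with t h
  rw [h]
  exact hU

theorem isClosed_controlSet {U : Set H} (hU : IsClosed U) : IsClosed (controlSet T U) := by
  refine IsSeqClosed.isClosed fun u v hu huv => ?_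
  obtain ⟨ns, -, hns⟩ := (tendstoInMeasure_of_tendsto_Lp huv).exists_seq_tendsto_ae
  filter_upwards [hns, ae_all_iff.2 hu] with t h1 h2
  exact hU.mem_of_tendsto h1 (Eventually.of_forall fun n => h2 (ns n))

theorem deriv_identity_neg {y : ℝ → V} {y' : ℝ → StrongDual ℝ V} {a b : ℝ → ℝ} {φ : V}
    {m : Measure ℝ}
    (h : ∫ t, a t * inner ℝ (ι (y t)) (ι φ) ∂m = -∫ t, b t * y' t φ ∂m) :
    ∫ t, a t * inner ℝ (ι (-y t)) (ι φ) ∂m = -∫ t, b t * (-y' t) φ ∂m := by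
  simp only [map_neg, inner_neg_left, mul_neg, neg_apply, integral_neg, h]

theorem equation_neg {v φ : V} {l : StrongDual ℝ V} {r : ℝ}
    (h : l φ + inner ℝ (D v) (D φ) = r) : (-l) φ + inner ℝ (D (-v)) (D φ) = -r := by
  rw [neg_apply, map_neg, inner_neg_left, ← neg_add, h]

/-- A relation between `P χ x` and `P x` is inherited by the operators on functions of time. -/
theorem lift_lift_rel {P χ : H →L[ℝ] H} {R : H → H → Prop} (hR : ∀ x, R (P (χ x)) (P x))
    (u : TimeL2 T H) {v : ℝ → H} (hv : v =ᵐ[timeMeasure T] lift T P u) :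
    ∀ᵐ t ∂(timeMeasure T), R (lift T P (lift T χ u) t) (v t) := by
  filter_upwards [hv, lift_coe P u, lift_coe P (lift T χ u), lift_coe χ u] with t a1 a2 a3 a4
  rw [a1, a3, a4, a2]
  exact hR (u t)

theorem lift_mem_controlSet {P : H →L[ℝ] H} {U : Set H} (hP : ∀ v ∈ U, P v ∈ U)
    {u : TimeL2 T H} (hu : u ∈ controlSet T U) : lift T P u ∈ controlSet T U := by
  filter_upwards [hu, lift_coe P u] with t a1 a2
  rw [a2]
  exact hP _ a1

/-- Every control is the transport of a control. -/
theorem exists_ae_eq_lift {P Q : H →L[ℝ] H} {U : Set H} (hPQ : ∀ v, P (Q v) = v)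
    (hQ : ∀ v ∈ U, Q v ∈ U) {v : ℝ → H} (hv : MemL2Time T v)
    (hvU : ∀ᵐ t ∂(timeMeasure T), v t ∈ U) :
    ∃ u ∈ controlSet T U, v =ᵐ[timeMeasure T] lift T P u := by
  refine ⟨lift T Q (MemLp.toLp v hv), lift_mem_controlSet hQ ?_, ?_⟩
  · filter_upwards [hv.coeFn_toLp, hvU] with t a1 a2
    rwa [a1]
  · filter_upwards [hv.coeFn_toLp, lift_coe P (lift T Q (MemLp.toLp v hv)),
      lift_coe Q (MemLp.toLp v hv)] with t a1 a2 a3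
    rw [a2, a3, hPQ, a1]

end Abstract

/-! ### The optimal value in terms of pulled-back controls, and its symmetry -/

section Optimal

variable {d : ℕ} {Ω ω : Set (E d)} {T γ : ℝ} {U : Set (L2 Ω)} {f : H10 Ω}

/-- Multiplication by the characteristic function of a null measurable set is a bounded operator
on `L₂(Ω)`. -/
theorem exists_cutoff (hω : NullMeasurableSet ω volume) :
    ∃ χ : L2 Ω →L[ℝ] L2 Ω, ∀ v : L2 Ω, χ v =ᵐ[volume.restrict Ω] ω.indicator v := by
  obtain ⟨ω', hm, hae⟩ := hω.exists_measurable_superset_ae_eq.imp fun _ h => h.2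
  let L : L2 Ω →ₗ[ℝ] L2 Ω :=
    { toFun := fun v => ((Lp.memLp v).indicator hm).toLp _
      map_add' := fun v w => by
        rw [← MemLp.toLp_add]
        refine MemLp.toLp_congr _ _ ?_
        filter_upwards [Lp.coeFn_add v w] with x h
        rw [Pi.add_apply] at h ⊢
        by_cases hx : x ∈ ω'
        · simp only [indicator_of_mem hx, h]
        · simp only [indicator_of_notMem hx, add_zero]
      map_smul' := fun c v => by
        rw [RingHom.id_apply, ← MemLp.toLp_const_smul]
        refine MemLp.toLp_congr _ _ ?_
        filter_upwards [Lp.coeFn_smul c v] with x h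
        rw [Pi.smul_apply, ← indicator_const_smul_apply]
        simp only [indicator, h]
        rfl }
  refine ⟨L.mkContinuous 1 fun v => ?_, fun v => ?_⟩
  · rw [one_mul]
    change ‖((Lp.memLp v).indicator hm).toLp _‖ ≤ ‖v‖
    rw [Lp.norm_toLp, Lp.norm_def]
    exact ENNReal.toReal_mono (Lp.memLp v).2.ne (eLpNorm_indicator_le _)
  · refine ((Lp.memLp v).indicator hm).coeFn_toLp.trans ?_
    exact ae_restrict_of_ae (indicator_ae_eq_of_ae_eq_set hae)

set_option maxHeartbeats 1000000 in
/-- The optimal value in terms of the control-to-state map and of the pulled-back controls `u`, with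
`v = P u`. In the application `ω'` is the image of `ω` under a transformation whose action on
functions is `P`, and `χ` is multiplication by `χ_ω`. -/
theorem J1_eq_pulledBackValue {ω' : Set (E d)} {P Q χ : L2 Ω →L[ℝ] L2 Ω}
    (hχ : ∀ v, P (χ v) =ᵐ[volume.restrict Ω] ω'.indicator (P v))
    (hPQ : ∀ v, P (Q v) = v) (hP : ∀ v ∈ U, P v ∈ U) (hQ : ∀ v ∈ U, Q v ∈ U)
    {A : TimeL2 T (L2 Ω) →L[ℝ] TimeL2 T (L2 Ω)} {b : TimeL2 T (L2 Ω)}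
    (hb : ∀ g : TimeL2 T (L2 Ω), (∃ y, IsWeakSol H10.val H10.grad T g f y) ∧
      ∀ y, IsWeakSol H10.val H10.grad T g f y →
        (fun t => H10.val (y t)) =ᵐ[timeMeasure T]
          (b + A g : TimeL2 T (L2 Ω))) :
    J1 Ω T γ U ω' f = pulledBackValue A b γ (controlSet T U) χ P := by
  have hind : ∀ (u : TimeL2 T (L2 Ω)) (v : ℝ → L2 Ω), v =ᵐ[timeMeasure T] lift T P u →
      ∀ᵐ t ∂(timeMeasure T),
        lift T P (lift T χ u) t =ᵐ[volume.restrict Ω] ω'.indicator (v t) :=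
    fun u v hv => lift_lift_rel
      (R := fun x y : L2 Ω => x =ᵐ[volume.restrict Ω] ω'.indicator y) hχ u hv
  have hcost : ∀ (u : TimeL2 T (L2 Ω)) (v : ℝ → L2 Ω), v =ᵐ[timeMeasure T] lift T P u →
      ∀ y, IsState Ω T ω' v f y → cost Ω T γ v y =
        ‖b + A (lift T P (lift T χ u))‖ ^ 2 + γ * ‖lift T P u‖ ^ 2 :=
    fun u v hv y hy => by
      have h : (fun t => H10.val (y t)) =ᵐ[timeMeasure T]
          (b + A (lift T P (lift T χ u)) : TimeL2 T (L2 Ω)) :=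
        (hb (lift T P (lift T χ u))).2 y ((isState_iff_isWeakSol (hind u v hv)).1 hy)
      exact integral_norm_sq_add (y := fun t => H10.val (y t)) h hv
  unfold J1 pulledBackValue
  congr 1
  ext c
  constructor
  · rintro ⟨v, ⟨hv, hvU⟩, y, hy, rfl⟩
    obtain ⟨u, hu, hvu⟩ := exists_ae_eq_lift hPQ hQ hv hvU
    exact ⟨u, hu, (hcost u v hvu y hy).symm⟩
  · rintro ⟨u, hu, rfl⟩
    have hself : ((lift T P u : TimeL2 T (L2 Ω)) : ℝ → L2 Ω) =ᵐ[timeMeasure T] lift T P u :=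
      EventuallyEq.rfl
    obtain ⟨y, hy⟩ := (hb (lift T P (lift T χ u))).1
    have hy' := (isState_iff_isWeakSol (hind u _ hself)).2 hy
    exact ⟨lift T P u, ⟨Lp.memLp _, lift_mem_controlSet hP hu⟩, y, hy',
      (hcost u _ hself y hy').symm⟩

theorem IsState.neg {u : ℝ → L2 Ω} {y : ℝ → H10 Ω} (h : IsState Ω T ω u f y) :
    IsState Ω T ω (fun t => -u t) (-f) (fun t => -y t) := by
  obtain ⟨h1, ⟨y', h2, h3, h4⟩, Y, h5, h6, h7⟩ := h
  refine ⟨MemLp.neg h1, ⟨fun t => -y' t, MemLp.neg h2,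
    fun η a b c φ => deriv_identity_neg (h3 η a b c φ), fun φ => ?_⟩, fun t => -Y t, h5.neg, ?_, ?_⟩
  · filter_upwards [h4 φ] with t ht
    refine (equation_neg ht).trans ?_
    rw [← integral_neg]
    refine integral_congr_ae ?_
    filter_upwards [Lp.coeFn_neg (u t)] with x hx
    by_cases hxω : x ∈ ω
    · simp only [indicator_of_mem hxω, hx, Pi.neg_apply, neg_mul]
    · simp only [indicator_of_notMem hxω, zero_mul, neg_zero]
  · filter_upwards [h6] with t ht
    exact (congrArg Neg.neg ht).trans (map_neg H10.val (y t)).symm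
  · exact (congrArg Neg.neg h7).trans (map_neg H10.val f).symm

/-- The optimal value is even in the initial value, since `𝒰` is symmetric. -/
theorem J1_neg (hU : ∀ v ∈ U, -v ∈ U) (ω : Set (E d)) (f : H10 Ω) :
    J1 Ω T γ U ω (-f) = J1 Ω T γ U ω f := by
  have key : ∀ f : H10 Ω, {c | ∃ u ∈ controls Ω T U, ∃ y, IsState Ω T ω u (-f) y ∧
      c = cost Ω T γ u y} ⊆ {c | ∃ u ∈ controls Ω T U, ∃ y, IsState Ω T ω u f y ∧
      c = cost Ω T γ u y} := by
    rintro f _ ⟨u, ⟨hu, huU⟩, y, hy, rfl⟩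
    have h := hy.neg
    rw [neg_neg] at h
    refine ⟨fun t => -u t, ⟨MemLp.neg hu, huU.mono fun t ht => hU _ ht⟩, _, h, ?_⟩
    simp only [cost, map_neg, norm_neg]
  unfold J1
  congr 1
  refine Subset.antisymm (key f) ?_
  have := key (-f)
  rwa [neg_neg] at this

end Optimal

/-! ### The shape derivative -/

section ShapeDerivative

variable {d : ℕ} {Ω ω : Set (E d)} {T γ t : ℝ} {U : Set (L2 Ω)} {X : E d → E d} {Θ : E d ≃ₜ E d}
  {P Q : L2 Ω →L[ℝ] L2 Ω}

/-- Either `τ_X` is positive or the field vanishes on `Ω`: for a field of norm `0`, the quotient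
`τ_X` is `1 / 0 = 0`. -/
theorem tau_pos_or_eq_zero (hX : IsC01Zero Ω X) : 0 < tau Ω X ∨ ∀ x ∈ Ω, X x = 0 := by
  have h1 : 0 ≤ sInf {K : ℝ | 0 ≤ K ∧ ∀ x ∈ closure Ω, ∀ y ∈ closure Ω,
      ‖X x - X y‖ ≤ K * ‖x - y‖} := Real.sInf_nonneg fun _ h => h.1
  have h2 : BddAbove ((fun x => ‖X x‖) '' closure Ω) := by
    obtain ⟨M, hM⟩ := hX.bounded
    refine ⟨M, ?_⟩
    rintro _ ⟨x, hx, rfl⟩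
    exact hM x hx
  rcases lt_or_ge 0 (c01Norm Ω X) with h | h
  · left
    unfold tau
    positivity
  · right
    intro x hx
    have h3 : ‖X x‖ ≤ sSup ((fun x => ‖X x‖) '' closure Ω) :=
      le_csSup h2 (mem_image_of_mem _ (subset_closure hx))
    unfold c01Norm at h
    exact norm_le_zero_iff.1 (by linarith)

theorem IsFlow.perturb_eq (h : IsFlow Ω (Ω.indicator X) t Θ) {x : E d} (hx : x ∈ Ω) :
    perturb X t x = Θ x := by
  rw [h.apply_eq, perturb, perturb, indicator_of_mem hx]

/-- Transport maps `χ_ω v` to `χ_{T_t(ω)} P v`. -/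
theorem IsTransport.push_cutoff (hT : IsTransport Ω Θ P Q) (h : IsFlow Ω (Ω.indicator X) t Θ)
    (hωΩ : ω ⊆ Ω) {v w : L2 Ω} (hw : w =ᵐ[volume.restrict Ω] ω.indicator v) :
    P w =ᵐ[volume.restrict Ω] (perturb X t '' ω).indicator (P v) := by
  have himg : perturb X t '' ω = Θ '' ω := image_congr fun x hx => h.perturb_eq (hωΩ hx)
  rw [himg]
  filter_upwards [hT.push_coe w, h.ae_eq_comp_symm hw, hT.push_coe v] with x a1 a2 a3
  rw [a1, a2, Function.comp_apply]
  by_cases hx : Θ.symm x ∈ ω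
  · have hmem : x ∈ Θ '' ω := ⟨_, hx, Θ.apply_symm_apply x⟩
    rw [indicator_of_mem hx, indicator_of_mem hmem, a3, Function.comp_apply]
  · rw [indicator_of_notMem hx, indicator_of_notMem]
    rintro ⟨z, hz, rfl⟩
    exact hx (by simpa using hz)

/-- Invariance under composition with `T_t` is applied to `P v`, whose composition with `T_t` is
`v`, and to `v`, whose composition with `T_t` is `Q v`. -/
theorem IsTransport.mem_of_invariant (hT : IsTransport Ω Θ P Q) (hΩ : IsOpen Ω)
    (h : IsFlow Ω (Ω.indicator X) t Θ) (hX : IsC01Zero Ω X)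
    (hU : InvariantUnderPerturbations Ω U) (ht : t ∈ Icc 0 (tau Ω X)) {v : L2 Ω} (hv : v ∈ U) :
    P v ∈ U ∧ Q v ∈ U := by
  have hae : ∀ᵐ x ∂(volume.restrict Ω), perturb X t x = Θ x := by
    filter_upwards [ae_restrict_mem hΩ.measurableSet] with x hx
    exact h.perturb_eq hx
  constructor
  · refine (hU X hX t ht (P v) v ?_).2 hv
    filter_upwards [hT.push_comp h v, hae] with x a1 a2
    rw [a2, ← a1]
    rfl
  · refine (hU X hX t ht v (Q v) ?_).1 hv
    filter_upwards [hT.pull_coe v, hae] with x a1 a2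
    rw [a1, a2]
    rfl

/-- The shape function `𝒥₁(·, f)` has a directional derivative: near `t = 0` its values are those
of `pulledBackValue` along the transport family of `X`. -/
theorem exists_hasShapeDeriv (hΩ : IsOpen Ω) (hT : 0 < T) (hγ : 0 < γ)
    (hUclosed : IsClosed U) (hUconvex : Convex ℝ U) (hUzero : (0 : L2 Ω) ∈ U)
    (hUinv : InvariantUnderPerturbations Ω U) (hω : NullMeasurableSet ω volume) (hωΩ : ω ⊆ Ω)
    (f : H10 Ω) (hX : IsC01Zero Ω X) :
    ∃ L : ℝ, HasShapeDeriv (fun ω' => J1 Ω T γ U ω' f) ω X L := by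
  rcases tau_pos_or_eq_zero hX with hτ | hX0
  · obtain ⟨χ, hχ⟩ := exists_cutoff (Ω := Ω) hω
    obtain ⟨P, Q, C, t₀, hP, hPQ⟩ := exists_isTransportFamily hΩ hX
    obtain ⟨A, b, L, hbs, hL⟩ := exists_state_formula_and_deriv H10.isGraphInner hT f hP χ hγ
      (isClosed_controlSet (T := T) hUclosed) (convex_controlSet hUconvex)
      ⟨0, zero_mem_controlSet hUzero⟩
    refine ⟨L, hL.congr' ?_⟩
    have hJ0 := J1_eq_pulledBackValue (γ := γ) (U := U) (ω' := ω) (P := ContinuousLinearMap.id ℝ _)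
      (Q := ContinuousLinearMap.id ℝ _) (χ := χ) (fun v => hχ v) (fun _ => rfl) (fun _ h => h)
      (fun _ h => h) hbs
    filter_upwards [Ioo_mem_nhdsGT (lt_min hP.pos hτ)] with t ht
    obtain ⟨Θ, hF, hTr⟩ := hPQ t ⟨ht.1, ht.2.trans_le (min_le_left _ _)⟩
    have htτ : t ∈ Icc 0 (tau Ω X) := ⟨ht.1.le, (ht.2.trans_le (min_le_right _ _)).le⟩
    have hJ := J1_eq_pulledBackValue (γ := γ) (U := U) (ω' := perturb X t '' ω) (P := P t)
      (Q := Q t) (χ := χ) (fun v => hTr.push_cutoff hF hωΩ (hχ v)) (hTr.push_pull hF)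
      (fun v hv => (hTr.mem_of_invariant hΩ hF hX hUinv htτ hv).1)
      (fun v hv => (hTr.mem_of_invariant hΩ hF hX hUinv htτ hv).2) hbs
    exact (congrArg₂ (fun p q : ℝ => (p - q) / t) hJ hJ0).symm
  · refine ⟨0, ?_⟩
    have himg : ∀ t : ℝ, perturb X t '' ω = ω := fun t => by
      have : EqOn (perturb X t) id ω := fun x hx => by
        rw [perturb, hX0 x (hωΩ hx), smul_zero, add_zero, id]
      rw [this.image_eq, image_id]
    unfold HasShapeDeriv
    simp only [himg, sub_self, zero_div]
    exact tendsto_const_nhds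

end ShapeDerivative

end ActuatorDesign

end

theorem corollary3p7 {d : ℕ} (Ω : Set (EuclideanSpace ℝ (Fin d))) (hΩ : IsOpen Ω)
    (T γ : ℝ) (hT : 0 < T) (hγ : 0 < γ)
    (U : Set (ActuatorDesign.L2 Ω)) (hUclosed : IsClosed U) (hUconvex : Convex ℝ U)
    (hUzero : (0 : ActuatorDesign.L2 Ω) ∈ U)
    (hUinv : ActuatorDesign.InvariantUnderPerturbations Ω U)
    (hUsymm : ∀ v ∈ U, -v ∈ U)
    (ω : Set (EuclideanSpace ℝ (Fin d))) (hω : NullMeasurableSet ω volume) (hωΩ : ω ⊆ Ω)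
    (f : ActuatorDesign.H10 Ω)
    (X : EuclideanSpace ℝ (Fin d) → EuclideanSpace ℝ (Fin d))
    (hX : ActuatorDesign.IsC01Zero Ω X) :
    ∃ L : ℝ,
      ActuatorDesign.HasShapeDeriv (fun ω' => ActuatorDesign.J1 Ω T γ U ω' (-f)) ω X L ∧
      ActuatorDesign.HasShapeDeriv (fun ω' => ActuatorDesign.J1 Ω T γ U ω' f) ω X L := by
  obtain ⟨L, hL⟩ := ActuatorDesign.exists_hasShapeDeriv hΩ hT hγ hUclosed hUconvex hUzero hUinv
    hω hωΩ f hX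
  refine ⟨L, ?_, hL⟩
  simp only [ActuatorDesign.J1_neg hUsymm]
  exact hL
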